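/- Let $\chi\in C_0^\infty(\mathbb R)$ be non-increasing on $[0,\infty)$ and let $v(x)=\chi(|x|)/|x|$ on $\mathbb R^3$ (so $v\ge 0$). Consider the Hartree equation $$ i\,\partial_t\phi+\Delta\phi-(v*|\phi|^2)\,\phi=0,\qquad \phi(0,\cdot)=\phi_0, \qquad x\in\mathbb R^3 .$$ By a global smooth solution we mean a function $\phi:[0,\infty)\times\mathbb R^3\to\mathbb C$ that is $C^\infty$ on $[0,\infty)\times\mathbb R^3$, satisfies the equation pointwise, and is bounded in $H^2(\mathbb R^3)$ on every bounded time interval. Put $W=v*|\phi|^2$, $\rho=\tfrac12|\phi|^2$, $p_j=\tfrac1{2i}(\phi\,\partial_j\overline\phi-\overline\phi\,\partial_j\phi)$, $e=|\nabla\phi|^2+W\rho$, and let $$E_c(t)=\int_{\mathbb R^3}\Big(\tfrac{|x|^2}{2}\rho+t\,x^jp_j+t^2e\Big)\,dx=t^2\int_{\mathbb R^3}\Big(\big|\nabla\big(e^{-i|x|^2/4t}\phi\big)\big|^2+W\rho\Big)\,dx$$ be the pseudoconformal energy (the second expression for $t>0$). Let $\phi$ be a global smooth solution such that $E_c(1)$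 is finite. Then there is a constant $C$, depending only on $\chi$ and on upper bounds for $\|\phi_0\|_{L^2}$ and $E_c(1)$, such that for all $t\ge 1$ $$\|\phi(t,\cdot)\|_{L^6(\mathbb R^3)}\le C\,t^{-3/4},\qquad \|\phi(t,\cdot)\|_{L^4(\mathbb R^3)}\le C\,t^{-9/16},$$ and $$\int_1^\infty\|\phi(t,\cdot)\|_{L^6(\mathbb R^3)}^2\,dt\le C,\qquad \int_1^\infty\|\phi(t,\cdot)\|_{L^4(\mathbb R^3)}^2\,dt\le C .$$ -/

import Mathlib

open MeasureTheory Set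
open scoped ContDiff ENNReal

noncomputable section

namespace Hartree

/-- Physical space `ℝ³` with its Euclidean norm and Lebesgue measure. -/
abbrev E3 : Type := EuclideanSpace ℝ (Fin 3)

/-- A decreasing cut-off profile `r ↦ χ(r)`: smooth, compactly supported and non-increasing on
`[0, ∞)`. In particular `χ ≥ 0` on `[0, ∞)`. -/
structure IsDecreasingCutoff (χ : ℝ → ℝ) : Prop where
  smooth : ContDiff ℝ ∞ χ
  compactSupport : HasCompactSupport χ
  decreasing : AntitoneOn χ (Ici 0)

/-- The truncated repulsive Coulomb potential `v(x) = χ(|x|) / |x|`. -/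
def potential (χ : ℝ → ℝ) (x : E3) : ℝ := χ ‖x‖ / ‖x‖

/-- The mean field `W = v * |f|²`. -/
def meanField (v : E3 → ℝ) (f : E3 → ℂ) (x : E3) : ℝ := ∫ y, v (x - y) * ‖f y‖ ^ 2

/-- The partial derivative `∇_j f`. -/
def partialDeriv (j : Fin 3) (f : E3 → ℂ) (x : E3) : ℂ :=
  fderiv ℝ f x (EuclideanSpace.single j 1)

/-- `φ(t, x)` is a global smooth solution of `i ∂ₜφ + Δφ - (v * |φ|²) φ = 0` with `φ(0) = φ₀`:
it is smooth on `[0, ∞) × ℝ³`, satisfies the equation pointwise, and `φ(t)` is bounded in the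
Sobolev space `H²(ℝ³)` on bounded time intervals. -/
structure IsGlobalSmoothSolution (v : E3 → ℝ) (φ₀ : E3 → ℂ) (φ : ℝ → E3 → ℂ) : Prop where
  smooth : ContDiffOn ℝ ∞ (fun z : ℝ × E3 => φ z.1 z.2) (Ici 0 ×ˢ univ)
  initial : φ 0 = φ₀
  equation : ∀ t : ℝ, 0 < t → ∀ x : E3,
    Complex.I * deriv (fun s => φ s x) t + Laplacian.laplacian (φ t) x
      - (meanField v (φ t) x : ℂ) * φ t x = 0
  sobolev : ∀ T : ℝ, ∃ B : ℝ, ∀ t ∈ Icc 0 T, ∀ k : ℕ, k ≤ 2 →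
    eLpNorm (iteratedFDeriv ℝ k (φ t)) 2 volume ≤ ENNReal.ofReal B

/-- The mass density `ρ = |f|² / 2`. -/
def massDensity (f : E3 → ℂ) (x : E3) : ℝ := (1 / 2) * ‖f x‖ ^ 2

/-- The momentum density `p_j = (1/2i) (f ∇_j f̄ - f̄ ∇_j f)`, which is a real number. -/
def momentumDensity (j : Fin 3) (f : E3 → ℂ) (x : E3) : ℝ :=
  (1 / (2 * Complex.I) *
    (f x * (starRingEnd ℂ) (partialDeriv j f x)
      - (starRingEnd ℂ) (f x) * partialDeriv j f x)).re

/-- The trace `σ = ∑_j σ_jj = 2 ∑_j |∇_j f|²` of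
`σ_jk = ∇_j f̄ ∇_k f + ∇_k f̄ ∇_j f`. -/
def stressTrace (f : E3 → ℂ) (x : E3) : ℝ := ∑ j : Fin 3, 2 * ‖partialDeriv j f x‖ ^ 2

/-- The energy density `e = σ / 2 + W ρ`. -/
def energyDensity (v : E3 → ℝ) (f : E3 → ℂ) (x : E3) : ℝ :=
  (1 / 2) * stressTrace f x + meanField v f x * massDensity f x

/-- The pseudoconformal energy density `e_c = (|x|² / 2) ρ + t x^j p_j + t² e` at time `t`. -/
def pseudoconformalDensity (v : E3 → ℝ) (φ : ℝ → E3 → ℂ) (t : ℝ) (x : E3) : ℝ :=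
  ‖x‖ ^ 2 / 2 * massDensity (φ t) x + t * ∑ j : Fin 3, x j * momentumDensity j (φ t) x
    + t ^ 2 * energyDensity v (φ t) x

/-- The pseudoconformal energy `E_c(t) = ∫ e_c(t, x) dx`; it is finite when the (non-negative, for
`v ≥ 0`) density is integrable. -/
def pseudoconformalEnergy (v : E3 → ℝ) (φ : ℝ → E3 → ℂ) (t : ℝ) : ℝ :=
  ∫ x, pseudoconformalDensity v φ t x

end Hartree

end

noncomputable section

namespace Hartree

open Filter Topology
open scoped NNReal ComplexConjugate

/-! ### Cut-off functions -/

/-! Put `Ψ(t, y) = t^{3/2} e^{-it|y|²/4} φ(t, ty)`. This change of variables keeps the time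
variable, preserves the L² norm, and turns the equation into `i ∂ₜΨ + t⁻² ΔΨ - VΨ = 0` with `V(t, y)
= ∫ v(t(y - y')) |Ψ(t, y')|² dy'` (`schrodinger_pseudoconformal`). The pseudoconformal energy
becomes `K + I`, where `K = ∫ |∇Ψ|²` and `I = ½ ∬ t² v(t(y - y')) |Ψ(y)|² |Ψ(y')|²`. In the time
derivative of a weighted energy `w(t)(K + I)` the terms containing `∂ₜ|Ψ|²` cancel. What remains is
`w' K` and the interaction through the kernel `∂ₜ(w t² v(tx))` (`energy_law`).

Since `t² v(tx) = t χ(t|x|)/|x|`, two weights suffice. For `w = 1/t` the remaining kernel is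
`χ'(t|x|) ≤ 0`, and `w' ≤ 0`; hence `K(t) ≤ E t` (`kinetic_le_linear`). For `w = 1` the remaining
kernel is at most `t v(tx)`, whose L¹ norm is of order `t⁻²`. The rate of growth of the energy is
therefore at most `t⁻² ‖Ψ‖₄⁴ ‖v‖₁`. By interpolation and Sobolev `‖Ψ‖₄⁴ ≤ ‖Ψ‖₂ ‖Ψ‖₆³ ≲ K^{3/2}`, and
the linear bound makes this `t^{3/2}`. Integrating `t^{-1/2}` gives `K(t) ≲ t^{1/2}`
(`kinetic_le_sqrt`).

Undoing the transform, `t⁶ ‖φ‖₆⁶ = ‖Ψ‖₆⁶ ≲ K³ ≲ t^{3/2}`, which is the L⁶ rate. Interpolation with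
the mass gives the L⁴ rate, and both rates are square integrable at infinity.

The remaining work justifies the formal identities. Flux terms are removed with cut-offs
(`balance`). As `∂ₜΨ` grows in `y`, this requires a finite second moment of `φ`: it holds at time
one because `E_c(1)` is finite (`integrable_moment`) and propagates by a Gronwall argument
(`exists_moment_le`). -/

/-- A fixed smooth bump, equal to `1` on the unit ball and supported in the ball of radius `2`. -/
def unitBump : ContDiffBump (0 : E3) := ⟨1, 2, one_pos, one_lt_two⟩

/-- The dilated cut-off `x ↦ η(x / (n + 1))`. -/
def cutoff (n : ℕ) (x : E3) : ℝ := unitBump ((n + 1 : ℝ)⁻¹ • x)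

lemma contDiff_cutoff (n : ℕ) : ContDiff ℝ ∞ (cutoff n) :=
  unitBump.contDiff.comp (contDiff_const_smul _)

lemma cutoff_nonneg (n : ℕ) (x : E3) : 0 ≤ cutoff n x := unitBump.nonneg

lemma cutoff_le_one (n : ℕ) (x : E3) : cutoff n x ≤ 1 := unitBump.le_one

lemma hasCompactSupport_cutoff (n : ℕ) : HasCompactSupport (cutoff n) :=
  unitBump.hasCompactSupport.comp_smul (inv_ne_zero (by positivity))

lemma cutoff_eventuallyEq_one (x : E3) : ∀ᶠ n in atTop, cutoff n =ᶠ[𝓝 x] fun _ => 1 := by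
  obtain ⟨m, hm⟩ := exists_nat_gt ‖x‖
  filter_upwards [eventually_ge_atTop m] with n hn
  have hx : x ∈ Metric.ball (0 : E3) (n + 1) := by
    have : (m : ℝ) ≤ n := by exact_mod_cast hn
    simp only [mem_ball_zero_iff]
    linarith
  filter_upwards [Metric.isOpen_ball.mem_nhds hx] with y hy
  apply unitBump.one_of_mem_closedBall
  simp only [mem_ball_zero_iff] at hy
  simp only [mem_closedBall_zero_iff, norm_smul, norm_inv]
  have : ‖(n + 1 : ℝ)‖ = n + 1 := Real.norm_of_nonneg (by positivity)
  rw [this, inv_mul_le_iff₀ (by positivity)]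
  change ‖y‖ ≤ (n + 1) * 1
  linarith

lemma tendsto_cutoff (x : E3) : Tendsto (fun n => cutoff n x) atTop (𝓝 1) :=
  tendsto_const_nhds.congr' ((cutoff_eventuallyEq_one x).mono fun _ h => h.eq_of_nhds.symm)

lemma tendsto_fderiv_cutoff (x e : E3) :
    Tendsto (fun n => fderiv ℝ (cutoff n) x e) atTop (𝓝 0) := by
  refine tendsto_const_nhds.congr' ((cutoff_eventuallyEq_one x).mono fun _ h => ?_)
  simp [h.fderiv_eq]

lemma fderiv_cutoff (n : ℕ) (x : E3) :
    fderiv ℝ (cutoff n) x = (n + 1 : ℝ)⁻¹ • fderiv ℝ unitBump ((n + 1 : ℝ)⁻¹ • x) :=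
  fderiv_comp_smul _

/-- Scaling gives the decay in `n`. The gradient lives where `‖x‖ ≤ 2(n + 1)`, so this decay can be
traded for decay in `x` uniform in `n`. The first bound kills L² errors; the second dominates fluxes
that are integrable only after division by `1 + ‖x‖`. -/
lemma exists_norm_fderiv_cutoff_le : ∃ L : ℝ, 0 ≤ L ∧ ∀ n x,
    ‖fderiv ℝ (cutoff n) x‖ ≤ L / (n + 1) ∧ ‖fderiv ℝ (cutoff n) x‖ ≤ L / (1 + ‖x‖) := by
  obtain ⟨L, hL⟩ := (unitBump.hasCompactSupport.fderiv (𝕜 := ℝ)).exists_bound_of_continuous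
    ((unitBump.contDiff (n := 1)).continuous_fderiv one_ne_zero)
  have hL0 : 0 ≤ L := (norm_nonneg _).trans (hL 0)
  have key : ∀ (n : ℕ) x, ‖fderiv ℝ (cutoff n) x‖ ≤ L / (n + 1) := fun n x => by
    rw [fderiv_cutoff, norm_smul, norm_inv, Real.norm_of_nonneg (by positivity : (0 : ℝ) ≤ n + 1),
      div_eq_inv_mul]
    gcongr
    exact hL _
  -- On the support of the gradient `1 + ‖x‖ ≤ 3 (n + 1)`.
  refine ⟨3 * L, by positivity, fun n x => ⟨(key n x).trans (by gcongr; linarith), ?_⟩⟩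
  by_cases hx : ‖x‖ ≤ 2 * (n + 1)
  · refine (key n x).trans ?_
    rw [div_le_div_iff₀ (by positivity) (by positivity)]
    have : 0 ≤ L * (2 * (n + 1) - ‖x‖) := mul_nonneg hL0 (by linarith)
    nlinarith [mul_nonneg hL0 (Nat.cast_nonneg (α := ℝ) n)]
  · have : fderiv ℝ unitBump ((n + 1 : ℝ)⁻¹ • x) = 0 := by
      by_contra h
      have h2 := support_fderiv_subset ℝ (Function.mem_support.2 h)
      rw [unitBump.tsupport_eq, mem_closedBall_zero_iff, norm_smul, norm_inv,
        Real.norm_of_nonneg (by positivity : (0 : ℝ) ≤ n + 1),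
        inv_mul_le_iff₀ (by positivity)] at h2
      change ‖x‖ ≤ (n + 1) * 2 at h2
      linarith
    rw [fderiv_cutoff, this, smul_zero, norm_zero]
    positivity

/-! ### The Sobolev inequality and interpolation -/

lemma exists_sobolev_const_of_hasCompactSupport : ∃ C : ℝ≥0, ∀ u : E3 → ℂ, ContDiff ℝ 1 u →
    HasCompactSupport u → eLpNorm u 6 volume ≤ C * eLpNorm (fderiv ℝ u) 2 volume := by
  refine ⟨SNormLESNormFDerivOfEqConst ℂ (volume : Measure E3) ((2 : ℝ≥0) : ℝ), fun u hu hc => ?_⟩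
  have h1 := eLpNorm_le_eLpNorm_fderiv_of_eq (volume : Measure E3) hu hc (p := 2) (p' := 6)
    (by norm_num) (by simp) (by simp; norm_num)
  rw [show ((2 : ℝ≥0) : ℝ≥0∞) = 2 by norm_num, show ((6 : ℝ≥0) : ℝ≥0∞) = 6 by norm_num] at h1
  exact h1

lemma norm_fderiv_cutoff_smul_le {u : E3 → ℂ} (hu : ContDiff ℝ 1 u) {n : ℕ} {x : E3} {c : ℝ}
    (hc : ‖fderiv ℝ (cutoff n) x‖ ≤ c) :
    ‖fderiv ℝ (fun x => cutoff n x • u x) x‖ ≤ ‖fderiv ℝ u x‖ + c * ‖u x‖ := by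
  rw [fderiv_fun_smul ((contDiff_cutoff n).differentiable (by simp) x)
    (hu.differentiable one_ne_zero x)]
  refine (norm_add_le _ _).trans (add_le_add ?_ ?_)
  · rw [norm_smul, Real.norm_of_nonneg (cutoff_nonneg n x)]
    exact mul_le_of_le_one_left (norm_nonneg _) (cutoff_le_one n x)
  · rw [ContinuousLinearMap.norm_smulRight_apply]
    gcongr

/-- Apply the compactly supported inequality to `cutoff n • u`. The product rule costs `L / (n + 1)
* ‖u‖₂`, which vanishes in the limit, and Fatou recovers `u` with the same constant. -/
lemma exists_sobolev_const : ∃ C : ℝ≥0, ∀ u : E3 → ℂ, ContDiff ℝ 1 u → eLpNorm u 2 volume ≠ ⊤ →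
    eLpNorm u 6 volume ≤ C * eLpNorm (fderiv ℝ u) 2 volume := by
  obtain ⟨L, hL0, hL⟩ := exists_norm_fderiv_cutoff_le
  obtain ⟨C, hC⟩ := exists_sobolev_const_of_hasCompactSupport
  refine ⟨C, fun u hu hu2 => ?_⟩
  have hcd : ∀ n, ContDiff ℝ 1 (fun x => (cutoff n x) • u x) := fun n =>
    ((contDiff_cutoff n).of_le (by exact_mod_cast le_top)).smul hu
  have hstep : ∀ n : ℕ, eLpNorm (fun x => (cutoff n x) • u x) 6 volume ≤
      C * (eLpNorm (fderiv ℝ u) 2 volume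
        + ENNReal.ofReal (L / (n + 1)) * eLpNorm u 2 volume) := fun n => by
    refine (hC _ (hcd n) ((hasCompactSupport_cutoff n).smul_right)).trans ?_
    gcongr
    have hcu := hu.continuous_fderiv one_ne_zero
    refine (eLpNorm_mono_real (g := (fun x => ‖fderiv ℝ u x‖) + fun x => L / (n + 1) * ‖u x‖)
      (fun x => norm_fderiv_cutoff_smul_le hu ((hL n x).1))).trans ?_
    refine (eLpNorm_add_le hcu.norm.aestronglyMeasurable
      (hu.continuous.norm.const_mul _).aestronglyMeasurable (by norm_num)).trans ?_
    rw [eLpNorm_norm]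
    gcongr
    refine eLpNorm_le_mul_eLpNorm_of_ae_le_mul (ae_of_all _ fun x => ?_) 2
    rw [norm_mul, norm_norm, Real.norm_of_nonneg (by positivity)]
  refine (Lp.eLpNorm_lim_le_liminf_eLpNorm (fun n => (hcd n).continuous.aestronglyMeasurable) u
    (ae_of_all _ fun x => ?_)).trans ?_
  · simpa using (tendsto_cutoff x).smul_const (u x)
  · refine (liminf_le_liminf (Eventually.of_forall hstep)).trans (le_of_eq ?_)
    refine Tendsto.liminf_eq ?_
    have h3 : Tendsto (fun n : ℕ => ENNReal.ofReal (L / (n + 1))) atTop (𝓝 0) := by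
      rw [← ENNReal.ofReal_zero]
      refine ENNReal.tendsto_ofReal ?_
      have := (tendsto_one_div_add_atTop_nhds_zero_nat (𝕜 := ℝ)).const_mul L
      simpa [div_eq_mul_inv] using this
    have h4 := ENNReal.Tendsto.mul_const h3 (Or.inr hu2) (b := eLpNorm u 2 volume)
    rw [zero_mul] at h4
    have h5 := ENNReal.Tendsto.const_mul (h4.const_add (eLpNorm (fderiv ℝ u) 2 volume))
      (Or.inr (ENNReal.coe_ne_top (r := C)))
    simpa using h5

lemma lintegral_enorm_pow {α F : Type*} [MeasurableSpace α] {μ : Measure α} [NormedAddCommGroup F]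
    (f : α → F) {n : ℕ} (hn : n ≠ 0) : ∫⁻ x, ‖f x‖ₑ ^ n ∂μ = eLpNorm f n μ ^ n := by
  have := eLpNorm_nnreal_pow_eq_lintegral (f := f) (μ := μ) (p := (n : ℝ≥0)) (by exact_mod_cast hn)
  simpa using this.symm

/-- Cauchy–Schwarz for the splitting `|u|⁴ = |u| · |u|³`, squared. -/
lemma lintegral_pow_four_le {u : E3 → ℂ} (hu : Continuous u) :
    (∫⁻ x, ‖u x‖ₑ ^ 4) ^ 2 ≤ (∫⁻ x, ‖u x‖ₑ ^ 2) * ∫⁻ x, ‖u x‖ₑ ^ 6 := by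
  have h := ENNReal.lintegral_mul_le_Lp_mul_Lq (volume : Measure E3) Real.HolderConjugate.two_two
    (f := fun x => ‖u x‖ₑ) (g := fun x => ‖u x‖ₑ ^ 3) hu.enorm.aemeasurable
    (hu.enorm.measurable.pow_const 3).aemeasurable
  have h2 := pow_le_pow_left₀ (zero_le) h 2
  rw [mul_pow, ← ENNReal.rpow_natCast (_ ^ (1 / 2 : ℝ)), ← ENNReal.rpow_natCast (_ ^ (1 / 2 : ℝ)),
    ← ENNReal.rpow_mul, ← ENNReal.rpow_mul] at h2
  norm_num [← pow_mul] at h2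
  simpa only [Pi.mul_apply, ← pow_succ'] using h2

/-! ### The potential -/

namespace IsDecreasingCutoff

variable {χ : ℝ → ℝ} (hχ : IsDecreasingCutoff χ)
include hχ

/-- A non-increasing profile that vanishes far out cannot be negative before. -/
lemma nonneg {r : ℝ} (hr : 0 ≤ r) : 0 ≤ χ r := by
  obtain ⟨R, hR⟩ := hχ.compactSupport.isCompact.isBounded.subset_closedBall 0
  have h0 : χ (max r (R + 1)) = 0 := by
    refine image_eq_zero_of_notMem_tsupport fun h => ?_
    have := hR h
    rw [mem_closedBall_zero_iff, Real.norm_eq_abs] at this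
    have := (le_abs_self _).trans this
    linarith [le_max_right r (R + 1)]
  rw [← h0]
  exact hχ.decreasing hr (hr.trans (le_max_left _ _)) (le_max_left _ _)

lemma potential_nonneg (x : E3) : 0 ≤ potential χ x :=
  div_nonneg (hχ.nonneg (norm_nonneg _)) (norm_nonneg _)

lemma deriv_nonpos {r : ℝ} (hr : 0 < r) : deriv χ r ≤ 0 := by
  have h := hχ.decreasing.derivWithin_nonpos (x := r)
  rwa [derivWithin_of_mem_nhds (Ici_mem_nhds hr)] at h

lemma measurable_potential : Measurable (potential χ) :=
  (hχ.smooth.continuous.comp continuous_norm).measurable.div continuous_norm.measurable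

lemma integrable_potential : Integrable (potential χ) := by
  refine (integrable_fun_norm_addHaar volume (f := fun r => χ r / r)).2 ?_
  have hc : Continuous fun y : ℝ => y * χ y := continuous_id.mul hχ.smooth.continuous
  refine ((hc.integrable_of_hasCompactSupport hχ.compactSupport.mul_left).integrableOn).congr_fun
    (fun y (hy : 0 < y) => ?_) measurableSet_Ioi
  simp
  field_simp

/-- In polar coordinates the Jacobian `r²` exactly absorbs the singularity `r⁻²`. Having `v` in L²
as well as in L¹ makes the mean field of an L² density bounded. -/
lemma integrable_potential_sq : Integrable fun x => potential χ x ^ 2 := by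
  refine (integrable_fun_norm_addHaar volume (f := fun r => (χ r / r) ^ 2)).2 ?_
  have hc : Continuous fun y : ℝ => χ y * χ y := hχ.smooth.continuous.mul hχ.smooth.continuous
  refine ((hc.integrable_of_hasCompactSupport hχ.compactSupport.mul_left).integrableOn).congr_fun
    (fun y (hy : 0 < y) => ?_) measurableSet_Ioi
  simp
  field_simp

/-- Dilating outward lowers `χ` and raises the denominator. Every dilated kernel at times `t ≥ 1` is
thus dominated by the single function `v`. -/
lemma potential_smul_le {t : ℝ} (ht : 1 ≤ t) (x : E3) : potential χ (t • x) ≤ potential χ x := by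
  have ht0 : 0 < t := by linarith
  rcases eq_or_ne x 0 with rfl | hx
  · simp
  have hx' : 0 < ‖x‖ := norm_pos_iff.2 hx
  have hle : ‖x‖ ≤ ‖t • x‖ := by
    rw [norm_smul, Real.norm_of_nonneg ht0.le]
    exact le_mul_of_one_le_left hx'.le ht
  exact div_le_div₀ (hχ.nonneg hx'.le) (hχ.decreasing hx'.le (hx'.le.trans hle) hle) hx' hle

end IsDecreasingCutoff

lemma potential_neg (χ : ℝ → ℝ) (x : E3) : potential χ (-x) = potential χ x := by
  simp [potential]

/-- In this form time enters only through a power of `t` and `χ(t‖x‖)`, so differentiating in `t`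
never touches the singularity at the origin. -/
lemma sq_mul_potential_smul (χ : ℝ → ℝ) {t : ℝ} (ht : 0 < t) (x : E3) :
    t ^ 2 * potential χ (t • x) = t * χ (t * ‖x‖) / ‖x‖ := by
  rw [potential, norm_smul, Real.norm_of_nonneg ht.le]
  rcases eq_or_ne ‖x‖ 0 with hx | hx
  · simp [hx]
  · field_simp

/-- The time derivative of `w(t) t² v(t x)`. -/
def kernelDeriv (χ w w' : ℝ → ℝ) (t : ℝ) (x : E3) : ℝ :=
  ((w' t * t + w t) * χ (t * ‖x‖) + w t * t * (deriv χ (t * ‖x‖) * ‖x‖)) / ‖x‖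

lemma hasDerivAt_kernel {χ : ℝ → ℝ} (hχ : ContDiff ℝ ∞ χ) {w w' : ℝ → ℝ} {t : ℝ} (ht : 0 < t)
    (hw : HasDerivAt w (w' t) t) (x : E3) :
    HasDerivAt (fun s => w s * (s ^ 2 * potential χ (s • x))) (kernelDeriv χ w w' t x) t := by
  have h1 : HasDerivAt (fun s => χ (s * ‖x‖)) (deriv χ (t * ‖x‖) * ‖x‖) t := by
    have := (hχ.differentiable (by simp) (t * ‖x‖)).hasDerivAt.scomp t (hasDerivAt_mul_const ‖x‖)
    exact this.congr_deriv (by rw [smul_eq_mul, mul_comm])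
  have h2 := ((hw.mul (hasDerivAt_id t)).mul h1).div_const ‖x‖
  refine (h2.congr_of_eventuallyEq ?_).congr_deriv ?_
  · filter_upwards [lt_mem_nhds ht] with s hs
    rw [sq_mul_potential_smul χ hs]
    simp
    ring
  · simp [kernelDeriv]

lemma continuousOn_kernelDeriv {χ : ℝ → ℝ} (hχ : ContDiff ℝ ∞ χ) {w w' : ℝ → ℝ} {s : Set ℝ}
    (hw : ContinuousOn w s) (hw' : ContinuousOn w' s) (x : E3) :
    ContinuousOn (fun t => kernelDeriv χ w w' t x) s := by
  have h1 := hχ.continuous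
  have h2 : Continuous (deriv χ) := hχ.continuous_deriv (by simp)
  unfold kernelDeriv
  fun_prop

/-! ### Local conservation laws -/

/-- Space-time at positive times. -/
def posTime : Set (ℝ × E3) := Ioi 0 ×ˢ univ

/-- The unit vector of `ℝ × ℝ³` in the time direction. -/
def timeDir : ℝ × E3 := (1, 0)

/-- The unit vector of `ℝ × ℝ³` in the `j`-th space direction. -/
def spaceDir (j : Fin 3) : ℝ × E3 := (0, EuclideanSpace.single j 1)

lemma isOpen_posTime : IsOpen posTime := isOpen_Ioi.prod isOpen_univ

lemma mem_posTime {t : ℝ} (ht : 0 < t) (x : E3) : (t, x) ∈ posTime := ⟨ht, mem_univ _⟩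

/-- Lebesgue measure on the slab `(a, b] × ℝ³`. -/
def slab (a b : ℝ) : Measure (ℝ × E3) := (volume.restrict (Ioc a b)).prod volume

section

variable {F : Type*} [NormedAddCommGroup F] [NormedSpace ℝ F] {f : ℝ × E3 → F}

lemma hasFDerivAt_of_contDiffOn {n : WithTop ℕ∞} (hf : ContDiffOn ℝ n f posTime) (hn : n ≠ 0)
    {t : ℝ} (ht : 0 < t) (x : E3) : HasFDerivAt f (fderiv ℝ f (t, x)) (t, x) :=
  ((hf.contDiffAt (isOpen_posTime.mem_nhds (mem_posTime ht x))).differentiableAt hn).hasFDerivAt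

lemma hasFDerivAt_slice {n : WithTop ℕ∞} (hf : ContDiffOn ℝ n f posTime) (hn : n ≠ 0)
    {t : ℝ} (ht : 0 < t) (x : E3) :
    HasFDerivAt (fun y => f (t, y)) ((fderiv ℝ f (t, x)).comp (ContinuousLinearMap.inr ℝ ℝ E3)) x :=
  (hasFDerivAt_of_contDiffOn hf hn ht x).comp x (hasFDerivAt_prodMk_right t x)

lemma fderiv_slice {n : WithTop ℕ∞} (hf : ContDiffOn ℝ n f posTime) (hn : n ≠ 0)
    {t : ℝ} (ht : 0 < t) (x : E3) (j : Fin 3) :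
    fderiv ℝ (fun y => f (t, y)) x (EuclideanSpace.single j 1) = fderiv ℝ f (t, x) (spaceDir j) := by
  rw [(hasFDerivAt_slice hf hn ht x).fderiv]
  rfl

lemma hasDerivAt_slice {n : WithTop ℕ∞} (hf : ContDiffOn ℝ n f posTime) (hn : n ≠ 0)
    {t : ℝ} (ht : 0 < t) (x : E3) :
    HasDerivAt (fun s => f (s, x)) (fderiv ℝ f (t, x) timeDir) t := by
  have h := ((hasFDerivAt_of_contDiffOn hf hn ht x).comp t
    (hasFDerivAt_prodMk_left t x)).hasDerivAt
  exact h

lemma contDiff_slice {n : WithTop ℕ∞} (hf : ContDiffOn ℝ n f posTime) {t : ℝ} (ht : 0 < t) :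
    ContDiff ℝ n (fun y => f (t, y)) := by
  have h : ContDiff ℝ n (fun y : E3 => (t, y)) := contDiff_prodMk_right t
  exact contDiffOn_univ.1 (hf.comp h.contDiffOn fun y _ => mem_posTime ht y)

lemma continuousOn_fderiv_apply {n : WithTop ℕ∞} (hf : ContDiffOn ℝ n f posTime) (hn : 1 ≤ n)
    (v : ℝ × E3) : ContinuousOn (fun z => fderiv ℝ f z v) posTime :=
  (hf.continuousOn_fderiv_of_isOpen isOpen_posTime hn).clm_apply continuousOn_const

lemma contDiffOn_fderiv_apply (hf : ContDiffOn ℝ ∞ f posTime) (v : ℝ × E3) :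
    ContDiffOn ℝ ∞ (fun z => fderiv ℝ f z v) posTime :=
  (hf.fderiv_of_isOpen isOpen_posTime (by simp)).clm_apply contDiffOn_const

end

/-- The fundamental theorem of calculus for each fixed `x`, followed by Fubini. Integrability of the
derivative on the product suffices; no dominating function uniform in time is needed. -/
lemma integral_sub_integral_eq {X : Type*} [MeasurableSpace X] {μ : Measure X} [SFinite μ]
    {F F' : ℝ → X → ℝ} {a b : ℝ} (hab : a ≤ b)
    (hF : ∀ x, ∀ t ∈ Icc a b, HasDerivAt (fun s => F s x) (F' t x) t)
    (hF' : ∀ x, ContinuousOn (fun t => F' t x) (Icc a b))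
    (hint : Integrable (fun z : ℝ × X => F' z.1 z.2) ((volume.restrict (Ioc a b)).prod μ))
    (ha : Integrable (F a) μ) (hb : Integrable (F b) μ) :
    (∫ x, F b x ∂μ) - ∫ x, F a x ∂μ = ∫ z, F' z.1 z.2 ∂((volume.restrict (Ioc a b)).prod μ) := by
  rw [integral_prod_symm _ hint, ← integral_sub hb ha]
  refine integral_congr_ae (ae_of_all _ fun x => ?_)
  simp only
  rw [← intervalIntegral.integral_of_le hab]
  have hu : uIcc a b = Icc a b := uIcc_of_le hab
  exact (intervalIntegral.integral_eq_sub_of_hasDerivAt (fun t ht => hF x t (hu ▸ ht))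
    ((hF' x).intervalIntegrable_of_Icc hab)).symm

lemma integrable_slab_of_continuousOn {f : ℝ × E3 → ℝ} {a b : ℝ} (ha : 0 < a)
    (hf : ContinuousOn f posTime) {K : Set E3} (hK : IsCompact K)
    (h0 : ∀ t, ∀ x ∉ K, f (t, x) = 0) : Integrable f (slab a b) := by
  have hsub : Icc a b ×ˢ K ⊆ posTime := fun z hz => ⟨lt_of_lt_of_le ha hz.1.1, mem_univ _⟩
  have h1 : IntegrableOn f (Icc a b ×ˢ K) :=
    (hf.mono hsub).integrableOn_compact (isCompact_Icc.prod hK)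
  have h2 : IntegrableOn f (Icc a b ×ˢ univ) := by
    refine h1.of_forall_sdiff_eq_zero (measurableSet_Icc.prod MeasurableSet.univ) fun z hz => ?_
    refine h0 z.1 z.2 fun hzK => hz.2 ⟨hz.1.1, hzK⟩
  have h3 : slab a b = volume.restrict (Ioc a b ×ˢ univ) := by
    rw [slab, Measure.volume_eq_prod, ← Measure.prod_restrict, Measure.restrict_univ]
  rw [h3]
  exact h2.mono_set (prod_mono Ioc_subset_Icc_self le_rfl)

/-- The source term of the balance law `∂ₜF = div G + source`. -/
def source (F : ℝ × E3 → ℝ) (G : Fin 3 → ℝ × E3 → ℝ) (z : ℝ × E3) : ℝ :=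
  fderiv ℝ F z timeDir - ∑ j, fderiv ℝ (G j) z (spaceDir j)

section

variable {F : ℝ × E3 → ℝ} {G : Fin 3 → ℝ × E3 → ℝ} (hF : ContDiffOn ℝ 1 F posTime)
  (hG : ∀ j, ContDiffOn ℝ 1 (G j) posTime) {a b : ℝ} (ha : 0 < a) (hab : a ≤ b)

include hF hG in
lemma continuousOn_source : ContinuousOn (source F G) posTime :=
  (continuousOn_fderiv_apply hF le_rfl _).sub
    (continuousOn_finsetSum _ fun j _ => continuousOn_fderiv_apply (hG j) le_rfl _)

include hF hG ha hab in
-- Compact support of `η` makes all terms integrable on the slab. The time derivative is integrated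
-- along each line, and the divergence is moved onto `η` slice by slice.
lemma weighted_balance {η : E3 → ℝ} (hη : ContDiff ℝ 1 η) (hηc : HasCompactSupport η) :
    Integrable (fun z => η z.2 * source F G z
      - ∑ j, fderiv ℝ η z.2 (EuclideanSpace.single j 1) * G j z) (slab a b) ∧
    (∫ x, η x * F (b, x)) - ∫ x, η x * F (a, x) = ∫ z, (η z.2 * source F G z
      - ∑ j, fderiv ℝ η z.2 (EuclideanSpace.single j 1) * G j z) ∂(slab a b) := by
  have hb : 0 < b := ha.trans_le hab
  have hK := hηc.isCompact
  have hη0 : ∀ x ∉ tsupport η, η x = 0 := fun x hx => image_eq_zero_of_notMem_tsupport hx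
  have hdη0 : ∀ (e : E3), ∀ x ∉ tsupport η, fderiv ℝ η x e = 0 := fun e x hx => by
    rw [image_eq_zero_of_notMem_tsupport (fun h => hx (tsupport_fderiv_subset ℝ h))]
    rfl
  have hηs : Continuous fun z : ℝ × E3 => η z.2 := hη.continuous.comp continuous_snd
  have hdηc : ∀ e : E3, Continuous fun x => fderiv ℝ η x e := fun e =>
    (hη.continuous_fderiv one_ne_zero).clm_apply continuous_const
  have hslice : ∀ {t : ℝ}, 0 < t → Integrable fun x => η x * F (t, x) := fun ht =>
    (hη.continuous.mul (contDiff_slice hF ht).continuous).integrable_of_hasCompactSupport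
      hηc.mul_right
  have hcF := continuousOn_fderiv_apply hF le_rfl timeDir
  have hint1 : Integrable (fun z : ℝ × E3 => η z.2 * fderiv ℝ F z timeDir) (slab a b) :=
    integrable_slab_of_continuousOn ha (hηs.continuousOn.mul hcF) hK
      fun t x hx => by simp [hη0 x hx]
  have hint2 : Integrable (fun z : ℝ × E3 => η z.2 * source F G z
      - ∑ j, fderiv ℝ η z.2 (EuclideanSpace.single j 1) * G j z) (slab a b) := by
    refine integrable_slab_of_continuousOn ha ((hηs.continuousOn.mul
      (continuousOn_source hF hG)).sub (continuousOn_finsetSum _ fun j _ => ?_)) hK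
      fun t x hx => by simp [hη0 x hx, hdη0 _ x hx]
    exact ((hdηc _).comp continuous_snd).continuousOn.mul (hG j).continuousOn
  have key := integral_sub_integral_eq (μ := (volume : Measure E3)) (F := fun t x => η x * F (t, x))
    (F' := fun t x => η x * fderiv ℝ F (t, x) timeDir) hab
    (fun x t ht => (hasDerivAt_slice hF one_ne_zero (ha.trans_le ht.1) x).const_mul _)
    (fun x => continuousOn_const.mul (hcF.comp (by fun_prop)
      fun t ht => mem_posTime (ha.trans_le ht.1) x))
    hint1 (hslice ha) (hslice hb)
  refine ⟨hint2, ?_⟩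
  rw [key, ← slab]
  rw [slab] at hint1 hint2 ⊢
  rw [integral_prod _ hint1, integral_prod _ hint2]
  refine setIntegral_congr_fun measurableSet_Ioc fun t ht => ?_
  have ht0 : 0 < t := ha.trans ht.1
  simp only
  have hGs : ∀ j, ContDiff ℝ 1 (fun x => G j (t, x)) := fun j => contDiff_slice (hG j) ht0
  have hGd : ∀ j, Continuous fun x => fderiv ℝ (G j) (t, x) (spaceDir j) := fun j => by
    simp only [← fderiv_slice (hG j) one_ne_zero ht0]
    exact ((hGs j).continuous_fderiv one_ne_zero).clm_apply continuous_const
  have hFd : Continuous fun x => fderiv ℝ F (t, x) timeDir :=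
    continuousOn_univ.1 (hcF.comp (by fun_prop) fun x _ => mem_posTime ht0 x)
  have i1 : ∀ j, Integrable fun x => η x * fderiv ℝ (G j) (t, x) (spaceDir j) := fun j =>
    (hη.continuous.mul (hGd j)).integrable_of_hasCompactSupport hηc.mul_right
  have i2 : ∀ j : Fin 3, Integrable fun x => fderiv ℝ η x (EuclideanSpace.single j 1) * G j (t, x) :=
    fun j => ((hdηc _).mul (hGs j).continuous).integrable_of_hasCompactSupport
      (hηc.fderiv_apply (𝕜 := ℝ) _).mul_right
  have i0 : Integrable fun x => η x * fderiv ℝ F (t, x) timeDir :=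
    (hη.continuous.mul hFd).integrable_of_hasCompactSupport hηc.mul_right
  have ibp : ∀ j, ∫ x, η x * fderiv ℝ (G j) (t, x) (spaceDir j) =
      - ∫ x, fderiv ℝ η x (EuclideanSpace.single j 1) * G j (t, x) := fun j => by
    have i1j := i1 j
    simp only [← fderiv_slice (hG j) one_ne_zero ht0] at i1j ⊢
    exact integral_mul_fderiv_eq_neg_fderiv_mul_of_integrable (i2 j) i1j
      ((hη.continuous.mul (hGs j).continuous).integrable_of_hasCompactSupport hηc.mul_right)
      (fun x _ => hη.differentiable one_ne_zero x) (fun x _ => (hGs j).differentiable one_ne_zero x)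
  have e1 : ∀ x, η x * source F G (t, x)
      - ∑ j, fderiv ℝ η x (EuclideanSpace.single j 1) * G j (t, x) =
      η x * fderiv ℝ F (t, x) timeDir - ∑ j, (η x * fderiv ℝ (G j) (t, x) (spaceDir j)
        + fderiv ℝ η x (EuclideanSpace.single j 1) * G j (t, x)) := fun x => by
    rw [source, mul_sub, Finset.mul_sum, Finset.sum_add_distrib]
    ring
  have i3 : ∀ j, Integrable fun x => η x * fderiv ℝ (G j) (t, x) (spaceDir j)
      + fderiv ℝ η x (EuclideanSpace.single j 1) * G j (t, x) := fun j => (i1 j).add (i2 j)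
  simp only [e1]
  rw [integral_sub i0 (integrable_finsetSum _ fun j _ => i3 j), integral_finsetSum _ fun j _ => i3 j]
  simp only [integral_add (i1 _) (i2 _), ibp]
  simp

include hF hG ha hab in
-- Let the cut-offs in `weighted_balance` tend to one. Their gradients tend to zero pointwise and
-- are at most `L / (1 + ‖x‖)`, so the flux disappears by dominated convergence even if it is
-- integrable only against that weight.
lemma balance (hFa : Integrable fun x => F (a, x)) (hFb : Integrable fun x => F (b, x))
    (hG1 : ∀ j, Integrable (fun z => G j z / (1 + ‖z.2‖)) (slab a b))
    (hS : Integrable (source F G) (slab a b)) :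
    (∫ x, F (b, x)) - ∫ x, F (a, x) = ∫ z, source F G z ∂(slab a b) := by
  obtain ⟨L, hL0, hL⟩ := exists_norm_fderiv_cutoff_le
  have hcut : ∀ (f : E3 → ℝ), Integrable f →
      Tendsto (fun n => ∫ x, cutoff n x * f x) atTop (𝓝 (∫ x, f x)) := fun f hf => by
    refine tendsto_integral_of_dominated_convergence (fun x => ‖f x‖) (fun n => ?_) hf.norm
      (fun n => ae_of_all _ fun x => ?_) (ae_of_all _ fun x => ?_)
    · exact (contDiff_cutoff n).continuous.aestronglyMeasurable.mul hf.aestronglyMeasurable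
    · rw [norm_mul, Real.norm_of_nonneg (cutoff_nonneg n x)]
      exact mul_le_of_le_one_left (norm_nonneg _) (cutoff_le_one n x)
    · simpa using (tendsto_cutoff x).mul_const (f x)
  have hbal := fun n => (weighted_balance hF hG ha hab
    ((contDiff_cutoff n).of_le (by exact_mod_cast le_top)) (hasCompactSupport_cutoff n)).2
  refine tendsto_nhds_unique ((hcut _ hFb).sub (hcut _ hFa)) ?_
  simp only [hbal]
  have hGj : ∀ j z, L * ‖G j z / (1 + ‖z.2‖)‖ = L / (1 + ‖z.2‖) * ‖G j z‖ := fun j z => by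
    rw [norm_div, Real.norm_of_nonneg (by positivity : 0 ≤ 1 + ‖z.2‖)]
    ring
  have hmG : ∀ j, AEStronglyMeasurable (G j) (slab a b) := fun j => by
    have h1 : Continuous fun z : ℝ × E3 => 1 + ‖z.2‖ := by fun_prop
    refine ((hG1 j).aestronglyMeasurable.mul h1.aestronglyMeasurable).congr (ae_of_all _ fun z => ?_)
    have : 1 + ‖z.2‖ ≠ 0 := by positivity
    simp [this]
  refine tendsto_integral_of_dominated_convergence
    (fun z => ‖source F G z‖ + ∑ j, L * ‖G j z / (1 + ‖z.2‖)‖) (fun n => ?_)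
    (hS.norm.add (integrable_finsetSum _ fun j _ => (hG1 j).norm.const_mul L))
    (fun n => ae_of_all _ fun z => ?_) (ae_of_all _ fun z => ?_)
  · refine (((contDiff_cutoff n).continuous.comp continuous_snd).aestronglyMeasurable.mul
      hS.aestronglyMeasurable).sub ?_
    refine Finset.aestronglyMeasurable_fun_sum _ fun j _ => ?_
    refine Continuous.aestronglyMeasurable ?_ |>.mul (hmG j)
    exact (((contDiff_cutoff n).continuous_fderiv (by simp)).clm_apply continuous_const).comp
      continuous_snd
  · refine (norm_sub_le _ _).trans (add_le_add ?_ ((norm_sum_le _ _).trans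
      (Finset.sum_le_sum fun j _ => ?_)))
    · rw [norm_mul, Real.norm_of_nonneg (cutoff_nonneg n _)]
      exact mul_le_of_le_one_left (norm_nonneg _) (cutoff_le_one n _)
    · rw [norm_mul, hGj]
      gcongr
      refine (ContinuousLinearMap.le_opNorm _ _).trans ?_
      simpa using (hL n z.2).2
  · have h1 := (tendsto_cutoff z.2).mul_const (source F G z)
    have h2 : Tendsto (fun n => ∑ j, fderiv ℝ (cutoff n) z.2 (EuclideanSpace.single j 1) * G j z)
        atTop (𝓝 (∑ j : Fin 3, 0 * G j z)) :=
      tendsto_finsetSum _ fun j _ => (tendsto_fderiv_cutoff z.2 _).mul_const _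
    simpa using h1.sub h2

end

/-! ### Densities and currents -/

section

variable {X : Type*} [NormedAddCommGroup X] [NormedSpace ℝ X] {f g : X → ℂ} {z : X}

lemma hasFDerivAt_conj_mul {f' g' : X →L[ℝ] ℂ} (hf : HasFDerivAt f f' z) (hg : HasFDerivAt g g' z) :
    HasFDerivAt (fun y => conj (f y) * g y)
      (conj (f z) • g' + g z • (Complex.conjCLE : ℂ →L[ℝ] ℂ).comp f') z :=
  ((Complex.conjCLE : ℂ →L[ℝ] ℂ).hasFDerivAt.comp z hf).mul hg

lemma fderiv_re_conj_mul (hf : DifferentiableAt ℝ f z) (hg : DifferentiableAt ℝ g z) (v : X) :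
    fderiv ℝ (fun y => (conj (f y) * g y).re) z v =
      (conj (f z) * fderiv ℝ g z v + conj (fderiv ℝ f z v) * g z).re := by
  have h : HasFDerivAt (fun y => (conj (f y) * g y).re) _ z := Complex.reCLM.hasFDerivAt.comp z
    (hasFDerivAt_conj_mul hf.hasFDerivAt hg.hasFDerivAt)
  rw [h.fderiv]
  simp
  ring

lemma fderiv_im_conj_mul (hf : DifferentiableAt ℝ f z) (hg : DifferentiableAt ℝ g z) (v : X) :
    fderiv ℝ (fun y => (conj (f y) * g y).im) z v =
      (conj (f z) * fderiv ℝ g z v + conj (fderiv ℝ f z v) * g z).im := by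
  have h : HasFDerivAt (fun y => (conj (f y) * g y).im) _ z := Complex.imCLM.hasFDerivAt.comp z
    (hasFDerivAt_conj_mul hf.hasFDerivAt hg.hasFDerivAt)
  rw [h.fderiv]
  simp
  ring

lemma re_conj_mul_self (a : ℂ) : (conj a * a).re = ‖a‖ ^ 2 := by
  rw [← Complex.normSq_eq_norm_sq, Complex.normSq_apply]
  simp

lemma fderiv_norm_sq (hf : DifferentiableAt ℝ f z) (v : X) :
    fderiv ℝ (fun y => ‖f y‖ ^ 2) z v = 2 * (conj (f z) * fderiv ℝ f z v).re := by
  simp only [← re_conj_mul_self]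
  rw [fderiv_re_conj_mul hf hf]
  simp
  ring

lemma contDiffOn_conj_mul {n : WithTop ℕ∞} {s : Set X} (hf : ContDiffOn ℝ n f s)
    (hg : ContDiffOn ℝ n g s) : ContDiffOn ℝ n (fun y => conj (f y) * g y) s :=
  ((Complex.conjCLE : ℂ →L[ℝ] ℂ).contDiff.comp_contDiffOn hf).mul hg

lemma contDiffOn_re_conj_mul {n : WithTop ℕ∞} {s : Set X} (hf : ContDiffOn ℝ n f s)
    (hg : ContDiffOn ℝ n g s) : ContDiffOn ℝ n (fun y => (conj (f y) * g y).re) s :=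
  Complex.reCLM.contDiff.comp_contDiffOn (contDiffOn_conj_mul hf hg)

lemma contDiffOn_im_conj_mul {n : WithTop ℕ∞} {s : Set X} (hf : ContDiffOn ℝ n f s)
    (hg : ContDiffOn ℝ n g s) : ContDiffOn ℝ n (fun y => (conj (f y) * g y).im) s :=
  Complex.imCLM.contDiff.comp_contDiffOn (contDiffOn_conj_mul hf hg)

lemma contDiffOn_norm_sq {n : WithTop ℕ∞} {s : Set X} (hf : ContDiffOn ℝ n f s) :
    ContDiffOn ℝ n (fun y => ‖f y‖ ^ 2) s := by
  simp only [← re_conj_mul_self]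
  exact contDiffOn_re_conj_mul hf hf

end

/-! ### Space-time derivatives and the local laws for mass and kinetic energy. -/

section

variable {Φ : ℝ × E3 → ℂ}

/-- The time derivative of a function on space-time. -/
def dt (Φ : ℝ × E3 → ℂ) (z : ℝ × E3) : ℂ := fderiv ℝ Φ z timeDir

/-- The `j`-th space derivative of a function on space-time. -/
def dx (j : Fin 3) (Φ : ℝ × E3 → ℂ) (z : ℝ × E3) : ℂ := fderiv ℝ Φ z (spaceDir j)

/-- The spatial Laplacian of a function on space-time. -/
def lap (Φ : ℝ × E3 → ℂ) (z : ℝ × E3) : ℂ := ∑ j, dx j (dx j Φ) z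

lemma differentiableAt_of_posTime {F : Type*} [NormedAddCommGroup F] [NormedSpace ℝ F]
    {Φ : ℝ × E3 → F} (h : ContDiffOn ℝ ∞ Φ posTime) {z : ℝ × E3}
    (hz : z ∈ posTime) : DifferentiableAt ℝ Φ z :=
  (h.contDiffAt (isOpen_posTime.mem_nhds hz)).differentiableAt (by simp)

lemma dt_dx_comm (h : ContDiffOn ℝ ∞ Φ posTime) {z : ℝ × E3} (hz : z ∈ posTime) (j : Fin 3) :
    dt (dx j Φ) z = dx j (dt Φ) z := by
  have hs := (h.contDiffAt (isOpen_posTime.mem_nhds hz)).isSymmSndFDerivAt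
    (by simpa using WithTop.coe_le_coe.2 (le_top (a := (2 : ℕ∞))))
  have hd : DifferentiableAt ℝ (fderiv ℝ Φ) z :=
    differentiableAt_of_posTime (h.fderiv_of_isOpen isOpen_posTime (by simp)) hz
  have key : ∀ v w, fderiv ℝ (fun y => fderiv ℝ Φ y v) z w = fderiv ℝ (fderiv ℝ Φ) z w v :=
    fun v w => by
      rw [fderiv_clm_apply hd (differentiableAt_const v)]
      simp
  change fderiv ℝ (fun y => fderiv ℝ Φ y (spaceDir j)) z timeDir =
    fderiv ℝ (fun y => fderiv ℝ Φ y timeDir) z (spaceDir j)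
  rw [key, key]
  exact hs _ _

lemma contDiffOn_dt (h : ContDiffOn ℝ ∞ Φ posTime) : ContDiffOn ℝ ∞ (dt Φ) posTime :=
  contDiffOn_fderiv_apply h _

lemma contDiffOn_dx (h : ContDiffOn ℝ ∞ Φ posTime) (j : Fin 3) :
    ContDiffOn ℝ ∞ (dx j Φ) posTime := contDiffOn_fderiv_apply h _

lemma fderiv_time_mul {w : ℝ → ℝ} (hw : ContDiffOn ℝ 1 w (Ioi 0)) {F : ℝ × E3 → ℝ}
    (hF : ContDiffOn ℝ ∞ F posTime) {z : ℝ × E3} (hz : z ∈ posTime) (v : ℝ × E3) :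
    fderiv ℝ (fun z => w z.1 * F z) z v = w z.1 * fderiv ℝ F z v + deriv w z.1 * v.1 * F z := by
  have hz1 : 0 < z.1 := hz.1
  have h1 : HasDerivAt w (deriv w z.1) z.1 :=
    ((hw.contDiffAt (Ioi_mem_nhds hz1)).differentiableAt one_ne_zero).hasDerivAt
  have h2 : HasFDerivAt (fun z : ℝ × E3 => w z.1) _ z := h1.hasFDerivAt.comp z hasFDerivAt_fst
  have h3 : HasFDerivAt (fun z : ℝ × E3 => w z.1 * F z) _ z :=
    h2.mul (differentiableAt_of_posTime hF hz).hasFDerivAt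
  rw [h3.fderiv]
  simp
  ring

lemma contDiffOn_time_mul {w : ℝ → ℝ} (hw : ContDiffOn ℝ 1 w (Ioi 0)) {F : ℝ × E3 → ℝ}
    (hF : ContDiffOn ℝ ∞ F posTime) : ContDiffOn ℝ 1 (fun z => w z.1 * F z) posTime :=
  (hw.comp contDiff_fst.contDiffOn fun _ hz => hz.1).mul (hF.of_le (by simp))

/-- Local conservation of mass, with a time weight. -/
lemma source_mass (h : ContDiffOn ℝ ∞ Φ posTime) {w : ℝ → ℝ} (hw : ContDiffOn ℝ 1 w (Ioi 0))
    {z : ℝ × E3} (hz : z ∈ posTime) {V : ℝ} (heq : Complex.I * dt Φ z + lap Φ z - V * Φ z = 0) :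
    source (fun z => w z.1 * ‖Φ z‖ ^ 2)
      (fun j z => w z.1 * (-2 * (conj (Φ z) * dx j Φ z).im)) z = deriv w z.1 * ‖Φ z‖ ^ 2 := by
  have hd := differentiableAt_of_posTime h hz
  have hj : ∀ j, ContDiffOn ℝ ∞ (fun z => -2 * (conj (Φ z) * dx j Φ z).im) posTime := fun j =>
    contDiffOn_const.mul (contDiffOn_im_conj_mul h (contDiffOn_dx h j))
  have hdj : ∀ j, DifferentiableAt ℝ (fun z => (conj (Φ z) * dx j Φ z).im) z := fun j =>
    differentiableAt_of_posTime (contDiffOn_im_conj_mul h (contDiffOn_dx h j)) hz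
  have e : ∀ j, fderiv ℝ (fun z => -2 * (conj (Φ z) * dx j Φ z).im) z (spaceDir j) =
      -2 * (conj (Φ z) * dx j (dx j Φ) z).im := fun j => by
    rw [fderiv_const_mul (hdj j), smul_apply,
      fderiv_im_conj_mul hd (differentiableAt_of_posTime (contDiffOn_dx h j) hz), smul_eq_mul]
    change -2 * (conj (Φ z) * dx j (dx j Φ) z + conj (dx j Φ z) * dx j Φ z).im = _
    -- The term `|∂ⱼΦ|²` is real and does not contribute to the imaginary part.
    rw [Complex.add_im]
    simp
    ring
  simp only [source, fderiv_time_mul hw (contDiffOn_norm_sq h) hz, fderiv_time_mul hw (hj _) hz, e,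
    fderiv_norm_sq hd]
  change w z.1 * (2 * (conj (Φ z) * dt Φ z).re) + _ - _ = _
  have hdt : dt Φ z = Complex.I * (lap Φ z - V * Φ z) := by
    linear_combination (-Complex.I) * heq + (dt Φ z) * Complex.I_mul_I
  -- The potential drops out because `V` is real, so that `i V |Φ|²` is purely imaginary.
  have h1 : (conj (Φ z) * dt Φ z).re = - ∑ j, (conj (Φ z) * dx j (dx j Φ) z).im := by
    rw [← Complex.im_sum, ← Finset.mul_sum, ← lap, hdt]
    simp
    ring
  rw [h1]
  simp [spaceDir, timeDir, ← Finset.mul_sum]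

/-- Local balance of the kinetic energy, with a time weight. -/
lemma source_kinetic (h : ContDiffOn ℝ ∞ Φ posTime) {w : ℝ → ℝ} (hw : ContDiffOn ℝ 1 w (Ioi 0))
    {z : ℝ × E3} (hz : z ∈ posTime) :
    source (fun z => w z.1 * ∑ j, ‖dx j Φ z‖ ^ 2)
      (fun j z => w z.1 * (2 * (conj (dx j Φ z) * dt Φ z).re)) z =
      deriv w z.1 * (∑ j, ‖dx j Φ z‖ ^ 2) - w z.1 * (2 * (conj (lap Φ z) * dt Φ z).re) := by
  have hdx := fun j => contDiffOn_dx h j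
  have hddx := fun j => differentiableAt_of_posTime (hdx j) hz
  have hddt := differentiableAt_of_posTime (contDiffOn_dt h) hz
  have hG0 : ∀ j, ContDiffOn ℝ ∞ (fun z => (conj (dx j Φ z) * dt Φ z).re) posTime := fun j =>
    contDiffOn_re_conj_mul (hdx j) (contDiffOn_dt h)
  have hG : ∀ j, ContDiffOn ℝ ∞ (fun z => 2 * (conj (dx j Φ z) * dt Φ z).re) posTime := fun j =>
    contDiffOn_const.mul (hG0 j)
  have hF : ContDiffOn ℝ ∞ (fun z => ∑ j, ‖dx j Φ z‖ ^ 2) posTime :=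
    ContDiffOn.sum fun j _ => contDiffOn_norm_sq (hdx j)
  have e : ∀ j, fderiv ℝ (fun z => 2 * (conj (dx j Φ z) * dt Φ z).re) z (spaceDir j) =
      2 * (conj (dx j Φ z) * dx j (dt Φ) z).re + 2 * (conj (dx j (dx j Φ) z) * dt Φ z).re :=
    fun j => by
      rw [fderiv_const_mul (differentiableAt_of_posTime (hG0 j) hz),
        smul_apply, fderiv_re_conj_mul (hddx j) hddt, smul_eq_mul]
      change 2 * (conj (dx j Φ z) * dx j (dt Φ) z + conj (dx j (dx j Φ) z) * dt Φ z).re = _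
      rw [Complex.add_re]
      ring
  have e2 : fderiv ℝ (fun z => ∑ j, ‖dx j Φ z‖ ^ 2) z timeDir =
      ∑ j, 2 * (conj (dx j Φ z) * dx j (dt Φ) z).re := by
    rw [fderiv_fun_sum fun j _ => differentiableAt_of_posTime (contDiffOn_norm_sq (hdx j)) hz,
      sum_apply]
    refine Finset.sum_congr rfl fun j _ => ?_
    rw [fderiv_norm_sq (hddx j)]
    change 2 * (conj (dx j Φ z) * dt (dx j Φ) z).re = _
    rw [dt_dx_comm h hz]
  -- The mixed terms `conj (∂ⱼΦ) ∂ⱼ∂ₜΦ` of the time derivative and of the divergence cancel, leaving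
  -- only the Laplacian.
  simp only [source, fderiv_time_mul hw hF hz, fderiv_time_mul hw (hG _) hz, e, e2]
  have h1 : (conj (lap Φ z) * dt Φ z).re = ∑ j, (conj (dx j (dx j Φ) z) * dt Φ z).re := by
    rw [lap, map_sum, Finset.sum_mul, Complex.re_sum]
  rw [h1]
  simp only [spaceDir, timeDir, Finset.sum_add_distrib, ← Finset.mul_sum]
  simp [Finset.sum_add_distrib]
  ring

end

/-! ### The pseudoconformal transformation -/

/-- The modulation `t^{3/2} exp(-i t |y|² / 4)`. -/
def modulation (z : ℝ × E3) : ℂ :=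
  ((z.1 ^ (3 / 2 : ℝ) : ℝ) : ℂ) * Complex.exp (-(Complex.I * ((z.1 * ‖z.2‖ ^ 2 / 4 : ℝ) : ℂ)))

/-- The dilation `(t, y) ↦ (t, t y)`. -/
def dilation (z : ℝ × E3) : ℝ × E3 := (z.1, z.1 • z.2)

/-- The pseudoconformal transform `t^{3/2} exp(-i t |y|² / 4) f(t, t y)`. -/
def pseudoconformal (f : ℝ × E3 → ℂ) (z : ℝ × E3) : ℂ := modulation z * f (dilation z)

/-- The operator conjugate to `dx j` under the pseudoconformal transform. -/
def conjDx (j : Fin 3) (f : ℝ × E3 → ℂ) (z : ℝ × E3) : ℂ :=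
  -(Complex.I * ((z.2 j / 2 : ℝ) : ℂ)) * f z + z.1 * dx j f z

/-- The operator conjugate to `dt` under the pseudoconformal transform. -/
def conjDt (f : ℝ × E3 → ℂ) (z : ℝ × E3) : ℂ :=
  (((3 / (2 * z.1) : ℝ) : ℂ) - Complex.I * ((‖z.2‖ ^ 2 / (4 * z.1 ^ 2) : ℝ) : ℂ)) * f z + dt f z
    + ∑ j, ((z.2 j / z.1 : ℝ) : ℂ) * dx j f z

lemma dilation_mem {z : ℝ × E3} (hz : z ∈ posTime) : dilation z ∈ posTime := ⟨hz.1, mem_univ _⟩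

lemma contDiff_dilation {n : WithTop ℕ∞} : ContDiff ℝ n dilation :=
  contDiff_fst.prodMk (contDiff_fst.smul contDiff_snd)

lemma contDiffOn_modulation : ContDiffOn ℝ ∞ modulation posTime := by
  refine ContDiffOn.mul ?_ ?_
  · exact Complex.ofRealCLM.contDiff.comp_contDiffOn
      (contDiff_fst.contDiffOn.rpow_const_of_ne fun z hz => (ne_of_gt hz.1))
  · refine ContDiff.contDiffOn (ContDiff.cexp (contDiff_const.mul ?_).neg)
    exact Complex.ofRealCLM.contDiff.comp
      ((contDiff_fst.mul (contDiff_snd.norm_sq ℝ)).div_const 4)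

lemma contDiffOn_pseudoconformal {f : ℝ × E3 → ℂ} (hf : ContDiffOn ℝ ∞ f posTime) :
    ContDiffOn ℝ ∞ (pseudoconformal f) posTime :=
  contDiffOn_modulation.mul (hf.comp contDiff_dilation.contDiffOn fun _ hz => dilation_mem hz)

lemma norm_modulation {z : ℝ × E3} (hz : z ∈ posTime) : ‖modulation z‖ = z.1 ^ (3 / 2 : ℝ) := by
  have h : -(Complex.I * ((z.1 * ‖z.2‖ ^ 2 / 4 : ℝ) : ℂ)) =
      ((-(z.1 * ‖z.2‖ ^ 2 / 4) : ℝ) : ℂ) * Complex.I := by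
    push_cast
    ring
  rw [modulation, h, norm_mul, Complex.norm_exp_ofReal_mul_I, Complex.norm_real,
    Real.norm_of_nonneg (Real.rpow_nonneg (le_of_lt hz.1) _), mul_one]

lemma norm_sq_modulation {z : ℝ × E3} (hz : z ∈ posTime) : ‖modulation z‖ ^ 2 = z.1 ^ 3 := by
  rw [norm_modulation hz, ← Real.rpow_natCast, ← Real.rpow_mul (le_of_lt hz.1)]
  norm_num

lemma dt_modulation {z : ℝ × E3} (hz : z ∈ posTime) : dt modulation z =
    modulation z * (((3 / (2 * z.1) : ℝ) : ℂ) - Complex.I * ((‖z.2‖ ^ 2 / 4 : ℝ) : ℂ)) := by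
  obtain ⟨t, y⟩ := z
  have ht : 0 < t := hz.1
  have h1 : HasDerivAt (fun s : ℝ => s ^ (3 / 2 : ℝ)) (3 / 2 * t ^ (3 / 2 - 1 : ℝ)) t :=
    Real.hasDerivAt_rpow_const (Or.inl ht.ne')
  have h2 : HasDerivAt (fun s : ℝ => s * ‖y‖ ^ 2 / 4) (‖y‖ ^ 2 / 4) t := by
    simpa using ((hasDerivAt_id t).mul_const (‖y‖ ^ 2)).div_const 4
  have h3 := h1.ofReal_comp.mul ((h2.ofReal_comp.const_mul Complex.I).neg.cexp)
  refine (hasDerivAt_slice contDiffOn_modulation (by simp) ht y).unique (h3.congr_deriv ?_)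
  have h4 : (3 / 2 * t ^ (3 / 2 - 1 : ℝ) : ℝ) = t ^ (3 / 2 : ℝ) * (3 / (2 * t)) := by
    rw [Real.rpow_sub ht, Real.rpow_one]
    field_simp
  rw [h4]
  simp only [modulation, Pi.neg_apply]
  push_cast
  ring

lemma dx_modulation {z : ℝ × E3} (hz : z ∈ posTime) (j : Fin 3) : dx j modulation z =
    modulation z * (-(Complex.I * ((z.1 * z.2 j / 2 : ℝ) : ℂ))) := by
  obtain ⟨t, y⟩ := z
  have ht : 0 < t := hz.1
  have h1 : HasFDerivAt (fun x : E3 => t * ‖x‖ ^ 2 / 4) _ y :=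
    ((hasStrictFDerivAt_norm_sq y).hasFDerivAt.const_mul t).mul_const (4 : ℝ)⁻¹
  have h2 : HasFDerivAt (fun x : E3 => ((t * ‖x‖ ^ 2 / 4 : ℝ) : ℂ)) _ y :=
    Complex.ofRealCLM.hasFDerivAt.comp y h1
  have h3 : HasFDerivAt (fun x : E3 => modulation (t, x)) _ y :=
    ((h2.const_mul Complex.I).neg.cexp).const_mul ((t ^ (3 / 2 : ℝ) : ℝ) : ℂ)
  rw [dx, ← fderiv_slice contDiffOn_modulation (by simp) ht, h3.fderiv]
  have hi : inner ℝ y (EuclideanSpace.single j (1 : ℝ)) = y j := by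
    simp [EuclideanSpace.inner_single_right]
  simp [modulation, hi]
  ring

lemma hasFDerivAt_dilation (z : ℝ × E3) : HasFDerivAt dilation
    ((ContinuousLinearMap.fst ℝ ℝ E3).prod (z.1 • ContinuousLinearMap.snd ℝ ℝ E3
      + (ContinuousLinearMap.fst ℝ ℝ E3).smulRight z.2)) z :=
  hasFDerivAt_fst.prodMk (hasFDerivAt_fst.fun_smul hasFDerivAt_snd)

lemma fderiv_pseudoconformal {f : ℝ × E3 → ℂ} (hf : ContDiffOn ℝ ∞ f posTime) {z : ℝ × E3}
    (hz : z ∈ posTime) (v : ℝ × E3) : fderiv ℝ (pseudoconformal f) z v =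
      fderiv ℝ modulation z v * f (dilation z)
        + modulation z * fderiv ℝ f (dilation z) (v.1, z.1 • v.2 + v.1 • z.2) := by
  have h1 := (differentiableAt_of_posTime contDiffOn_modulation hz).hasFDerivAt
  have h2 := (differentiableAt_of_posTime hf (dilation_mem hz)).hasFDerivAt.comp z
    (hasFDerivAt_dilation z)
  have h3 : HasFDerivAt (pseudoconformal f) _ z := h1.mul h2
  rw [h3.fderiv]
  simp
  ring

lemma sum_smul_single (y : E3) : ∑ j, y j • EuclideanSpace.single j (1 : ℝ) = y := by
  ext i
  simp [Finset.sum_apply, Pi.single_apply]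

lemma dt_pseudoconformal {f : ℝ × E3 → ℂ} (hf : ContDiffOn ℝ ∞ f posTime) {z : ℝ × E3}
    (hz : z ∈ posTime) : dt (pseudoconformal f) z = pseudoconformal (conjDt f) z := by
  have ht : z.1 ≠ 0 := ne_of_gt hz.1
  -- The dilation pushes the time direction forward to `∂ₜ + ∑ yⱼ ∂ⱼ`, the source of the transport
  -- term in `conjDt`.
  have hv : ((1 : ℝ), z.1 • (0 : E3) + (1 : ℝ) • z.2) = timeDir + ∑ j, z.2 j • spaceDir j := by
    have : ∑ j, z.2 j • spaceDir j = ((0 : ℝ), z.2) := by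
      refine Prod.ext ?_ ?_
      · simp [Prod.fst_sum, spaceDir]
      · rw [Prod.snd_sum]
        exact sum_smul_single z.2
    rw [this]
    simp [timeDir]
  rw [dt, fderiv_pseudoconformal hf hz, ← dt, dt_modulation hz]
  change _ + _ * fderiv ℝ f (dilation z) ((1 : ℝ), z.1 • (0 : E3) + (1 : ℝ) • z.2) = _
  rw [hv, map_add, map_sum, pseudoconformal, conjDt]
  have e1 : ‖(dilation z).2‖ ^ 2 / (4 * (dilation z).1 ^ 2) = ‖z.2‖ ^ 2 / 4 := by
    simp only [dilation, norm_smul, mul_pow, Real.norm_eq_abs, sq_abs]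
    field_simp
  have e2 : ∀ j, (dilation z).2 j / (dilation z).1 = z.2 j := fun j => by
    simp only [dilation, PiLp.smul_apply, smul_eq_mul]
    field_simp
  have e3 : (dilation z).1 = z.1 := rfl
  simp only [e1, e2]
  simp only [e3, map_smul, dt, dx, Complex.real_smul]
  ring

lemma dx_pseudoconformal {f : ℝ × E3 → ℂ} (hf : ContDiffOn ℝ ∞ f posTime) {z : ℝ × E3}
    (hz : z ∈ posTime) (j : Fin 3) :
    dx j (pseudoconformal f) z = pseudoconformal (conjDx j f) z := by
  have hv : ((0 : ℝ), z.1 • EuclideanSpace.single j (1 : ℝ) + (0 : ℝ) • z.2) = z.1 • spaceDir j := by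
    simp [spaceDir]
  rw [dx, fderiv_pseudoconformal hf hz, ← dx, dx_modulation hz]
  change _ + _ * fderiv ℝ f (dilation z) ((0 : ℝ), z.1 • EuclideanSpace.single j (1 : ℝ)
    + (0 : ℝ) • z.2) = _
  rw [hv, pseudoconformal, conjDx]
  have e2 : (dilation z).2 j = z.1 * z.2 j := by simp [dilation]
  have e3 : (dilation z).1 = z.1 := rfl
  simp only [e2, e3, map_smul, dx, Complex.real_smul]
  ring

lemma contDiffOn_coord (j : Fin 3) : ContDiff ℝ ∞ fun z : ℝ × E3 => z.2 j := by fun_prop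

lemma contDiffOn_conjDx {f : ℝ × E3 → ℂ} (hf : ContDiffOn ℝ ∞ f posTime) (j : Fin 3) :
    ContDiffOn ℝ ∞ (conjDx j f) posTime := by
  refine ContDiffOn.add (ContDiffOn.mul ?_ hf) (ContDiffOn.mul ?_ (contDiffOn_dx hf j))
  · exact (contDiff_const.mul (Complex.ofRealCLM.contDiff.comp
      ((contDiffOn_coord j).div_const 2))).neg.contDiffOn
  · exact (Complex.ofRealCLM.contDiff.comp contDiff_fst).contDiffOn

lemma dx_conjDx {f : ℝ × E3 → ℂ} (hf : ContDiffOn ℝ ∞ f posTime) {z : ℝ × E3}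
    (hz : z ∈ posTime) (j : Fin 3) : dx j (conjDx j f) z =
      -(Complex.I / 2) * f z - Complex.I * ((z.2 j / 2 : ℝ) : ℂ) * dx j f z
        + z.1 * dx j (dx j f) z := by
  obtain ⟨t, y⟩ := z
  have ht : 0 < t := hz.1
  have hc : HasFDerivAt (fun x : E3 => x j) (EuclideanSpace.proj j : E3 →L[ℝ] ℝ) y :=
    (EuclideanSpace.proj j : E3 →L[ℝ] ℝ).hasFDerivAt
  have h1 : HasFDerivAt (fun x : E3 => x j / 2) _ y := hc.mul_const (2 : ℝ)⁻¹
  have h2 : HasFDerivAt (fun x : E3 => ((x j / 2 : ℝ) : ℂ)) _ y :=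
    Complex.ofRealCLM.hasFDerivAt.comp y h1
  have h3 := ((h2.const_mul Complex.I).neg.mul (hasFDerivAt_slice hf (by simp) ht y)).add
    ((hasFDerivAt_slice (contDiffOn_dx hf j) (by simp) ht y).const_mul (t : ℂ))
  have h4 : HasFDerivAt (fun x : E3 => conjDx j f (t, x)) _ y := h3
  rw [dx, ← fderiv_slice (contDiffOn_conjDx hf j) (by simp) ht, h4.fderiv]
  simp [dx, spaceDir]
  ring

/-- The pseudoconformal transform intertwines the Schrödinger operators. -/
lemma schrodinger_pseudoconformal {f : ℝ × E3 → ℂ} (hf : ContDiffOn ℝ ∞ f posTime) {z : ℝ × E3}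
    (hz : z ∈ posTime) :
    Complex.I * dt (pseudoconformal f) z + ((z.1 ^ 2 : ℝ) : ℂ)⁻¹ * lap (pseudoconformal f) z =
      modulation z * (Complex.I * dt f (dilation z) + lap f (dilation z)) := by
  have ht : z.1 ≠ 0 := ne_of_gt hz.1
  have htc : (z.1 : ℂ) ≠ 0 := by exact_mod_cast ht
  have hz' := dilation_mem hz
  have h1 : ∀ j, dx j (dx j (pseudoconformal f)) z =
      pseudoconformal (conjDx j (conjDx j f)) z := fun j => by
    rw [← dx_pseudoconformal (contDiffOn_conjDx hf j) hz]
    have : dx j (pseudoconformal f) =ᶠ[𝓝 z] pseudoconformal (conjDx j f) := by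
      filter_upwards [isOpen_posTime.mem_nhds hz] with y hy using dx_pseudoconformal hf hy j
    rw [dx, this.fderiv_eq, ← dx]
  have h2 : ‖(dilation z).2‖ ^ 2 = ∑ j, (dilation z).2 j ^ 2 := EuclideanSpace.real_norm_sq_eq _
  rw [dt_pseudoconformal hf hz, lap]
  simp only [h1, pseudoconformal]
  rw [conjDt, h2]
  have h3 : ∀ j, conjDx j (conjDx j f) (dilation z) =
      -(Complex.I * (((dilation z).2 j / 2 : ℝ) : ℂ)) * conjDx j f (dilation z)
        + (dilation z).1 * dx j (conjDx j f) (dilation z) := fun j => rfl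
  simp only [h3, dx_conjDx hf hz', lap]
  simp only [conjDx, Fin.sum_univ_three]
  have e3 : (dilation z).1 = z.1 := rfl
  simp only [e3]
  -- With `x = t y`, expanding `t⁻² ∑ (t∂ⱼ - i xⱼ/2)²` yields `Δ - (i/t) x·∇ - 3i/(2t) -
  -- |x|²/(4t²)`. The last three terms are cancelled by `i` times `conjDt`; the prefactor `t^{3/2}`
  -- is there for the zeroth-order one.
  push_cast
  field_simp
  ring

/-! ### Bilinear estimates -/

lemma enorm_mul_le_sq_add_sq (a b : ℝ≥0∞) : a * b ≤ a ^ 2 + b ^ 2 := by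
  rcases le_total a b with h | h
  · calc a * b ≤ b * b := by gcongr
      _ ≤ a ^ 2 + b ^ 2 := by rw [sq b]; exact le_add_self
  · calc a * b ≤ a * a := by gcongr
      _ ≤ a ^ 2 + b ^ 2 := by rw [sq a]; exact le_self_add

lemma lintegral_mul_le_sq_add_sq {X : Type*} [MeasurableSpace X] {μ : Measure X} {f g : X → ℝ≥0∞}
    (hf : Measurable f) : ∫⁻ x, f x * g x ∂μ ≤ (∫⁻ x, f x ^ 2 ∂μ) + ∫⁻ x, g x ^ 2 ∂μ := by
  rw [← lintegral_add_left (hf.pow_const 2)]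
  exact lintegral_mono fun x => enorm_mul_le_sq_add_sq _ _

/-- With `k` and `g` square integrable, the inner integral is bounded uniformly in the outer
variable, so `f` need only be in L¹. In the energy law `f` is a mass rate, about which nothing
better is known. -/
lemma lintegral_kernel_le_left {k f g : E3 → ℝ≥0∞} (hk : Measurable k) (hf : Measurable f)
    (hg : Measurable g) : ∫⁻ p : E3 × E3, k (p.1 - p.2) * (f p.1 * g p.2) ≤
      ((∫⁻ x, k x ^ 2) + ∫⁻ x, g x ^ 2) * ∫⁻ x, f x := by
  rw [Measure.volume_eq_prod, lintegral_prod _ (by fun_prop), ← lintegral_const_mul _ hf]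
  refine lintegral_mono fun x => ?_
  calc ∫⁻ y, k (x - y) * (f x * g y) = f x * ∫⁻ y, k (x - y) * g y := by
        rw [← lintegral_const_mul _ (by fun_prop)]
        congr 1 with y
        ring
    _ ≤ f x * ((∫⁻ y, k (x - y) ^ 2) + ∫⁻ y, g y ^ 2) := by
        gcongr
        exact lintegral_mul_le_sq_add_sq (by fun_prop)
    _ = ((∫⁻ x, k x ^ 2) + ∫⁻ x, g x ^ 2) * f x := by
        rw [lintegral_sub_left_eq_self (fun y => k y ^ 2), mul_comm]

/-- Swap the variables and reflect the kernel. -/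
lemma lintegral_kernel_le_right {k f g : E3 → ℝ≥0∞} (hk : Measurable k) (hf : Measurable f)
    (hg : Measurable g) : ∫⁻ p : E3 × E3, k (p.1 - p.2) * (f p.1 * g p.2) ≤
      ((∫⁻ x, k x ^ 2) + ∫⁻ x, f x ^ 2) * ∫⁻ x, g x := by
  have h := lintegral_kernel_le_left (k := fun x => k (-x)) (by fun_prop) hg hf
  rw [lintegral_neg_eq_self (fun x => k x ^ 2)] at h
  refine le_trans (le_of_eq ?_) h
  rw [Measure.volume_eq_prod, ← lintegral_prod_swap]
  refine lintegral_congr fun p => ?_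
  simp only [Prod.fst_swap, Prod.snd_swap, neg_sub]
  ring

/-- A Schur test: the product `f(x) f(y)` is at most `f(x)² + f(y)²`, and each square sees the
kernel only through its L¹ norm. -/
lemma lintegral_kernel_sq_le {k f : E3 → ℝ≥0∞} (hk : Measurable k) (hf : Measurable f) :
    ∫⁻ p : E3 × E3, k (p.1 - p.2) * (f p.1 * f p.2) ≤ 2 * (∫⁻ x, k x) * ∫⁻ x, f x ^ 2 := by
  have h1 : ∫⁻ p : E3 × E3, k (p.1 - p.2) * f p.1 ^ 2 = (∫⁻ x, k x) * ∫⁻ x, f x ^ 2 := by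
    rw [Measure.volume_eq_prod, lintegral_prod _ (by fun_prop),
      ← lintegral_const_mul _ (by fun_prop)]
    refine lintegral_congr fun x => ?_
    simp only
    rw [lintegral_mul_const _ (by fun_prop), lintegral_sub_left_eq_self k]
  have h2 : ∫⁻ p : E3 × E3, k (p.1 - p.2) * f p.2 ^ 2 = (∫⁻ x, k x) * ∫⁻ x, f x ^ 2 := by
    rw [Measure.volume_eq_prod, lintegral_prod_symm _ (by fun_prop),
      ← lintegral_const_mul _ (by fun_prop)]
    refine lintegral_congr fun x => ?_
    simp only
    rw [lintegral_mul_const _ (by fun_prop), lintegral_sub_right_eq_self k]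
  calc ∫⁻ p : E3 × E3, k (p.1 - p.2) * (f p.1 * f p.2)
      ≤ ∫⁻ p : E3 × E3, (k (p.1 - p.2) * f p.1 ^ 2 + k (p.1 - p.2) * f p.2 ^ 2) := by
        refine lintegral_mono fun p => ?_
        rw [← mul_add]
        gcongr
        exact enorm_mul_le_sq_add_sq _ _
    _ = 2 * (∫⁻ x, k x) * ∫⁻ x, f x ^ 2 := by
        rw [lintegral_add_left (by fun_prop), h1, h2]
        ring

lemma enorm_potential_eq {χ : ℝ → ℝ} (hχ : IsDecreasingCutoff χ) (x : E3) :
    ‖potential χ x‖ₑ = ENNReal.ofReal (potential χ x) :=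
  Real.enorm_of_nonneg (hχ.potential_nonneg x)

lemma IsDecreasingCutoff.lintegral_potential_sq_lt_top {χ : ℝ → ℝ} (hχ : IsDecreasingCutoff χ) :
    ∫⁻ x : E3, ‖potential χ x‖ₑ ^ 2 < ⊤ := by
  have := hχ.integrable_potential_sq.2
  simpa [HasFiniteIntegral, enorm_pow] using this

lemma IsDecreasingCutoff.enorm_potential_smul_le {χ : ℝ → ℝ} (hχ : IsDecreasingCutoff χ) {t : ℝ}
    (ht : 1 ≤ t) (x : E3) : ‖potential χ (t • x)‖ₑ ≤ ‖potential χ x‖ₑ := by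
  rw [enorm_potential_eq hχ, enorm_potential_eq hχ]
  exact ENNReal.ofReal_le_ofReal (hχ.potential_smul_le ht x)

/-- The part with `χ` is dominated by `v`, since `χ(t‖x‖) ≤ χ(‖x‖)` for `t ≥ 1`. In the part with
`χ'` the chain rule supplies a factor `‖x‖` cancelling the singularity, so it is bounded; this
accounts for the `+ 1`. -/
lemma exists_kernelDeriv_le {χ : ℝ → ℝ} (hχ : IsDecreasingCutoff χ) {w w' : ℝ → ℝ} {a b : ℝ}
    (ha : 1 ≤ a) (hw : ContinuousOn w (Icc a b)) (hw' : ContinuousOn w' (Icc a b)) :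
    ∃ C : ℝ, 0 ≤ C ∧ ∀ t ∈ Icc a b, ∀ x : E3,
      |kernelDeriv χ w w' t x| ≤ C * (potential χ x + 1) := by
  obtain ⟨L, hL⟩ := (hχ.compactSupport.deriv).exists_bound_of_continuous
    (hχ.smooth.continuous_deriv (by simp))
  have hL0 : 0 ≤ L := (norm_nonneg _).trans (hL 0)
  obtain ⟨C₁, hC₁⟩ := isCompact_Icc.exists_bound_of_continuousOn
    (f := fun t => w' t * t + w t) (by fun_prop : ContinuousOn _ (Icc a b))
  obtain ⟨C₂, hC₂⟩ := isCompact_Icc.exists_bound_of_continuousOn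
    (f := fun t => w t * t) (by fun_prop : ContinuousOn _ (Icc a b))
  refine ⟨|C₁| + |C₂| * L, by positivity, fun t ht x => ?_⟩
  have ht1 : 1 ≤ t := ha.trans ht.1
  have hv := hχ.potential_nonneg x
  rcases eq_or_ne x 0 with rfl | hx
  · simp [kernelDeriv]
    positivity
  have hr : 0 < ‖x‖ := norm_pos_iff.2 hx
  have hle : ‖x‖ ≤ t * ‖x‖ := le_mul_of_one_le_left hr.le ht1
  have e : kernelDeriv χ w w' t x =
      (w' t * t + w t) * (χ (t * ‖x‖) / ‖x‖) + w t * t * deriv χ (t * ‖x‖) := by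
    rw [kernelDeriv]
    field_simp
  have h1 : |χ (t * ‖x‖) / ‖x‖| ≤ potential χ x := by
    rw [abs_of_nonneg (div_nonneg (hχ.nonneg (hr.le.trans hle)) hr.le), potential]
    gcongr
    exact hχ.decreasing hr.le (hr.le.trans hle) hle
  have h2 : |w' t * t + w t| ≤ |C₁| := (hC₁ t ht).trans (le_abs_self _)
  have h3 : |w t * t| ≤ |C₂| := (hC₂ t ht).trans (le_abs_self _)
  have h4 : |deriv χ (t * ‖x‖)| ≤ L := hL _
  calc |kernelDeriv χ w w' t x|
      ≤ |C₁| * potential χ x + |C₂| * L := by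
        rw [e]
        refine (abs_add_le _ _).trans ?_
        rw [abs_mul _ (χ _ / _), abs_mul _ (deriv χ _)]
        gcongr
    _ ≤ (|C₁| + |C₂| * L) * (potential χ x + 1) := by
        nlinarith [abs_nonneg C₁, mul_nonneg (mul_nonneg (abs_nonneg C₂) hL0) hv]

/-! ### The energy law for the transformed equation -/

lemma integrable_prod_of_lintegral_le {X : Type*} [MeasurableSpace X] {μ : Measure X} [SFinite μ]
    {a b : ℝ} {f : ℝ × X → ℝ} (hm : AEStronglyMeasurable f ((volume.restrict (Ioc a b)).prod μ))
    {C : ℝ≥0∞} (hC : C ≠ ⊤) (h : ∀ t ∈ Ioc a b, ∫⁻ x, ‖f (t, x)‖ₑ ∂μ ≤ C) :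
    Integrable f ((volume.restrict (Ioc a b)).prod μ) := by
  refine ⟨hm, ?_⟩
  rw [HasFiniteIntegral, lintegral_prod _ hm.enorm]
  refine (setLIntegral_mono measurable_const h).trans_lt ?_
  rw [setLIntegral_const]
  exact ENNReal.mul_lt_top hC.lt_top (by simp)

lemma aestronglyMeasurable_prod_of_continuousOn {X : Type*} [MeasurableSpace X]
    [TopologicalSpace X] [BorelSpace X] [SecondCountableTopology X] {μ : Measure X} [SFinite μ]
    {a b : ℝ} (ha : 0 < a) {f : ℝ × X → ℝ} (hf : ContinuousOn f (Ioi 0 ×ˢ univ)) :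
    AEStronglyMeasurable f ((volume.restrict (Ioc a b)).prod μ) := by
  have h : (volume.restrict (Ioc a b)).prod μ = (volume.prod μ).restrict (Ioc a b ×ˢ univ) := by
    rw [← Measure.prod_restrict, Measure.restrict_univ]
  rw [h]
  refine (hf.mono ?_).aestronglyMeasurable (measurableSet_Ioc.prod MeasurableSet.univ)
  exact prod_mono (fun t ht => ha.trans ht.1) le_rfl

/-- Uniform bounds on a time interval for the transformed solution. -/
structure Controlled (Ψ : ℝ × E3 → ℂ) (a b : ℝ) (B : ℝ≥0) : Prop where
  weighted : ∀ t ∈ Icc a b, ∫⁻ y, ‖(1 + ‖y‖) • Ψ (t, y)‖ₑ ^ 2 ≤ B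
  grad : ∀ t ∈ Icc a b, ∀ j, ∫⁻ y, ‖dx j Ψ (t, y)‖ₑ ^ 2 ≤ B
  time : ∀ t ∈ Icc a b, ∫⁻ y, ‖(1 + ‖y‖)⁻¹ • dt Ψ (t, y)‖ₑ ^ 2 ≤ B
  four : ∀ t ∈ Icc a b, ∫⁻ y, ‖Ψ (t, y)‖ₑ ^ 4 ≤ B

/-- The time derivative of `|Ψ|²`. -/
def massRate (Ψ : ℝ × E3 → ℂ) (z : ℝ × E3) : ℝ := 2 * (conj (Ψ z) * dt Ψ z).re

/-- The mean field of the transformed equation. -/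
def scaledField (χ : ℝ → ℝ) (Ψ : ℝ × E3 → ℂ) (z : ℝ × E3) : ℝ :=
  ∫ y, potential χ (z.1 • (z.2 - y)) * ‖Ψ (z.1, y)‖ ^ 2

/-- The kinetic part of the pseudoconformal energy. -/
def kinetic (Ψ : ℝ × E3 → ℂ) (t : ℝ) : ℝ := ∫ y, ∑ j, ‖dx j Ψ (t, y)‖ ^ 2

/-- Half the interaction of two mass distributions through a kernel. -/
def interaction (k : E3 → ℝ) (Ψ : ℝ × E3 → ℂ) (t : ℝ) : ℝ :=
  ∫ p : E3 × E3, 1 / 2 * (k (p.1 - p.2) * (‖Ψ (t, p.1)‖ ^ 2 * ‖Ψ (t, p.2)‖ ^ 2))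

/-! ### Bilinear integrals with kernels dominated by `C (v + 1)`. -/

section bilinear

variable {χ : ℝ → ℝ} (hχ : IsDecreasingCutoff χ) {k : E3 → ℝ} {C : ℝ}
  (hkC : ∀ x, |k x| ≤ C * (potential χ x + 1)) {f g : E3 → ℝ} (hf : Continuous f)
  (hg : Continuous g)

include hχ hkC in
lemma enorm_kernel_le (x : E3) : ‖k x‖ₑ ≤ ENNReal.ofReal C * (‖potential χ x‖ₑ + 1) := by
  have h0 := hχ.potential_nonneg x
  rw [Real.enorm_eq_ofReal_abs, enorm_potential_eq hχ, ← ENNReal.ofReal_one,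
    ← ENNReal.ofReal_add h0 zero_le_one, ← ENNReal.ofReal_mul' (by positivity)]
  exact ENNReal.ofReal_le_ofReal (hkC x)

include hχ hkC hf hg in
-- The constant part of the kernel bound decouples the two variables and leaves a product of L¹
-- norms.
lemma lintegral_enorm_kernel_mul_le :
    ∫⁻ p : E3 × E3, ‖k (p.1 - p.2) * (f p.1 * g p.2)‖ₑ ≤ ENNReal.ofReal C *
      ((∫⁻ p : E3 × E3, ‖potential χ (p.1 - p.2)‖ₑ * (‖f p.1‖ₑ * ‖g p.2‖ₑ))
        + (∫⁻ x, ‖f x‖ₑ) * ∫⁻ x, ‖g x‖ₑ) := by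
  have hv := hχ.measurable_potential
  have hfm := hf.measurable
  have hgm := hg.measurable
  calc ∫⁻ p : E3 × E3, ‖k (p.1 - p.2) * (f p.1 * g p.2)‖ₑ
      ≤ ∫⁻ p : E3 × E3, ENNReal.ofReal C * (‖potential χ (p.1 - p.2)‖ₑ * (‖f p.1‖ₑ * ‖g p.2‖ₑ)
          + ‖f p.1‖ₑ * ‖g p.2‖ₑ) := by
        refine lintegral_mono fun p => ?_
        simp only [enorm_mul]
        calc _ ≤ ENNReal.ofReal C * (‖potential χ (p.1 - p.2)‖ₑ + 1) * (‖f p.1‖ₑ * ‖g p.2‖ₑ) := by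
              gcongr
              exact enorm_kernel_le hχ hkC _
          _ = _ := by ring
    _ = _ := by
        rw [lintegral_const_mul _ (by fun_prop), lintegral_add_right _ (by fun_prop),
          Measure.volume_eq_prod, lintegral_prod_mul (f := fun x => ‖f x‖ₑ) (g := fun x => ‖g x‖ₑ)
            (by fun_prop) (by fun_prop)]

include hχ hkC hf hg in
lemma lintegral_enorm_kernel_mul_le_left {A : ℝ≥0∞} (h1 : ∫⁻ x, ‖f x‖ₑ ≤ A)
    (h2 : ∫⁻ x, ‖g x‖ₑ ≤ A) (h3 : ∫⁻ x, ‖g x‖ₑ ^ 2 ≤ A) :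
    ∫⁻ p : E3 × E3, ‖k (p.1 - p.2) * (f p.1 * g p.2)‖ₑ ≤
      ENNReal.ofReal C * (((∫⁻ x : E3, ‖potential χ x‖ₑ ^ 2) + A) * A + A * A) := by
  refine (lintegral_enorm_kernel_mul_le hχ hkC hf hg).trans ?_
  gcongr
  refine (lintegral_kernel_le_left (k := fun x => ‖potential χ x‖ₑ)
    hχ.measurable_potential.enorm hf.measurable.enorm hg.measurable.enorm).trans ?_
  gcongr

include hχ hkC hf hg in
lemma lintegral_enorm_kernel_mul_le_right {A : ℝ≥0∞} (h1 : ∫⁻ x, ‖f x‖ₑ ≤ A)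
    (h2 : ∫⁻ x, ‖g x‖ₑ ≤ A) (h3 : ∫⁻ x, ‖f x‖ₑ ^ 2 ≤ A) :
    ∫⁻ p : E3 × E3, ‖k (p.1 - p.2) * (f p.1 * g p.2)‖ₑ ≤
      ENNReal.ofReal C * (((∫⁻ x : E3, ‖potential χ x‖ₑ ^ 2) + A) * A + A * A) := by
  refine (lintegral_enorm_kernel_mul_le hχ hkC hf hg).trans ?_
  gcongr
  refine (lintegral_kernel_le_right (k := fun x => ‖potential χ x‖ₑ)
    hχ.measurable_potential.enorm hf.measurable.enorm hg.measurable.enorm).trans ?_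
  gcongr

include hχ in
lemma bilinear_bound_ne_top {A : ℝ≥0∞} (hA : A ≠ ⊤) :
    ENNReal.ofReal C * (((∫⁻ x : E3, ‖potential χ x‖ₑ ^ 2) + A) * A + A * A) ≠ ⊤ := by
  have := hχ.lintegral_potential_sq_lt_top.ne
  finiteness

end bilinear

/-! ### Consequences of the uniform bounds for the mass density and its rate. -/

section

variable {Ψ : ℝ × E3 → ℂ} (h : ContDiffOn ℝ ∞ Ψ posTime) {a b : ℝ} {B : ℝ≥0}
  (hB : Controlled Ψ a b B)

lemma enorm_norm_sq (c : ℂ) : ‖‖c‖ ^ 2‖ₑ = ‖c‖ₑ ^ 2 := by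
  rw [enorm_pow, enorm_norm]

include hB in
lemma Controlled.mass {t : ℝ} (ht : t ∈ Icc a b) : ∫⁻ y, ‖‖Ψ (t, y)‖ ^ 2‖ₑ ≤ B := by
  refine (lintegral_mono fun y => ?_).trans (hB.weighted t ht)
  rw [enorm_norm_sq]
  gcongr
  rw [enorm_smul]
  refine le_mul_of_one_le_left zero_le ?_
  rw [Real.enorm_of_nonneg (by positivity), ← ENNReal.ofReal_one]
  exact ENNReal.ofReal_le_ofReal (by simp)

include hB in
lemma Controlled.mass_sq {t : ℝ} (ht : t ∈ Icc a b) : ∫⁻ y, ‖‖Ψ (t, y)‖ ^ 2‖ₑ ^ 2 ≤ B := by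
  refine le_trans (le_of_eq (lintegral_congr fun y => ?_)) (hB.four t ht)
  rw [enorm_norm_sq, ← pow_mul]

/-- Inserting `1 + ‖y‖` and its inverse shifts the growth of `∂ₜΨ` onto `Ψ`, where the second moment
pays for it. -/
lemma enorm_massRate_le (z : ℝ × E3) : ‖massRate Ψ z‖ₑ ≤
    2 * (‖(1 + ‖z.2‖) • Ψ z‖ₑ ^ 2 + ‖(1 + ‖z.2‖)⁻¹ • dt Ψ z‖ₑ ^ 2) := by
  have hz : 1 + ‖z.2‖ ≠ 0 := by positivity
  have e : ‖Ψ z‖ₑ * ‖dt Ψ z‖ₑ = ‖(1 + ‖z.2‖) • Ψ z‖ₑ * ‖(1 + ‖z.2‖)⁻¹ • dt Ψ z‖ₑ := by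
    rw [← enorm_mul, ← enorm_mul, smul_mul_smul_comm, mul_inv_cancel₀ hz, one_smul]
  have e2 : ‖(conj (Ψ z) * dt Ψ z).re‖ₑ ≤ ‖Ψ z‖ₑ * ‖dt Ψ z‖ₑ := by
    rw [← enorm_mul, enorm_le_iff_norm_le]
    refine (Complex.abs_re_le_norm _).trans (le_of_eq ?_)
    simp
  rw [massRate, enorm_mul]
  have : ‖(2 : ℝ)‖ₑ = 2 := by
    rw [Real.enorm_of_nonneg (by norm_num)]
    simp
  rw [this]
  gcongr
  exact (e2.trans e.le).trans (enorm_mul_le_sq_add_sq _ _)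

include h in
lemma contDiffOn_massRate : ContDiffOn ℝ ∞ (massRate Ψ) posTime :=
  contDiffOn_const.mul (contDiffOn_re_conj_mul h (contDiffOn_dt h))

lemma continuous_slice {F : Type*} [TopologicalSpace F] {f : ℝ × E3 → F}
    (hf : ContinuousOn f posTime) {t : ℝ} (ht : 0 < t) : Continuous fun y => f (t, y) :=
  continuousOn_univ.1 (hf.comp (by fun_prop) fun x _ => mem_posTime ht x)

include h hB in
lemma Controlled.massRate (ha : 0 < a) {t : ℝ} (ht : t ∈ Icc a b) :
    ∫⁻ y, ‖massRate Ψ (t, y)‖ₑ ≤ 4 * B := by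
  have hc : Continuous fun y => Ψ (t, y) := continuous_slice h.continuousOn (ha.trans_le ht.1)
  have hc' : Continuous fun y : E3 => (1 + ‖y‖) • Ψ (t, y) :=
    (continuous_const.add continuous_norm).smul hc
  refine (lintegral_mono fun y => enorm_massRate_le (t, y)).trans ?_
  rw [lintegral_const_mul' _ _ (by simp), lintegral_add_left (hc'.enorm.measurable.pow_const 2)]
  calc _ ≤ 2 * ((B : ℝ≥0∞) + B) := by
        gcongr
        · exact hB.weighted t ht
        · exact hB.time t ht
    _ = 4 * B := by ring

include h in
lemma hasDerivAt_norm_sq_slice {t : ℝ} (ht : 0 < t) (y : E3) :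
    HasDerivAt (fun s => ‖Ψ (s, y)‖ ^ 2) (Hartree.massRate Ψ (t, y)) t := by
  have h1 := hasDerivAt_slice (contDiffOn_norm_sq h) (by simp) ht y
  rw [fderiv_norm_sq (differentiableAt_of_posTime h (mem_posTime ht y))] at h1
  exact h1

end

/-- Solve the equation for `ΔΨ`: the part proportional to `∂ₜΨ` gives `i |∂ₜΨ|²`, with zero real
part, and the potential part gives the rate of change of `|Ψ|²`. -/
lemma re_conj_lap_mul_dt {Ψ : ℝ × E3 → ℂ} {z : ℝ × E3} (hz : z ∈ posTime) {V : ℝ}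
    (heq : Complex.I * dt Ψ z + ((z.1 ^ 2 : ℝ) : ℂ)⁻¹ * lap Ψ z - V * Ψ z = 0) :
    2 * (conj (lap Ψ z) * dt Ψ z).re = z.1 ^ 2 * V * massRate Ψ z := by
  have hz0 : z.1 ≠ 0 := ne_of_gt hz.1
  have ht : ((z.1 ^ 2 : ℝ) : ℂ) ≠ 0 := by exact_mod_cast pow_ne_zero 2 hz0
  have h1 : lap Ψ z = ((z.1 ^ 2 : ℝ) : ℂ) * (V * Ψ z - Complex.I * dt Ψ z) := by
    field_simp at heq
    linear_combination heq
  rw [h1, massRate]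
  simp only [map_mul, map_sub, Complex.conj_ofReal, Complex.conj_I, mul_assoc,
    Complex.re_ofReal_mul]
  simp
  ring

lemma exists_bound_on_Icc {w : ℝ → ℝ} {a b : ℝ} (ha : 0 < a) (hw : ContinuousOn w (Ioi 0)) :
    ∃ C : ℝ≥0, ∀ t ∈ Icc a b, ‖w t‖ₑ ≤ C := by
  obtain ⟨C, hC⟩ := isCompact_Icc.exists_bound_of_continuousOn
    (hw.mono fun t (ht : t ∈ Icc a b) => ha.trans_le ht.1)
  refine ⟨C.toNNReal, fun t ht => ?_⟩
  rw [← ofReal_norm]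
  exact ENNReal.ofReal_le_ofReal (hC t ht)

lemma continuousOn_deriv_of_contDiffOn {w : ℝ → ℝ} (hw : ContDiffOn ℝ 1 w (Ioi 0)) :
    ContinuousOn (deriv w) (Ioi 0) := hw.continuousOn_deriv_of_isOpen isOpen_Ioi le_rfl

/-! ### The kinetic half of the energy law. -/

section

variable {χ : ℝ → ℝ} (hχ : IsDecreasingCutoff χ) {Ψ : ℝ × E3 → ℂ} (h : ContDiffOn ℝ ∞ Ψ posTime)
  {a b : ℝ} (ha : 1 ≤ a) (hab : a ≤ b) {B : ℝ≥0} (hB : Controlled Ψ a b B)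

include h ha hB in
lemma Controlled.integrable_grad {t : ℝ} (ht : t ∈ Icc a b) :
    Integrable fun y => ∑ j, ‖dx j Ψ (t, y)‖ ^ 2 := by
  have ht0 : 0 < t := by linarith [ht.1]
  refine integrable_finsetSum _ fun j _ => ⟨?_, ?_⟩
  · exact ((continuous_slice (contDiffOn_dx h j).continuousOn ht0).norm.pow 2).aestronglyMeasurable
  · simp only [HasFiniteIntegral, enorm_norm_sq]
    exact (hB.grad t ht j).trans_lt ENNReal.coe_lt_top

include hχ ha hB in
-- For `t ≥ 1` the dilated kernel is below `v`, and both `v` and `|Ψ|²` lie in L².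
lemma Controlled.enorm_scaledField_le {t : ℝ} (ht : t ∈ Icc a b) (y : E3) :
    ‖scaledField χ Ψ (t, y)‖ₑ ≤ (∫⁻ x : E3, ‖potential χ x‖ₑ ^ 2) + B := by
  have hv := hχ.measurable_potential
  refine (enorm_integral_le_lintegral_enorm _).trans ?_
  calc ∫⁻ x, ‖potential χ (t • (y - x)) * ‖Ψ (t, x)‖ ^ 2‖ₑ
      ≤ ∫⁻ x, ‖potential χ (y - x)‖ₑ * ‖‖Ψ (t, x)‖ ^ 2‖ₑ := by
        refine lintegral_mono fun x => ?_
        rw [enorm_mul]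
        gcongr
        exact hχ.enorm_potential_smul_le (ha.trans ht.1) _
    _ ≤ (∫⁻ x : E3, ‖potential χ (y - x)‖ₑ ^ 2) + ∫⁻ x, ‖‖Ψ (t, x)‖ ^ 2‖ₑ ^ 2 :=
        lintegral_mul_le_sq_add_sq (by fun_prop)
    _ ≤ _ := by
        rw [lintegral_sub_left_eq_self (fun y => ‖potential χ y‖ₑ ^ 2)]
        gcongr
        exact hB.mass_sq ht

variable {w : ℝ → ℝ} (hw : ContDiffOn ℝ 1 w (Ioi 0))
  (heq : ∀ z ∈ posTime, Complex.I * dt Ψ z + ((z.1 ^ 2 : ℝ) : ℂ)⁻¹ * lap Ψ z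
    - (scaledField χ Ψ z : ℂ) * Ψ z = 0)

/-- The source of the weighted kinetic energy. -/
def kineticSource (χ : ℝ → ℝ) (Ψ : ℝ × E3 → ℂ) (w : ℝ → ℝ) (z : ℝ × E3) : ℝ :=
  deriv w z.1 * (∑ j, ‖dx j Ψ z‖ ^ 2)
    - w z.1 * (z.1 ^ 2 * (scaledField χ Ψ z * massRate Ψ z))

include hχ h ha hab hB hw heq in
-- The equation removes `ΔΨ` from the source, which then involves only the gradient, the bounded
-- mean field and the integrable mass rate. No bound on second derivatives of `Ψ` is required.
lemma kinetic_balance : Integrable (kineticSource χ Ψ w) (slab a b) ∧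
    w b * kinetic Ψ b - w a * kinetic Ψ a = ∫ z, kineticSource χ Ψ w z ∂(slab a b) := by
  have ha0 : 0 < a := by linarith
  have hF0 : ContDiffOn ℝ ∞ (fun z => ∑ j, ‖dx j Ψ z‖ ^ 2) posTime :=
    ContDiffOn.sum fun j _ => contDiffOn_norm_sq (contDiffOn_dx h j)
  have hF := contDiffOn_time_mul hw hF0
  have hG0 : ∀ j, ContDiffOn ℝ ∞ (fun z => 2 * (conj (dx j Ψ z) * dt Ψ z).re) posTime := fun j =>
    contDiffOn_const.mul (contDiffOn_re_conj_mul (contDiffOn_dx h j) (contDiffOn_dt h))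
  have hG := fun j => contDiffOn_time_mul hw (hG0 j)
  obtain ⟨C, hC⟩ := exists_bound_on_Icc (b := b) ha0 hw.continuousOn
  obtain ⟨C', hC'⟩ := exists_bound_on_Icc (b := b) ha0 (continuousOn_deriv_of_contDiffOn hw)
  have hsource : ∀ z ∈ posTime, source (fun z => w z.1 * ∑ j, ‖dx j Ψ z‖ ^ 2)
      (fun j z => w z.1 * (2 * (conj (dx j Ψ z) * dt Ψ z).re)) z = kineticSource χ Ψ w z :=
    fun z hz => by
      rw [source_kinetic h hw hz, re_conj_lap_mul_dt hz (heq z hz), kineticSource, mul_assoc]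
  have hcont : ContinuousOn (kineticSource χ Ψ w) posTime :=
    (continuousOn_source hF hG).congr fun z hz => (hsource z hz).symm
  have hV := hχ.lintegral_potential_sq_lt_top.ne
  have hint : Integrable (kineticSource χ Ψ w) (slab a b) := by
    refine integrable_prod_of_lintegral_le (aestronglyMeasurable_prod_of_continuousOn ha0 hcont)
      (C := C' * (3 * B) + C * (ENNReal.ofReal (b ^ 2)
        * (((∫⁻ x : E3, ‖potential χ x‖ₑ ^ 2) + B) * (4 * B)))) (by finiteness) fun t ht => ?_
    have ht' := Ioc_subset_Icc_self ht
    have ht0 : 0 < t := ha0.trans ht.1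
    have hm : ∀ j, Measurable fun y => ‖dx j Ψ (t, y)‖ₑ ^ 2 := fun j =>
      (continuous_slice (contDiffOn_dx h j).continuousOn ht0).enorm.measurable.pow_const 2
    have hm2 : Measurable fun y => ‖massRate Ψ (t, y)‖ₑ :=
      (continuous_slice (contDiffOn_massRate h).continuousOn ht0).enorm.measurable
    calc ∫⁻ y, ‖kineticSource χ Ψ w (t, y)‖ₑ
        ≤ ∫⁻ y, (C' * (∑ j, ‖dx j Ψ (t, y)‖ₑ ^ 2) + C * (ENNReal.ofReal (b ^ 2)
            * (((∫⁻ x : E3, ‖potential χ x‖ₑ ^ 2) + B) * ‖massRate Ψ (t, y)‖ₑ))) := by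
          refine lintegral_mono fun y => ?_
          refine (enorm_sub_le).trans (add_le_add ?_ ?_)
          · rw [enorm_mul]
            gcongr
            · exact hC' t ht'
            · refine (enorm_sum_le _ _).trans (le_of_eq ?_)
              simp only [enorm_norm_sq]
          · simp only [enorm_mul]
            gcongr
            · exact hC t ht'
            · rw [Real.enorm_of_nonneg (by positivity)]
              exact ENNReal.ofReal_le_ofReal (by gcongr; exact ht.2)
            · exact hB.enorm_scaledField_le hχ ha ht' y
      _ ≤ _ := by
          rw [lintegral_add_right _ (by fun_prop), lintegral_const_mul _ (by fun_prop),
            lintegral_const_mul _ (by fun_prop), lintegral_const_mul _ (by fun_prop),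
            lintegral_const_mul _ hm2, lintegral_finsetSum _ fun j _ => hm j]
          gcongr
          · refine (Finset.sum_le_sum fun j _ => hB.grad t ht' j).trans (le_of_eq ?_)
            simp
          · exact hB.massRate h ha0 ht'
  -- The energy flux contains `∂ₜΨ`, controlled in L² only after division by `1 + ‖y‖`. That is
  -- exactly the weight tolerated by `balance`.
  have hGint : ∀ j, Integrable (fun z => w z.1 * (2 * (conj (dx j Ψ z) * dt Ψ z).re)
      / (1 + ‖z.2‖)) (slab a b) := fun j => by
    refine integrable_prod_of_lintegral_le (C := C * (2 * (B + B)))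
      (aestronglyMeasurable_prod_of_continuousOn ha0 ((hG j).continuousOn.div (by fun_prop)
        fun z _ => by positivity)) (by finiteness) fun t ht => ?_
    have ht' := Ioc_subset_Icc_self ht
    have ht0 : 0 < t := ha0.trans ht.1
    have hm : Measurable fun y => ‖dx j Ψ (t, y)‖ₑ :=
      (continuous_slice (contDiffOn_dx h j).continuousOn ht0).enorm.measurable
    calc _ ≤ ∫⁻ y, C * (2 * (‖dx j Ψ (t, y)‖ₑ * ‖(1 + ‖y‖)⁻¹ • dt Ψ (t, y)‖ₑ)) := by
          refine lintegral_mono fun y => ?_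
          have e1 : w t * (2 * (conj (dx j Ψ (t, y)) * dt Ψ (t, y)).re) / (1 + ‖y‖) =
              w t * (2 * (conj (dx j Ψ (t, y)) * ((1 + ‖y‖)⁻¹ • dt Ψ (t, y))).re) := by
            rw [mul_smul_comm, Complex.smul_re, smul_eq_mul]
            ring
          have e2 : ‖(conj (dx j Ψ (t, y)) * ((1 + ‖y‖)⁻¹ • dt Ψ (t, y))).re‖ₑ ≤
              ‖dx j Ψ (t, y)‖ₑ * ‖(1 + ‖y‖)⁻¹ • dt Ψ (t, y)‖ₑ := by
            rw [← enorm_mul, enorm_le_iff_norm_le]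
            refine (Complex.abs_re_le_norm _).trans (le_of_eq ?_)
            simp
          have e3 : ‖(2 : ℝ)‖ₑ = 2 := by
            rw [Real.enorm_of_nonneg (by norm_num)]
            simp
          simp only [e1, enorm_mul, e3]
          gcongr
          exact hC t ht'
      _ ≤ _ := by
          rw [lintegral_const_mul' _ _ (by finiteness), lintegral_const_mul' _ _ (by finiteness)]
          gcongr
          refine (lintegral_mul_le_sq_add_sq hm).trans ?_
          gcongr
          · exact hB.grad t ht' j
          · exact hB.time t ht'
  have hsl : ∀ᵐ z ∂(slab a b), z ∈ posTime := by
    have h1 : ∀ᵐ t ∂(volume.restrict (Ioc a b)), 0 < t :=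
      (ae_restrict_mem measurableSet_Ioc).mono fun t ht => ha0.trans ht.1
    have := (Measure.quasiMeasurePreserving_fst (μ := volume.restrict (Ioc a b))
      (ν := (volume : Measure E3))).ae h1
    exact this.mono fun z hz => ⟨hz, mem_univ _⟩
  have hae : source (fun z => w z.1 * ∑ j, ‖dx j Ψ z‖ ^ 2)
      (fun j z => w z.1 * (2 * (conj (dx j Ψ z) * dt Ψ z).re)) =ᵐ[slab a b]
      kineticSource χ Ψ w := hsl.mono fun z hz => hsource z hz
  refine ⟨hint, ?_⟩
  have key := balance hF hG ha0 hab ((hB.integrable_grad h ha ⟨le_rfl, hab⟩).const_mul (w a))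
    ((hB.integrable_grad h ha ⟨hab, le_rfl⟩).const_mul (w b)) hGint (hint.congr hae.symm)
  rw [integral_congr_ae hae] at key
  rw [kinetic, kinetic, ← integral_const_mul, ← integral_const_mul]
  exact key

end

/-- The kernel `w(t) t² v(t x)`. -/
def kernel (χ w : ℝ → ℝ) (t : ℝ) (x : E3) : ℝ := w t * (t ^ 2 * potential χ (t • x))

/-- The time derivative of the weighted interaction density. -/
def interactionRate (χ w : ℝ → ℝ) (Ψ : ℝ × E3 → ℂ) (t : ℝ) (p : E3 × E3) : ℝ :=
  1 / 2 * (kernelDeriv χ w (deriv w) t (p.1 - p.2) * (‖Ψ (t, p.1)‖ ^ 2 * ‖Ψ (t, p.2)‖ ^ 2))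
    + 1 / 2 * (kernel χ w t (p.1 - p.2) * (massRate Ψ (t, p.1) * ‖Ψ (t, p.2)‖ ^ 2)
      + kernel χ w t (p.1 - p.2) * (‖Ψ (t, p.1)‖ ^ 2 * massRate Ψ (t, p.2)))

/-! ### The interaction half and the combined energy law. -/

section

variable {χ : ℝ → ℝ} (hχ : IsDecreasingCutoff χ) {Ψ : ℝ × E3 → ℂ} (h : ContDiffOn ℝ ∞ Ψ posTime)
  {a b : ℝ} (ha : 1 ≤ a) (hab : a ≤ b) {B : ℝ≥0} (hB : Controlled Ψ a b B)
  {w : ℝ → ℝ} (hw : ContDiffOn ℝ 1 w (Ioi 0))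

include hχ ha hw in
lemma exists_kernel_le : ∃ C : ℝ, ∀ t ∈ Icc a b, ∀ x : E3,
    |kernel χ w t x| ≤ C * (potential χ x + 1) ∧
      |kernelDeriv χ w (deriv w) t x| ≤ C * (potential χ x + 1) := by
  have hpos : Icc a b ⊆ Ioi (0 : ℝ) := fun t ht => by
    have := ht.1
    simp only [mem_Ioi]
    linarith
  have hwc := hw.continuousOn.mono hpos
  obtain ⟨C₁, hC₁0, hC₁⟩ := exists_kernelDeriv_le hχ ha hwc
    ((continuousOn_deriv_of_contDiffOn hw).mono hpos)
  obtain ⟨C₂, hC₂⟩ := isCompact_Icc.exists_bound_of_continuousOn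
    (f := fun t => w t * t ^ 2) (by fun_prop : ContinuousOn _ (Icc a b))
  refine ⟨C₁ + |C₂|, fun t ht x => ⟨?_, ?_⟩⟩
  · have hv := hχ.potential_nonneg x
    have hv' := hχ.potential_nonneg (t • x)
    have h1 := hχ.potential_smul_le (ha.trans ht.1) x
    have h2 : |w t * t ^ 2| ≤ |C₂| := (hC₂ t ht).trans (le_abs_self _)
    calc |kernel χ w t x| = |w t * t ^ 2| * potential χ (t • x) := by
          rw [kernel, ← mul_assoc, abs_mul, abs_of_nonneg hv']
      _ ≤ |C₂| * potential χ x := by gcongr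
      _ ≤ _ := by nlinarith [abs_nonneg C₂, mul_nonneg hC₁0 hv]
  · refine (hC₁ t ht x).trans ?_
    have hv := hχ.potential_nonneg x
    gcongr
    exact le_add_of_nonneg_right (abs_nonneg _)

include hχ in
lemma measurable_kernel (t : ℝ) : Measurable (kernel χ w t) := by
  have hv := hχ.measurable_potential
  unfold kernel
  fun_prop

include hχ in
lemma measurable_kernelDeriv (t : ℝ) (w' : ℝ → ℝ) : Measurable (kernelDeriv χ w w' t) := by
  have h1 := hχ.smooth.continuous
  have h2 : Continuous (deriv χ) := hχ.smooth.continuous_deriv (by simp)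
  unfold kernelDeriv
  fun_prop

lemma measurable_kernel_mul {k f g : E3 → ℝ} (hk : Measurable k) (hf : Measurable f)
    (hg : Measurable g) : Measurable fun p : E3 × E3 => k (p.1 - p.2) * (f p.1 * g p.2) := by
  fun_prop

/-- A finite bound for the bilinear expressions in the energy law. -/
def bilinearBound (χ : ℝ → ℝ) (B : ℝ≥0) (C : ℝ) : ℝ≥0∞ :=
  ENNReal.ofReal C * (((∫⁻ x : E3, ‖potential χ x‖ₑ ^ 2) + 4 * B) * (4 * B) + 4 * B * (4 * B))

include hχ in
lemma bilinearBound_ne_top (C : ℝ) : bilinearBound χ B C ≠ ⊤ :=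
  bilinear_bound_ne_top hχ (by finiteness)

section fixedTime

variable {t : ℝ} (ht : t ∈ Icc a b) {k : E3 → ℝ} {C : ℝ}
  (hkC : ∀ x, |k x| ≤ C * (potential χ x + 1))

lemma le_four_mul {x : ℝ≥0∞} (hx : x ≤ B) : x ≤ 4 * B :=
  hx.trans (le_mul_of_one_le_left zero_le (by norm_num))

include hχ h ha hB ht hkC

lemma lintegral_density_density_le :
    ∫⁻ p : E3 × E3, ‖k (p.1 - p.2) * (‖Ψ (t, p.1)‖ ^ 2 * ‖Ψ (t, p.2)‖ ^ 2)‖ₑ ≤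
      bilinearBound χ B C := by
  have ht0 : 0 < t := by linarith [ht.1]
  have hN : Continuous fun y => ‖Ψ (t, y)‖ ^ 2 :=
    (continuous_slice h.continuousOn ht0).norm.pow 2
  exact lintegral_enorm_kernel_mul_le_left hχ hkC hN hN (le_four_mul (hB.mass ht))
    (le_four_mul (hB.mass ht)) (le_four_mul (hB.mass_sq ht))

lemma lintegral_rate_density_le :
    ∫⁻ p : E3 × E3, ‖k (p.1 - p.2) * (massRate Ψ (t, p.1) * ‖Ψ (t, p.2)‖ ^ 2)‖ₑ ≤
      bilinearBound χ B C := by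
  have ht0 : 0 < t := by linarith [ht.1]
  have hN : Continuous fun y => ‖Ψ (t, y)‖ ^ 2 :=
    (continuous_slice h.continuousOn ht0).norm.pow 2
  exact lintegral_enorm_kernel_mul_le_left hχ hkC
    (continuous_slice (contDiffOn_massRate h).continuousOn ht0) hN
    (hB.massRate h (by linarith) ht) (le_four_mul (hB.mass ht)) (le_four_mul (hB.mass_sq ht))

lemma lintegral_density_rate_le :
    ∫⁻ p : E3 × E3, ‖k (p.1 - p.2) * (‖Ψ (t, p.1)‖ ^ 2 * massRate Ψ (t, p.2))‖ₑ ≤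
      bilinearBound χ B C := by
  have ht0 : 0 < t := by linarith [ht.1]
  have hN : Continuous fun y => ‖Ψ (t, y)‖ ^ 2 :=
    (continuous_slice h.continuousOn ht0).norm.pow 2
  exact lintegral_enorm_kernel_mul_le_right hχ hkC hN
    (continuous_slice (contDiffOn_massRate h).continuousOn ht0)
    (le_four_mul (hB.mass ht)) (hB.massRate h (by linarith) ht) (le_four_mul (hB.mass_sq ht))

lemma integrable_density_density (hk : Measurable k) :
    Integrable fun p : E3 × E3 => k (p.1 - p.2) * (‖Ψ (t, p.1)‖ ^ 2 * ‖Ψ (t, p.2)‖ ^ 2) := by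
  have ht0 : 0 < t := by linarith [ht.1]
  have hN : Measurable fun y => ‖Ψ (t, y)‖ ^ 2 :=
    ((continuous_slice h.continuousOn ht0).norm.pow 2).measurable
  refine ⟨(measurable_kernel_mul hk hN hN).aestronglyMeasurable, ?_⟩
  exact (lintegral_density_density_le hχ h ha hB ht hkC).trans_lt
    (bilinearBound_ne_top hχ C).lt_top

lemma integrable_rate_density (hk : Measurable k) :
    Integrable fun p : E3 × E3 => k (p.1 - p.2) * (massRate Ψ (t, p.1) * ‖Ψ (t, p.2)‖ ^ 2) := by
  have ht0 : 0 < t := by linarith [ht.1]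
  have hN : Measurable fun y => ‖Ψ (t, y)‖ ^ 2 :=
    ((continuous_slice h.continuousOn ht0).norm.pow 2).measurable
  have hR : Measurable fun y => massRate Ψ (t, y) :=
    (continuous_slice (contDiffOn_massRate h).continuousOn ht0).measurable
  refine ⟨(measurable_kernel_mul hk hR hN).aestronglyMeasurable, ?_⟩
  exact (lintegral_rate_density_le hχ h ha hB ht hkC).trans_lt
    (bilinearBound_ne_top hχ C).lt_top

lemma integrable_density_rate (hk : Measurable k) :
    Integrable fun p : E3 × E3 => k (p.1 - p.2) * (‖Ψ (t, p.1)‖ ^ 2 * massRate Ψ (t, p.2)) := by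
  have ht0 : 0 < t := by linarith [ht.1]
  have hN : Measurable fun y => ‖Ψ (t, y)‖ ^ 2 :=
    ((continuous_slice h.continuousOn ht0).norm.pow 2).measurable
  have hR : Measurable fun y => massRate Ψ (t, y) :=
    (continuous_slice (contDiffOn_massRate h).continuousOn ht0).measurable
  refine ⟨(measurable_kernel_mul hk hN hR).aestronglyMeasurable, ?_⟩
  exact (lintegral_density_rate_le hχ h ha hB ht hkC).trans_lt
    (bilinearBound_ne_top hχ C).lt_top

end fixedTime

include hχ h hw in
lemma hasDerivAt_interaction {t : ℝ} (ht : 0 < t) (p : E3 × E3) :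
    HasDerivAt (fun s => 1 / 2 * (kernel χ w s (p.1 - p.2)
      * (‖Ψ (s, p.1)‖ ^ 2 * ‖Ψ (s, p.2)‖ ^ 2))) (interactionRate χ w Ψ t p) t := by
  have hwd : HasDerivAt w (deriv w t) t :=
    ((hw.contDiffAt (Ioi_mem_nhds ht)).differentiableAt one_ne_zero).hasDerivAt
  have h1 := hasDerivAt_kernel hχ.smooth ht hwd (p.1 - p.2)
  have h2 := (h1.mul ((hasDerivAt_norm_sq_slice h ht p.1).mul
    (hasDerivAt_norm_sq_slice h ht p.2))).const_mul (1 / 2)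
  refine h2.congr_deriv ?_
  simp only [interactionRate, kernel, Pi.mul_apply]
  ring

include hχ h hw in
lemma continuousOn_interactionRate (ha0 : 0 < a) (p : E3 × E3) :
    ContinuousOn (fun t => interactionRate χ w Ψ t p) (Icc a b) := by
  have hpos : Icc a b ⊆ Ioi (0 : ℝ) := fun t ht => ha0.trans_le ht.1
  have hK : ContinuousOn (fun t => kernel χ w t (p.1 - p.2)) (Icc a b) := fun t ht =>
    (hasDerivAt_kernel hχ.smooth (hpos ht) (((hw.contDiffAt
      (Ioi_mem_nhds (hpos ht))).differentiableAt one_ne_zero).hasDerivAt)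
      (p.1 - p.2)).continuousAt.continuousWithinAt
  have hD := continuousOn_kernelDeriv hχ.smooth (hw.continuousOn.mono hpos)
    ((continuousOn_deriv_of_contDiffOn hw).mono hpos) (p.1 - p.2)
  have hs : ∀ {f : ℝ × E3 → ℝ}, ContinuousOn f posTime → ∀ y,
      ContinuousOn (fun t => f (t, y)) (Icc a b) := fun hf y =>
    hf.comp (by fun_prop) fun t ht => mem_posTime (hpos ht) y
  have hN := (contDiffOn_norm_sq h).continuousOn
  have hR := (contDiffOn_massRate h).continuousOn
  have h1 := hs hN p.1
  have h2 := hs hN p.2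
  have h3 := hs hR p.1
  have h4 := hs hR p.2
  unfold interactionRate
  fun_prop

include hχ h hw in
lemma aestronglyMeasurable_interactionRate (ha0 : 0 < a) :
    AEStronglyMeasurable (fun q : ℝ × (E3 × E3) => interactionRate χ w Ψ q.1 q.2)
      ((volume.restrict (Ioc a b)).prod volume) := by
  have hv := hχ.measurable_potential
  have hχc := hχ.smooth.continuous
  have hχd : Continuous (deriv χ) := hχ.smooth.continuous_deriv (by simp)
  have hwc : ContinuousOn (fun q : ℝ × (E3 × E3) => w q.1) (Ioi 0 ×ˢ univ) :=
    hw.continuousOn.comp continuousOn_fst fun q hq => hq.1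
  have hwd : ContinuousOn (fun q : ℝ × (E3 × E3) => deriv w q.1) (Ioi 0 ×ˢ univ) :=
    (continuousOn_deriv_of_contDiffOn hw).comp continuousOn_fst fun q hq => hq.1
  have hs1 : ∀ {f : ℝ × E3 → ℝ}, ContinuousOn f posTime →
      ContinuousOn (fun q : ℝ × (E3 × E3) => f (q.1, q.2.1)) (Ioi 0 ×ˢ univ) := fun hf =>
    hf.comp (by fun_prop) fun q hq => mem_posTime hq.1 _
  have hs2 : ∀ {f : ℝ × E3 → ℝ}, ContinuousOn f posTime →
      ContinuousOn (fun q : ℝ × (E3 × E3) => f (q.1, q.2.2)) (Ioi 0 ×ˢ univ) := fun hf =>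
    hf.comp (by fun_prop) fun q hq => mem_posTime hq.1 _
  have hN := (contDiffOn_norm_sq h).continuousOn
  have hR := (contDiffOn_massRate h).continuousOn
  have hK : AEStronglyMeasurable (fun q : ℝ × (E3 × E3) => kernel χ w q.1 (q.2.1 - q.2.2))
      ((volume.restrict (Ioc a b)).prod volume) := by
    refine (aestronglyMeasurable_prod_of_continuousOn ha0 hwc).mul ?_
    exact Measurable.aestronglyMeasurable (by fun_prop)
  have hD : AEStronglyMeasurable (fun q : ℝ × (E3 × E3) =>
      kernelDeriv χ w (deriv w) q.1 (q.2.1 - q.2.2))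
      ((volume.restrict (Ioc a b)).prod volume) := by
    -- The singular factor is separated as merely measurable; everything else is jointly continuous
    -- for positive times.
    have hm : Measurable fun q : ℝ × (E3 × E3) => ‖q.2.1 - q.2.2‖⁻¹ := by fun_prop
    simp only [kernelDeriv, div_eq_mul_inv]
    refine AEStronglyMeasurable.mul (aestronglyMeasurable_prod_of_continuousOn ha0 ?_)
      hm.aestronglyMeasurable
    have hr : Continuous fun q : ℝ × (E3 × E3) => q.1 * ‖q.2.1 - q.2.2‖ := by fun_prop
    have c1 := hχc.comp hr
    have c2 := hχd.comp hr
    have c3 : Continuous fun q : ℝ × (E3 × E3) => ‖q.2.1 - q.2.2‖ := by fun_prop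
    exact (((hwd.mul continuousOn_fst).add hwc).mul c1.continuousOn).add
      ((hwc.mul continuousOn_fst).mul (c2.mul c3).continuousOn)
  have m1 := aestronglyMeasurable_prod_of_continuousOn (μ := volume) (b := b) ha0 (hs1 hN)
  have m2 := aestronglyMeasurable_prod_of_continuousOn (μ := volume) (b := b) ha0 (hs2 hN)
  have m3 := aestronglyMeasurable_prod_of_continuousOn (μ := volume) (b := b) ha0 (hs1 hR)
  have m4 := aestronglyMeasurable_prod_of_continuousOn (μ := volume) (b := b) ha0 (hs2 hR)
  exact ((hD.mul (m1.mul m2)).const_mul _).add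
    (((hK.mul (m3.mul m2)).add (hK.mul (m1.mul m4))).const_mul _)

include hχ h ha hab hB hw in
-- The pair density carries no spatial flux, so its time derivative at a fixed pair of points can be
-- integrated directly. The bilinear bounds supply the integrability on the slab.
lemma interaction_balance :
    Integrable (fun q : ℝ × (E3 × E3) => interactionRate χ w Ψ q.1 q.2)
      ((volume.restrict (Ioc a b)).prod volume) ∧
    interaction (kernel χ w b) Ψ b - interaction (kernel χ w a) Ψ a =
      ∫ q, interactionRate χ w Ψ q.1 q.2 ∂((volume.restrict (Ioc a b)).prod volume) := by
  have ha0 : 0 < a := by linarith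
  obtain ⟨C, hC⟩ := exists_kernel_le (b := b) hχ ha hw
  have hint : Integrable (fun q : ℝ × (E3 × E3) => interactionRate χ w Ψ q.1 q.2)
      ((volume.restrict (Ioc a b)).prod volume) := by
    refine integrable_prod_of_lintegral_le (aestronglyMeasurable_interactionRate hχ h hw ha0)
      (C := ‖(1 / 2 : ℝ)‖ₑ * bilinearBound χ B C + ‖(1 / 2 : ℝ)‖ₑ * (bilinearBound χ B C
        + bilinearBound χ B C)) ?_ fun t ht => ?_
    · have := bilinearBound_ne_top (B := B) hχ C
      finiteness
    · have ht' := Ioc_subset_Icc_self ht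
      have hk := fun x => (hC t ht' x).1
      have hd := fun x => (hC t ht' x).2
      have i1 := integrable_density_density hχ h ha hB ht' hd (measurable_kernelDeriv hχ t _)
      have i2 := integrable_rate_density hχ h ha hB ht' hk (measurable_kernel hχ t)
      calc _ ≤ ∫⁻ p : E3 × E3, (‖(1 / 2 : ℝ)‖ₑ * ‖kernelDeriv χ w (deriv w) t (p.1 - p.2)
              * (‖Ψ (t, p.1)‖ ^ 2 * ‖Ψ (t, p.2)‖ ^ 2)‖ₑ
            + ‖(1 / 2 : ℝ)‖ₑ * (‖kernel χ w t (p.1 - p.2)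
              * (massRate Ψ (t, p.1) * ‖Ψ (t, p.2)‖ ^ 2)‖ₑ
            + ‖kernel χ w t (p.1 - p.2) * (‖Ψ (t, p.1)‖ ^ 2 * massRate Ψ (t, p.2))‖ₑ)) := by
            refine lintegral_mono fun p => ?_
            refine (enorm_add_le _ _).trans (add_le_add ?_ ?_)
            · rw [enorm_mul]
            · rw [enorm_mul]
              gcongr
              exact enorm_add_le _ _
        _ ≤ _ := by
            rw [lintegral_add_left' (i1.aestronglyMeasurable.enorm.const_mul _),
              lintegral_const_mul' _ _ (by finiteness), lintegral_const_mul' _ _ (by finiteness),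
              lintegral_add_left' i2.aestronglyMeasurable.enorm]
            gcongr
            · exact lintegral_density_density_le hχ h ha hB ht' hd
            · exact lintegral_rate_density_le hχ h ha hB ht' hk
            · exact lintegral_density_rate_le hχ h ha hB ht' hk
  refine ⟨hint, ?_⟩
  have hi : ∀ t ∈ Icc a b, Integrable fun p : E3 × E3 => 1 / 2 * (kernel χ w t (p.1 - p.2)
      * (‖Ψ (t, p.1)‖ ^ 2 * ‖Ψ (t, p.2)‖ ^ 2)) := fun t ht =>
    (integrable_density_density hχ h ha hB ht (fun x => (hC t ht x).1)
      (measurable_kernel hχ t)).const_mul _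
  exact integral_sub_integral_eq (F := fun t (p : E3 × E3) => 1 / 2 * (kernel χ w t (p.1 - p.2)
      * (‖Ψ (t, p.1)‖ ^ 2 * ‖Ψ (t, p.2)‖ ^ 2))) hab
    (fun p t ht => hasDerivAt_interaction hχ h hw (ha0.trans_le ht.1) p)
    (fun p => continuousOn_interactionRate hχ h hw ha0 p) hint
    (hi a ⟨le_rfl, hab⟩) (hi b ⟨hab, le_rfl⟩)

include hχ h ha hB hw in
-- As `v` is even, exchanging the two points shows that the two mass-rate terms are equal. They
-- absorb the factor one half and give the work of the mean field, which enters `kineticSource` with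
-- the opposite sign.
lemma integral_interactionRate {t : ℝ} (ht : t ∈ Icc a b) :
    Integrable (fun y => scaledField χ Ψ (t, y) * massRate Ψ (t, y)) ∧
    ∫ p, interactionRate χ w Ψ t p = interaction (kernelDeriv χ w (deriv w) t) Ψ t
      + w t * (t ^ 2 * ∫ y, scaledField χ Ψ (t, y) * massRate Ψ (t, y)) := by
  obtain ⟨C, hC⟩ := exists_kernel_le (b := b) hχ ha hw
  -- Weight one is treated separately because `w t` may vanish and cannot be divided out.
  obtain ⟨C', hC'⟩ := exists_kernel_le (b := b) hχ ha (w := fun _ => 1) contDiffOn_const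
  have ht0 : 0 < t := by linarith [ht.1]
  have hk := fun x => (hC t ht x).1
  have hd := fun x => (hC t ht x).2
  have i1 := integrable_density_density hχ h ha hB ht hd (measurable_kernelDeriv hχ t _)
  have i2 := integrable_rate_density hχ h ha hB ht hk (measurable_kernel hχ t)
  have i3 := integrable_density_rate hχ h ha hB ht hk (measurable_kernel hχ t)
  have j2 := integrable_rate_density hχ h ha hB ht (fun x => (hC' t ht x).1)
    (measurable_kernel hχ t)
  have e3 : ∫ p : E3 × E3, kernel χ w t (p.1 - p.2) * (‖Ψ (t, p.1)‖ ^ 2 * massRate Ψ (t, p.2)) =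
      ∫ p : E3 × E3, kernel χ w t (p.1 - p.2) * (massRate Ψ (t, p.1) * ‖Ψ (t, p.2)‖ ^ 2) := by
    rw [Measure.volume_eq_prod, ← integral_prod_swap]
    congr 1 with p
    simp only [Prod.fst_swap, Prod.snd_swap]
    rw [mul_comm (massRate Ψ (t, p.1)), kernel, kernel, ← neg_sub p.1 p.2, smul_neg, potential_neg]
  have inner : ∀ y, ∫ y', kernel χ (fun _ => 1) t (y - y')
      * (massRate Ψ (t, y) * ‖Ψ (t, y')‖ ^ 2) =
      t ^ 2 * (scaledField χ Ψ (t, y) * massRate Ψ (t, y)) := fun y => by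
    rw [scaledField, ← integral_mul_const, ← integral_const_mul]
    congr 1 with y'
    simp only [kernel]
    ring
  have e2 : ∫ p : E3 × E3, kernel χ w t (p.1 - p.2) * (massRate Ψ (t, p.1) * ‖Ψ (t, p.2)‖ ^ 2) =
      w t * (t ^ 2 * ∫ y, scaledField χ Ψ (t, y) * massRate Ψ (t, y)) := by
    rw [← integral_const_mul (t ^ 2)]
    simp only [← inner]
    rw [← integral_prod (fun p : E3 × E3 => kernel χ (fun _ => 1) t (p.1 - p.2)
      * (massRate Ψ (t, p.1) * ‖Ψ (t, p.2)‖ ^ 2)) j2, ← integral_const_mul,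
      ← Measure.volume_eq_prod]
    congr 1 with p
    simp only [kernel]
    ring
  constructor
  · have := Integrable.integral_prod_left j2
    simp only [inner] at this
    have h2 := this.const_mul (t ^ 2)⁻¹
    refine h2.congr (ae_of_all _ fun y => ?_)
    simp only
    field_simp
  · have hsplit : ∫ p, interactionRate χ w Ψ t p = interaction (kernelDeriv χ w (deriv w) t) Ψ t
        + 1 / 2 * ((∫ p : E3 × E3, kernel χ w t (p.1 - p.2)
            * (massRate Ψ (t, p.1) * ‖Ψ (t, p.2)‖ ^ 2))
          + ∫ p : E3 × E3, kernel χ w t (p.1 - p.2)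
            * (‖Ψ (t, p.1)‖ ^ 2 * massRate Ψ (t, p.2))) := by
      have i23 : Integrable fun p : E3 × E3 => kernel χ w t (p.1 - p.2)
            * (massRate Ψ (t, p.1) * ‖Ψ (t, p.2)‖ ^ 2)
          + kernel χ w t (p.1 - p.2) * (‖Ψ (t, p.1)‖ ^ 2 * massRate Ψ (t, p.2)) := i2.add i3
      rw [← integral_add i2 i3, ← integral_const_mul, interaction,
        ← integral_add (i1.const_mul _) (i23.const_mul _)]
      rfl
    rw [hsplit, e3, e2]
    ring

include hχ h ha hab hB hw in
/-- The pseudoconformal energy law, with a time weight. -/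
theorem energy_law
    (heq : ∀ z ∈ posTime, Complex.I * dt Ψ z + ((z.1 ^ 2 : ℝ) : ℂ)⁻¹ * lap Ψ z
      - (scaledField χ Ψ z : ℂ) * Ψ z = 0) :
    IntegrableOn (fun t => deriv w t * kinetic Ψ t
      + interaction (kernelDeriv χ w (deriv w) t) Ψ t) (Ioc a b) ∧
    (w b * kinetic Ψ b + interaction (kernel χ w b) Ψ b)
      - (w a * kinetic Ψ a + interaction (kernel χ w a) Ψ a) =
      ∫ t in Ioc a b, (deriv w t * kinetic Ψ t
        + interaction (kernelDeriv χ w (deriv w) t) Ψ t) := by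
  obtain ⟨iK, eK⟩ := kinetic_balance hχ h ha hab hB hw heq
  obtain ⟨iI, eI⟩ := interaction_balance hχ h ha hab hB hw
  rw [slab] at iK eK
  have key : ∀ t ∈ Ioc a b, (∫ y, kineticSource χ Ψ w (t, y)) + ∫ p, interactionRate χ w Ψ t p =
      deriv w t * kinetic Ψ t + interaction (kernelDeriv χ w (deriv w) t) Ψ t := fun t ht => by
    have ht' := Ioc_subset_Icc_self ht
    obtain ⟨j1, j2⟩ := integral_interactionRate hχ h ha hB hw ht'
    have e1 : ∫ y, kineticSource χ Ψ w (t, y) = deriv w t * kinetic Ψ t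
        - w t * (t ^ 2 * ∫ y, scaledField χ Ψ (t, y) * massRate Ψ (t, y)) := by
      rw [kinetic, ← integral_const_mul (t ^ 2), ← integral_const_mul (w t),
        ← integral_const_mul (deriv w t), ← integral_sub
          ((hB.integrable_grad h ha ht').const_mul _) ((j1.const_mul _).const_mul _)]
      rfl
    -- The work of the mean field cancels here between the kinetic and the interaction parts.
    rw [e1, j2]
    ring
  have i1 := iK.integral_prod_left
  have i2 := iI.integral_prod_left
  have iadd := i1.add i2
  refine ⟨iadd.congr ((ae_restrict_mem measurableSet_Ioc).mono fun t ht => key t ht), ?_⟩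
  rw [← setIntegral_congr_fun measurableSet_Ioc key, integral_add i1 i2, ← integral_prod _ iK,
    ← integral_prod _ iI, ← eK, ← eI]
  ring

end

/-! ### Growth of the transformed solution -/

/-- Cauchy–Schwarz: the operator norm is at most the Hilbert–Schmidt norm. The Sobolev inequality is
stated with the former and the kinetic energy with the latter. -/
lemma norm_sq_clm_le (L : E3 →L[ℝ] ℂ) :
    ‖L‖ ^ 2 ≤ ∑ j, ‖L (EuclideanSpace.single j 1)‖ ^ 2 := by
  have h0 : 0 ≤ ∑ j, ‖L (EuclideanSpace.single j 1)‖ ^ 2 := by positivity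
  rw [← Real.le_sqrt (norm_nonneg _) h0]
  refine L.opNorm_le_bound (Real.sqrt_nonneg _) fun x => ?_
  calc ‖L x‖ = ‖∑ j, x j • L (EuclideanSpace.single j 1)‖ := by
        conv_lhs => rw [← sum_smul_single x]
        simp only [map_sum, map_smul]
    _ ≤ ∑ j, ‖L (EuclideanSpace.single j 1)‖ * ‖x j‖ := by
        refine (norm_sum_le _ _).trans (Finset.sum_le_sum fun j _ => ?_)
        rw [norm_smul, mul_comm]
    _ ≤ √(∑ j, ‖L (EuclideanSpace.single j 1)‖ ^ 2) * √(∑ j, ‖x j‖ ^ 2) :=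
        Real.sum_mul_le_sqrt_mul_sqrt _ _ _
    _ = _ := by rw [EuclideanSpace.norm_eq]

lemma exists_lintegral_pow_six_le : ∃ S : ℝ≥0, ∀ u : E3 → ℂ, ContDiff ℝ 1 u →
    ∫⁻ x, ‖u x‖ₑ ^ 2 ≠ ⊤ → ∫⁻ x, ‖u x‖ₑ ^ 6 ≤
      S * (∫⁻ x, ENNReal.ofReal (∑ j, ‖partialDeriv j u x‖ ^ 2)) ^ 3 := by
  obtain ⟨C, hC⟩ := exists_sobolev_const
  refine ⟨C ^ 6, fun u hu h2 => ?_⟩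
  have e2 := lintegral_enorm_pow (μ := (volume : Measure E3)) u (n := 2) (by norm_num)
  have e6 := lintegral_enorm_pow (μ := (volume : Measure E3)) u (n := 6) (by norm_num)
  have ed := lintegral_enorm_pow (μ := (volume : Measure E3)) (fderiv ℝ u) (n := 2) (by norm_num)
  norm_num at e2 e6 ed
  have hfin : eLpNorm u 2 volume ≠ ⊤ := fun h => h2 (by rw [e2, h]; simp)
  rw [e6]
  calc eLpNorm u 6 volume ^ 6 ≤ (C * eLpNorm (fderiv ℝ u) 2 volume) ^ 6 := by
        gcongr
        exact hC u hu hfin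
    _ = (C ^ 6 : ℝ≥0) * (∫⁻ x, ‖fderiv ℝ u x‖ₑ ^ 2) ^ 3 := by
        rw [ed, mul_pow, ← pow_mul]
        push_cast
        rfl
    _ ≤ _ := by
        gcongr with x
        rw [← ofReal_norm, ← ENNReal.ofReal_pow (norm_nonneg _)]
        exact ENNReal.ofReal_le_ofReal (norm_sq_clm_le _)

lemma lintegral_four_le {u : E3 → ℂ} (hu : Continuous u) {D : ℝ}
    (h : (∫⁻ x, ‖u x‖ₑ ^ 2) * ∫⁻ x, ‖u x‖ₑ ^ 6 ≤ ENNReal.ofReal D) :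
    ∫⁻ x, ‖u x‖ₑ ^ 4 ≤ ENNReal.ofReal (√D) := by
  have h1 := (lintegral_pow_four_le hu).trans h
  by_contra! h2
  have h3 : ENNReal.ofReal (√D) ^ 2 < (∫⁻ x, ‖u x‖ₑ ^ 4) ^ 2 := by
    exact ENNReal.pow_lt_pow_left (by norm_num) h2
  rw [← ENNReal.ofReal_pow (Real.sqrt_nonneg _)] at h3
  refine absurd (h3.trans_le h1) (not_lt.2 (ENNReal.ofReal_le_ofReal ?_))
  rcases le_or_gt 0 D with hD | hD
  · rw [Real.sq_sqrt hD]
  · exact hD.le.trans (sq_nonneg _)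

/-- The Schur test applied to `|Ψ|²`; its factor two cancels the one half in `interaction`. -/
lemma interaction_le {k : E3 → ℝ} (hk : Measurable k) (hk0 : ∀ x, 0 ≤ k x) (hki : Integrable k)
    {Ψ : ℝ × E3 → ℂ} {t : ℝ} (hΨ : Continuous fun y => Ψ (t, y)) {X : ℝ} (hX : 0 ≤ X)
    (h : ∫⁻ y, ‖Ψ (t, y)‖ₑ ^ 4 ≤ ENNReal.ofReal X) : interaction k Ψ t ≤ (∫ x, k x) * X := by
  have hN : Measurable fun y => ‖Ψ (t, y)‖ ^ 2 := (hΨ.norm.pow 2).measurable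
  have hI : 0 ≤ ∫ x, k x := integral_nonneg hk0
  have h0 : ∀ p : E3 × E3, 0 ≤ k (p.1 - p.2) * (‖Ψ (t, p.1)‖ ^ 2 * ‖Ψ (t, p.2)‖ ^ 2) := fun p =>
    mul_nonneg (hk0 _) (by positivity)
  rw [interaction, integral_const_mul, integral_eq_lintegral_of_nonneg_ae (ae_of_all _ h0)
    (measurable_kernel_mul hk hN hN).aestronglyMeasurable]
  have h1 : ∫⁻ p : E3 × E3, ENNReal.ofReal (k (p.1 - p.2)
      * (‖Ψ (t, p.1)‖ ^ 2 * ‖Ψ (t, p.2)‖ ^ 2)) ≤ ENNReal.ofReal (2 * ((∫ x, k x) * X)) := by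
    calc _ = ∫⁻ p : E3 × E3, ENNReal.ofReal (k (p.1 - p.2))
            * (‖Ψ (t, p.1)‖ₑ ^ 2 * ‖Ψ (t, p.2)‖ₑ ^ 2) := by
          refine lintegral_congr fun p => ?_
          rw [ENNReal.ofReal_mul (hk0 _), ENNReal.ofReal_mul (by positivity),
            ENNReal.ofReal_pow (norm_nonneg _), ENNReal.ofReal_pow (norm_nonneg _), ofReal_norm,
            ofReal_norm]
      _ ≤ 2 * (∫⁻ x, ENNReal.ofReal (k x)) * ∫⁻ x, (‖Ψ (t, x)‖ₑ ^ 2) ^ 2 :=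
          lintegral_kernel_sq_le (k := fun x => ENNReal.ofReal (k x))
            (f := fun x => ‖Ψ (t, x)‖ₑ ^ 2) hk.ennreal_ofReal (hΨ.enorm.measurable.pow_const 2)
      _ ≤ 2 * ENNReal.ofReal (∫ x, k x) * ENNReal.ofReal X := by
          rw [ofReal_integral_eq_lintegral_ofReal hki (ae_of_all _ hk0)]
          gcongr
          simpa only [← pow_mul] using h
      _ = _ := by
          rw [ENNReal.ofReal_mul (by norm_num), ENNReal.ofReal_mul hI]
          norm_num
          ring
  have h2 := ENNReal.toReal_mono ENNReal.ofReal_ne_top h1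
  rw [ENNReal.toReal_ofReal (by positivity)] at h2
  linarith

lemma interaction_nonneg {k : E3 → ℝ} (hk0 : ∀ x, 0 ≤ k x) (Ψ : ℝ × E3 → ℂ) (t : ℝ) :
    0 ≤ interaction k Ψ t :=
  integral_nonneg fun p => mul_nonneg (by norm_num) (mul_nonneg (hk0 _) (by positivity))

lemma interaction_nonpos {k : E3 → ℝ} (hk0 : ∀ x, k x ≤ 0) (Ψ : ℝ × E3 → ℂ) (t : ℝ) :
    interaction k Ψ t ≤ 0 :=
  integral_nonpos fun p => mul_nonpos_of_nonneg_of_nonpos (by norm_num)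
    (mul_nonpos_of_nonpos_of_nonneg (hk0 _) (by positivity))

lemma kinetic_nonneg (Ψ : ℝ × E3 → ℂ) (t : ℝ) : 0 ≤ kinetic Ψ t :=
  integral_nonneg fun y => by positivity

/-- The hypotheses on the transformed solution under which its energy is controlled. -/
structure IsTransformed (χ : ℝ → ℝ) (M E : ℝ) (Ψ : ℝ × E3 → ℂ) : Prop where
  smooth : ContDiffOn ℝ ∞ Ψ posTime
  equation : ∀ z ∈ posTime, Complex.I * dt Ψ z + ((z.1 ^ 2 : ℝ) : ℂ)⁻¹ * lap Ψ z
    - (scaledField χ Ψ z : ℂ) * Ψ z = 0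
  controlled : ∀ T, ∃ B, Controlled Ψ 1 T B
  mass : ∀ t, 1 ≤ t → ∫⁻ y, ‖Ψ (t, y)‖ₑ ^ 2 ≤ ENNReal.ofReal M
  energy : kinetic Ψ 1 + interaction (potential χ) Ψ 1 ≤ E

/-! ### Growth of the kinetic energy: the linear bound and its bootstrap. -/

namespace IsTransformed

variable {χ : ℝ → ℝ} (hχ : IsDecreasingCutoff χ) {M E : ℝ} {Ψ : ℝ × E3 → ℂ}
  (h : IsTransformed χ M E Ψ)

include h in
lemma lintegral_six_le {S : ℝ≥0} (hS : ∀ u : E3 → ℂ, ContDiff ℝ 1 u →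
    ∫⁻ x, ‖u x‖ₑ ^ 2 ≠ ⊤ → ∫⁻ x, ‖u x‖ₑ ^ 6 ≤
      S * (∫⁻ x, ENNReal.ofReal (∑ j, ‖partialDeriv j u x‖ ^ 2)) ^ 3) {t : ℝ} (ht : 1 ≤ t) :
    ∫⁻ y, ‖Ψ (t, y)‖ₑ ^ 6 ≤ S * ENNReal.ofReal (kinetic Ψ t) ^ 3 := by
  have ht0 : 0 < t := by linarith
  obtain ⟨B, hB⟩ := h.controlled t
  refine (hS _ ((contDiff_slice h.smooth ht0).of_le (by exact_mod_cast le_top))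
    ((h.mass t ht).trans_lt ENNReal.ofReal_lt_top).ne).trans ?_
  rw [kinetic, ofReal_integral_eq_lintegral_ofReal
    (hB.integrable_grad h.smooth le_rfl ⟨ht, le_rfl⟩) (ae_of_all _ fun y => by positivity)]
  simp only [partialDeriv, fderiv_slice h.smooth (by simp : (∞ : WithTop ℕ∞) ≠ 0) ht0]
  rfl

include hχ h

lemma energy_nonneg : 0 ≤ E :=
  (add_nonneg (kinetic_nonneg _ _) (interaction_nonneg hχ.potential_nonneg _ _)).trans h.energy

/-- The weight `1/t` is chosen so that `w t² v(tx) = χ(t‖x‖)/‖x‖`, which decreases in time. Both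
parts of the rate are then non-positive, and dropping the non-negative interaction at time `t`
leaves `K(t)/t ≤ E`. -/
lemma kinetic_le_linear {t : ℝ} (ht : 1 ≤ t) : kinetic Ψ t ≤ E * t := by
  obtain ⟨B, hB⟩ := h.controlled t
  have ht0 : 0 < t := by linarith
  have hw : ContDiffOn ℝ 1 (fun s : ℝ => s⁻¹) (Ioi 0) :=
    contDiffOn_id.inv fun s hs => ne_of_gt hs
  obtain ⟨-, hlaw⟩ := energy_law hχ h.smooth le_rfl ht hB hw h.equation
  have hneg : ∫ s in Ioc 1 t, (deriv (fun s : ℝ => s⁻¹) s * kinetic Ψ s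
      + interaction (kernelDeriv χ (fun s => s⁻¹) (deriv fun s => s⁻¹) s) Ψ s) ≤ 0 := by
    refine setIntegral_nonpos measurableSet_Ioc fun s hs => ?_
    have hs0 : 0 < s := by linarith [hs.1]
    refine add_nonpos ?_ (interaction_nonpos (fun x => ?_) _ _)
    · rw [deriv_inv]
      refine mul_nonpos_of_nonpos_of_nonneg ?_ (kinetic_nonneg _ _)
      simp only [Left.neg_nonpos_iff]
      positivity
    · rcases eq_or_ne x 0 with rfl | hx
      · simp [kernelDeriv]
      have hr : 0 < ‖x‖ := norm_pos_iff.2 hx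
      have e : kernelDeriv χ (fun s => s⁻¹) (deriv fun s => s⁻¹) s x = deriv χ (s * ‖x‖) := by
        rw [kernelDeriv, deriv_inv]
        field_simp
        ring
      rw [e]
      exact hχ.deriv_nonpos (by positivity)
  have e1 : kernel χ (fun s => s⁻¹) 1 = potential χ := by
    funext x
    simp [kernel]
  have h2 : 0 ≤ interaction (kernel χ (fun s => s⁻¹) t) Ψ t :=
    interaction_nonneg (fun x => mul_nonneg (by positivity)
      (mul_nonneg (by positivity) (hχ.potential_nonneg _))) _ _
  rw [e1] at hlaw
  have h3 := h.energy
  have h4 : t⁻¹ * kinetic Ψ t ≤ E := by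
    simp only [inv_one, one_mul] at hlaw
    linarith
  rwa [inv_mul_le_iff₀ ht0, mul_comm] at h4

/-- With weight one only the interaction rate remains. Its size is estimated with the linear bound
already proved, and integration in time turns `s^{-1/2}` into `t^{1/2}`. -/
lemma kinetic_le_sqrt {S : ℝ≥0} (hS : ∀ u : E3 → ℂ, ContDiff ℝ 1 u →
    ∫⁻ x, ‖u x‖ₑ ^ 2 ≠ ⊤ → ∫⁻ x, ‖u x‖ₑ ^ 6 ≤
      S * (∫⁻ x, ENNReal.ofReal (∑ j, ‖partialDeriv j u x‖ ^ 2)) ^ 3) {t : ℝ} (ht : 1 ≤ t) :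
    kinetic Ψ t ≤ (E + 2 * ((∫ x, potential χ x) * √(M * (S * E ^ 3)))) * t ^ (1 / 2 : ℝ) := by
  obtain ⟨B, hB⟩ := h.controlled t
  have ht0 : 0 < t := by linarith
  have hE := h.energy_nonneg hχ
  set V := ∫ x, potential χ x with hV
  have hV0 : 0 ≤ V := integral_nonneg hχ.potential_nonneg
  set D := √(M * (S * E ^ 3)) with hD
  obtain ⟨hint, hlaw⟩ := energy_law hχ h.smooth le_rfl ht hB (w := fun _ => 1) contDiffOn_const
    h.equation
  have hbound : ∀ s ∈ Ioc 1 t, deriv (fun _ : ℝ => (1 : ℝ)) s * kinetic Ψ s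
      + interaction (kernelDeriv χ (fun _ => 1) (deriv fun _ => 1) s) Ψ s
      ≤ V * D * s ^ (-(1 / 2) : ℝ) := fun s hs => by
    have hs1 : 1 ≤ s := hs.1.le
    have hs0 : 0 < s := by linarith
    have hc : Continuous fun y => Ψ (s, y) := continuous_slice h.smooth.continuousOn hs0
    -- Interpolation between mass and L⁶, with the linear bound inserted in Sobolev, gives growth
    -- `s^{3/2}`.
    have hL4 : ∫⁻ y, ‖Ψ (s, y)‖ₑ ^ 4 ≤ ENNReal.ofReal (√(M * (S * (E * s) ^ 3))) := by
      refine lintegral_four_le hc ?_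
      rw [ENNReal.ofReal_mul' (by positivity), ENNReal.ofReal_mul (by positivity),
        ENNReal.ofReal_pow (by positivity), ENNReal.ofReal_coe_nnreal]
      gcongr
      · exact h.mass s hs1
      · refine (h.lintegral_six_le hS hs1).trans ?_
        gcongr
        exact h.kinetic_le_linear hχ hs1
    have e1 : √(M * (S * (E * s) ^ 3)) = D * s ^ (3 / 2 : ℝ) := by
      have : M * (S * (E * s) ^ 3) = M * (S * E ^ 3) * (s ^ (3 / 2 : ℝ)) ^ 2 := by
        rw [← Real.rpow_natCast (s ^ (3 / 2 : ℝ)), ← Real.rpow_mul hs0.le]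
        norm_num
        ring
      rw [this, Real.sqrt_mul' _ (sq_nonneg _), Real.sqrt_sq (by positivity)]
    rw [e1] at hL4
    set k : E3 → ℝ := fun x => s * potential χ (s • x) with hk
    have hk0 : ∀ x, 0 ≤ k x := fun x => mul_nonneg hs0.le (hχ.potential_nonneg _)
    have hkm : Measurable k := by
      have := hχ.measurable_potential
      fun_prop
    have hki : Integrable k := (hχ.integrable_potential.comp_smul hs0.ne').const_mul s
    -- The Jacobian `s⁻³` against the explicit factor `s`.
    have hkI : ∫ x, k x = s ^ (-2 : ℝ) * V := by
      rw [hk, integral_const_mul, Measure.integral_comp_smul volume (potential χ) s]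
      rw [abs_of_nonneg (by positivity)]
      simp only [finrank_euclideanSpace, Fintype.card_fin, smul_eq_mul]
      rw [Real.rpow_neg hs0.le]
      norm_num
      field_simp
      rw [hV]
    have h1 := interaction_le hkm hk0 hki hc (by positivity) hL4
    -- The derivative of `s χ(s‖x‖)/‖x‖` is `χ(s‖x‖)/‖x‖ + s χ'(s‖x‖)`. The second term is
    -- non-positive and is discarded, leaving `s v(sx)`.
    have h2 : interaction (kernelDeriv χ (fun _ => 1) (deriv fun _ => 1) s) Ψ s
        ≤ interaction k Ψ s := by
      obtain ⟨C, hC⟩ := exists_kernel_le (b := t) hχ le_rfl (w := fun _ => (1 : ℝ)) contDiffOn_const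
      have hs' := Ioc_subset_Icc_self hs
      refine integral_mono ((integrable_density_density hχ h.smooth le_rfl hB hs'
        (fun x => (hC s hs' x).2) (measurable_kernelDeriv hχ s _)).const_mul _)
        ((integrable_density_density (C := s) hχ h.smooth le_rfl hB hs' (fun x => ?_) hkm).const_mul _)
        fun p => ?_
      · rw [abs_of_nonneg (hk0 x)]
        have := hχ.potential_smul_le hs1 x
        have := hχ.potential_nonneg x
        simp only [hk]
        gcongr
        linarith
      · simp only
        gcongr
        set x := p.1 - p.2
        rcases eq_or_ne x 0 with hx | hx
        · rw [hx]
          simp [kernelDeriv, hk, potential]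
        have hr : 0 < ‖x‖ := norm_pos_iff.2 hx
        have hd := hχ.deriv_nonpos (mul_pos hs0 hr)
        have e : kernelDeriv χ (fun _ => 1) (deriv fun _ => 1) s x =
            χ (s * ‖x‖) / ‖x‖ + s * deriv χ (s * ‖x‖) := by
          simp [kernelDeriv]
          field_simp
        have e' : k x = χ (s * ‖x‖) / ‖x‖ := by
          simp only [hk, potential, norm_smul, Real.norm_of_nonneg hs0.le]
          field_simp
        rw [e, e']
        nlinarith
    have h3 : s ^ (-2 : ℝ) * V * (D * s ^ (3 / 2 : ℝ)) = V * D * s ^ (-(1 / 2) : ℝ) := by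
      have : s ^ (-(1 / 2) : ℝ) = s ^ (-2 : ℝ) * s ^ (3 / 2 : ℝ) := by
        rw [← Real.rpow_add hs0]
        norm_num
      rw [this]
      ring
    rw [deriv_const, zero_mul, zero_add]
    rw [hkI, h3] at h1
    exact h2.trans h1
  -- The integral of `s^{-1/2}` from `1` to `t` is `2 (t^{1/2} - 1)`, which explains the factor two
  -- in the statement.
  have hii : IntervalIntegrable (fun s : ℝ => V * D * s ^ (-(1 / 2) : ℝ)) volume 1 t :=
    (intervalIntegral.intervalIntegrable_rpow' (by norm_num)).const_mul _
  have hle := setIntegral_mono_on hint ((intervalIntegrable_iff_integrableOn_Ioc_of_le ht).1 hii)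
    measurableSet_Ioc hbound
  rw [← hlaw, ← intervalIntegral.integral_of_le ht, intervalIntegral.integral_const_mul,
    integral_rpow (Or.inl (by norm_num))] at hle
  have e1 : kernel χ (fun _ => 1) 1 = potential χ := by
    funext x
    simp [kernel]
  have h2 : 0 ≤ interaction (kernel χ (fun _ => 1) t) Ψ t :=
    interaction_nonneg (fun x => mul_nonneg (by positivity)
      (mul_nonneg (by positivity) (hχ.potential_nonneg _))) _ _
  rw [e1] at hle
  have h3 := h.energy
  have h5 : (1 : ℝ) ≤ t ^ (1 / 2 : ℝ) := Real.one_le_rpow ht (by norm_num)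
  have hVD : 0 ≤ V * D := by positivity
  norm_num at hle
  have h6 : E ≤ E * t ^ (1 / 2 : ℝ) := le_mul_of_one_le_right hE h5
  rw [add_mul]
  nlinarith

end IsTransformed

/-! ### A priori bounds for the solution -/

/-- A time-dependent function as a function on space-time. -/
def spacetime (φ : ℝ → E3 → ℂ) (z : ℝ × E3) : ℂ := φ z.1 z.2

/-- Uniform `H²` bounds on a time interval. -/
structure SobolevBound (φ : ℝ → E3 → ℂ) (T : ℝ) (B : ℝ≥0) : Prop where
  zero : ∀ t ∈ Ioc 0 T, ∫⁻ x, ‖φ t x‖ₑ ^ 2 ≤ B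
  one : ∀ t ∈ Ioc 0 T, ∀ j, ∫⁻ x, ‖dx j (spacetime φ) (t, x)‖ₑ ^ 2 ≤ B
  two : ∀ t ∈ Ioc 0 T, ∫⁻ x, ‖lap (spacetime φ) (t, x)‖ₑ ^ 2 ≤ B

namespace IsGlobalSmoothSolution

variable {v : E3 → ℝ} {φ₀ : E3 → ℂ} {φ : ℝ → E3 → ℂ} (hφ : IsGlobalSmoothSolution v φ₀ φ)
include hφ

lemma contDiffOn_spacetime : ContDiffOn ℝ ∞ (spacetime φ) posTime :=
  hφ.smooth.mono (prod_mono Ioi_subset_Ici_self le_rfl)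

lemma contDiff_slice {t : ℝ} (ht : 0 < t) : ContDiff ℝ ∞ (φ t) :=
  Hartree.contDiff_slice hφ.contDiffOn_spacetime ht

lemma partialDeriv_eq {t : ℝ} (ht : 0 < t) (j : Fin 3) (x : E3) :
    partialDeriv j (φ t) x = dx j (spacetime φ) (t, x) :=
  fderiv_slice hφ.contDiffOn_spacetime (by simp) ht x j

lemma iteratedFDeriv_two_eq {t : ℝ} (ht : 0 < t) (j : Fin 3) (x : E3) :
    iteratedFDeriv ℝ 2 (φ t) x ![EuclideanSpace.single j 1, EuclideanSpace.single j 1] =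
      dx j (dx j (spacetime φ)) (t, x) := by
  have hs := hφ.contDiffOn_spacetime
  have hd : Differentiable ℝ (fderiv ℝ (φ t)) :=
    ((hφ.contDiff_slice ht).fderiv_right (m := ∞) (by simp)).differentiable (by simp)
  rw [iteratedFDeriv_two_apply, dx, ← fderiv_slice (contDiffOn_dx hs j) (by simp) ht]
  have e : (fun y => dx j (spacetime φ) (t, y)) =
      fun y => fderiv ℝ (φ t) y (EuclideanSpace.single j 1) := by
    funext y
    exact (hφ.partialDeriv_eq ht j y).symm
  rw [e, fderiv_clm_apply (hd x) (differentiableAt_const _)]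
  simp

lemma laplacian_eq {t : ℝ} (ht : 0 < t) (x : E3) :
    Laplacian.laplacian (φ t) x = lap (spacetime φ) (t, x) := by
  rw [InnerProductSpace.laplacian_eq_iteratedFDeriv_orthonormalBasis (φ t)
    (EuclideanSpace.basisFun (Fin 3) ℝ), lap]
  refine Finset.sum_congr rfl fun j _ => ?_
  rw [← hφ.iteratedFDeriv_two_eq ht, EuclideanSpace.basisFun_apply]

lemma equation_spacetime {z : ℝ × E3} (hz : z ∈ posTime) :
    Complex.I * dt (spacetime φ) z + lap (spacetime φ) z
      - (meanField v (φ z.1) z.2 : ℂ) * spacetime φ z = 0 := by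
  have ht : 0 < z.1 := hz.1
  have h := hφ.equation z.1 ht z.2
  have hd : HasDerivAt (fun s => φ s z.2) (dt (spacetime φ) z) z.1 :=
    hasDerivAt_slice hφ.contDiffOn_spacetime (by simp) ht z.2
  rw [hφ.laplacian_eq ht, hd.deriv] at h
  exact h

lemma exists_sobolevBound (T : ℝ) : ∃ B, SobolevBound φ T B := by
  obtain ⟨B, hB⟩ := hφ.sobolev T
  have key : ∀ t ∈ Ioc 0 T, ∀ k : ℕ, k ≤ 2 →
      ∫⁻ x, ‖iteratedFDeriv ℝ k (φ t) x‖ₑ ^ 2 ≤ ENNReal.ofReal B ^ 2 := fun t ht k hk => by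
    have e := lintegral_enorm_pow (μ := (volume : Measure E3)) (iteratedFDeriv ℝ k (φ t)) (n := 2)
      (by norm_num)
    rw [e]
    gcongr
    exact_mod_cast hB t (Ioc_subset_Icc_self ht) k hk
  have hsingle : ∀ j : Fin 3, ‖EuclideanSpace.single j (1 : ℝ)‖ = 1 := fun j => by simp
  -- The nine is the square of the three terms of the Laplacian, each at most the norm of the second
  -- derivative.
  have e9 : ((9 * B.toNNReal ^ 2 : ℝ≥0) : ℝ≥0∞) = 9 * ENNReal.ofReal B ^ 2 := by
    push_cast
    rfl
  have hle : ENNReal.ofReal B ^ 2 ≤ 9 * ENNReal.ofReal B ^ 2 :=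
    le_mul_of_one_le_left zero_le (by norm_num)
  refine ⟨9 * B.toNNReal ^ 2, ⟨fun t ht => ?_, fun t ht j => ?_, fun t ht => ?_⟩⟩ <;> rw [e9]
  · refine le_trans (le_of_eq (lintegral_congr fun x => ?_)) ((key t ht 0 (by norm_num)).trans hle)
    congr 1
    rw [← ofReal_norm, ← ofReal_norm, norm_iteratedFDeriv_zero]
  · refine (lintegral_mono fun x => ?_).trans ((key t ht 1 (by norm_num)).trans hle)
    gcongr
    rw [enorm_le_iff_norm_le, ← hφ.partialDeriv_eq ht.1, norm_iteratedFDeriv_one, partialDeriv]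
    simpa using (fderiv ℝ (φ t) x).le_opNorm (EuclideanSpace.single j 1)
  · calc ∫⁻ x, ‖lap (spacetime φ) (t, x)‖ₑ ^ 2
        ≤ ∫⁻ x, 9 * ‖iteratedFDeriv ℝ 2 (φ t) x‖ₑ ^ 2 := by
          refine lintegral_mono fun x => ?_
          have : ‖lap (spacetime φ) (t, x)‖ₑ ≤ 3 * ‖iteratedFDeriv ℝ 2 (φ t) x‖ₑ := by
            refine (enorm_sum_le _ _).trans ?_
            refine (Finset.sum_le_sum (g := fun _ => ‖iteratedFDeriv ℝ 2 (φ t) x‖ₑ)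
              fun j _ => ?_).trans (le_of_eq (by simp))
            rw [enorm_le_iff_norm_le, ← hφ.iteratedFDeriv_two_eq ht.1]
            refine ((iteratedFDeriv ℝ 2 (φ t) x).le_opNorm _).trans (le_of_eq ?_)
            simp [Fin.prod_univ_two]
          calc _ ≤ (3 * ‖iteratedFDeriv ℝ 2 (φ t) x‖ₑ) ^ 2 := by gcongr
            _ = _ := by
              rw [mul_pow]
              norm_num
      _ ≤ _ := by
          rw [lintegral_const_mul' _ _ (by finiteness)]
          gcongr
          exact key t ht 2 le_rfl

end IsGlobalSmoothSolution

/-! ### The mass does not increase. -/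

section mass

variable {v : E3 → ℝ} {φ₀ : E3 → ℂ} {φ : ℝ → E3 → ℂ} (hφ : IsGlobalSmoothSolution v φ₀ φ)

/-- The mass flux, with a time weight. -/
def massFlux (w : ℝ → ℝ) (φ : ℝ → E3 → ℂ) (j : Fin 3) (z : ℝ × E3) : ℝ :=
  w z.1 * (-2 * (conj (spacetime φ z) * dx j (spacetime φ) z).im)

lemma abs_massFlux_le (w : ℝ → ℝ) (φ : ℝ → E3 → ℂ) (j : Fin 3) (z : ℝ × E3) :
    |massFlux w φ j z| ≤ |w z.1| * (2 * (‖spacetime φ z‖ * ‖dx j (spacetime φ) z‖)) := by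
  rw [massFlux, abs_mul, abs_mul, abs_neg, abs_two]
  gcongr
  refine (Complex.abs_im_le_norm _).trans (le_of_eq ?_)
  simp

include hφ in
lemma mass_weighted_balance {w : ℝ → ℝ} (hw : ContDiffOn ℝ 1 w (Ioi 0)) {a b : ℝ} (ha : 0 < a)
    (hab : a ≤ b) {η : E3 → ℝ} (hη : ContDiff ℝ 1 η) (hηc : HasCompactSupport η) :
    Integrable (fun z => η z.2 * (deriv w z.1 * ‖spacetime φ z‖ ^ 2)
      - ∑ j, fderiv ℝ η z.2 (EuclideanSpace.single j 1) * massFlux w φ j z) (slab a b) ∧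
    w b * (∫ x, η x * ‖φ b x‖ ^ 2) - w a * ∫ x, η x * ‖φ a x‖ ^ 2 =
      ∫ z, (η z.2 * (deriv w z.1 * ‖spacetime φ z‖ ^ 2)
        - ∑ j, fderiv ℝ η z.2 (EuclideanSpace.single j 1) * massFlux w φ j z) ∂(slab a b) := by
  have hs := hφ.contDiffOn_spacetime
  have hF := contDiffOn_time_mul hw (contDiffOn_norm_sq hs)
  have hG : ∀ j, ContDiffOn ℝ 1 (massFlux w φ j) posTime := fun j =>
    contDiffOn_time_mul hw (contDiffOn_const.mul (contDiffOn_im_conj_mul hs (contDiffOn_dx hs j)))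
  obtain ⟨h1, h2⟩ := weighted_balance hF hG ha hab hη hηc
  have hsl : ∀ᵐ z ∂(slab a b), z ∈ posTime := by
    have h1 : ∀ᵐ t ∂(volume.restrict (Ioc a b)), 0 < t :=
      (ae_restrict_mem measurableSet_Ioc).mono fun t ht => ha.trans ht.1
    have := (Measure.quasiMeasurePreserving_fst (μ := volume.restrict (Ioc a b))
      (ν := (volume : Measure E3))).ae h1
    exact this.mono fun z hz => ⟨hz, mem_univ _⟩
  have hae : (fun z => η z.2 * source (fun z => w z.1 * ‖spacetime φ z‖ ^ 2) (massFlux w φ) z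
      - ∑ j, fderiv ℝ η z.2 (EuclideanSpace.single j 1) * massFlux w φ j z) =ᵐ[slab a b]
      fun z => η z.2 * (deriv w z.1 * ‖spacetime φ z‖ ^ 2)
        - ∑ j, fderiv ℝ η z.2 (EuclideanSpace.single j 1) * massFlux w φ j z := by
    refine hsl.mono fun z hz => ?_
    simp only
    rw [← source_mass hs hw hz (hφ.equation_spacetime hz)]
    rfl
  refine ⟨h1.congr hae, ?_⟩
  rw [← integral_congr_ae hae, ← h2, ← integral_const_mul, ← integral_const_mul]
  congr 2 <;> · ext x; simp only [spacetime]; ring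

include hφ in
-- Only the flux through the gradient of the cut-off changes the truncated mass, and uniform H¹
-- bounds make this `O(1/(n + 1))`. The twelve collects three directions, the factor two of the
-- flux, and `B + B` from the product of `φ` and its derivative.
lemma cutoff_mass_le {T : ℝ} {B : ℝ≥0} (hB : SobolevBound φ T B) {L : ℝ} (hL0 : 0 ≤ L)
    (hL : ∀ (n : ℕ) x, ‖fderiv ℝ (cutoff n) x‖ ≤ L / (n + 1)) (n : ℕ) {a : ℝ} (ha : 0 < a)
    (haT : a ≤ T) : ∫ x, cutoff n x * ‖φ T x‖ ^ 2 ≤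
      (∫ x, cutoff n x * ‖φ a x‖ ^ 2) + L / (n + 1) * (12 * B * T) := by
  have hs := hφ.contDiffOn_spacetime
  have hw : ContDiffOn ℝ 1 (fun _ : ℝ => (1 : ℝ)) (Ioi 0) := contDiffOn_const
  have key := (mass_weighted_balance hφ hw ha haT ((contDiff_cutoff n).of_le
    (by exact_mod_cast le_top)) (hasCompactSupport_cutoff n)).2
  simp only [deriv_const, zero_mul, mul_zero, zero_sub, one_mul] at key
  have hD0 : 0 ≤ L / (n + 1) := by positivity
  have hT : 0 < T := ha.trans_le haT
  have hbound : ‖∫ z, -∑ j, fderiv ℝ (cutoff n) z.2 (EuclideanSpace.single j 1)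
      * massFlux (fun _ => 1) φ j z ∂(slab a T)‖ₑ ≤ ENNReal.ofReal (L / (n + 1) * (12 * B * T)) := by
    refine (enorm_integral_le_lintegral_enorm _).trans ?_
    refine (lintegral_prod_le _).trans ?_
    calc _ ≤ ∫⁻ t in Ioc a T, ENNReal.ofReal (L / (n + 1)) * (12 * B) := by
          refine setLIntegral_mono measurable_const fun t ht => ?_
          have ht' : t ∈ Ioc 0 T := ⟨ha.trans ht.1, ht.2⟩
          have hm0 : Measurable fun x => ‖φ t x‖ₑ :=
            (hφ.contDiff_slice ht'.1).continuous.enorm.measurable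
          have hm : ∀ j, Measurable fun x => ‖dx j (spacetime φ) (t, x)‖ₑ := fun j =>
            (continuous_slice (contDiffOn_dx hs j).continuousOn ht'.1).enorm.measurable
          calc _ ≤ ∫⁻ x, ∑ j, ENNReal.ofReal (L / (n + 1))
                * (2 * (‖φ t x‖ₑ * ‖dx j (spacetime φ) (t, x)‖ₑ)) := by
                refine lintegral_mono fun x => ?_
                rw [enorm_neg]
                refine (enorm_sum_le _ _).trans (Finset.sum_le_sum fun j _ => ?_)
                rw [enorm_mul]
                gcongr
                · rw [← ofReal_norm]
                  refine ENNReal.ofReal_le_ofReal ?_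
                  refine ((fderiv ℝ (cutoff n) x).le_opNorm _).trans ?_
                  simpa using hL n x
                · have h1 := ENNReal.ofReal_le_ofReal (abs_massFlux_le (fun _ => 1) φ j (t, x))
                  rw [← Real.enorm_eq_ofReal_abs, abs_one, one_mul,
                    ENNReal.ofReal_mul (by norm_num), ENNReal.ofReal_mul (norm_nonneg _),
                    ofReal_norm, ofReal_norm] at h1
                  simpa [spacetime] using h1
            _ ≤ ∑ j : Fin 3, ENNReal.ofReal (L / (n + 1)) * (2 * ((B : ℝ≥0∞) + B)) := by
                rw [lintegral_finsetSum _ fun j _ => by have := hm j; fun_prop]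
                refine Finset.sum_le_sum fun j _ => ?_
                rw [lintegral_const_mul' _ _ (by finiteness),
                  lintegral_const_mul' _ _ (by finiteness)]
                gcongr
                refine (lintegral_mul_le_sq_add_sq hm0).trans ?_
                gcongr
                · exact hB.zero t ht'
                · exact hB.one t ht' j
            _ = _ := by
                simp only [Finset.sum_const, Finset.card_univ, Fintype.card_fin, nsmul_eq_mul]
                push_cast
                ring
      _ ≤ _ := by
          rw [setLIntegral_const, Real.volume_Ioc]
          have : (12 * B : ℝ≥0∞) = ENNReal.ofReal (12 * B) := by
            rw [ENNReal.ofReal_mul (by norm_num)]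
            simp
          rw [this, ← ENNReal.ofReal_mul hD0, ← ENNReal.ofReal_mul (by positivity)]
          refine ENNReal.ofReal_le_ofReal ?_
          rw [mul_assoc]
          gcongr
          linarith
  have h2 : |(∫ x, cutoff n x * ‖φ T x‖ ^ 2) - ∫ x, cutoff n x * ‖φ a x‖ ^ 2| ≤
      L / (n + 1) * (12 * B * T) := by
    rw [key, ← Real.norm_eq_abs]
    rw [← ofReal_norm] at hbound
    exact (ENNReal.ofReal_le_ofReal_iff (by positivity)).1 hbound
  linarith [(abs_le.1 h2).2]

include hφ in
-- The equation holds only for positive times, so the initial mass has to be reached as a limit.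
-- Continuity up to `t = 0` is uniformly controlled on the compact support of the cut-off.
lemma tendsto_cutoff_mass (n : ℕ) : Tendsto (fun k : ℕ => ∫ x, cutoff n x * ‖φ (1 / (k + 1)) x‖ ^ 2)
    atTop (𝓝 (∫ x, cutoff n x * ‖φ₀ x‖ ^ 2)) := by
  have hc : ContinuousOn (fun z : ℝ × E3 => ‖φ z.1 z.2‖ ^ 2) (Ici 0 ×ˢ univ) :=
    hφ.smooth.continuousOn.norm.pow 2
  obtain ⟨C, hC⟩ := (isCompact_Icc (a := (0 : ℝ)) (b := 1)).prod
    (hasCompactSupport_cutoff n).isCompact |>.exists_bound_of_continuousOn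
    (hc.mono (prod_mono Icc_subset_Ici_self (subset_univ _)))
  have hk : ∀ k : ℕ, (1 / (k + 1) : ℝ) ∈ Icc (0 : ℝ) 1 := fun k =>
    ⟨by positivity, by rw [div_le_one (by positivity)]; simp⟩
  have hsl : ∀ {t : ℝ}, 0 ≤ t → Continuous fun x => ‖φ t x‖ ^ 2 := fun ht =>
    continuousOn_univ.1 (hc.comp (by fun_prop : ContinuousOn (fun x : E3 => (_, x)) univ)
      fun x _ => ⟨ht, mem_univ _⟩)
  refine tendsto_integral_of_dominated_convergence (fun x => cutoff n x * C) (fun k => ?_) ?_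
    (fun k => ae_of_all _ fun x => ?_) (ae_of_all _ fun x => ?_)
  · exact ((contDiff_cutoff n).continuous.mul (hsl (hk k).1)).aestronglyMeasurable
  · exact ((contDiff_cutoff n).continuous.integrable_of_hasCompactSupport
      (hasCompactSupport_cutoff n)).mul_const C
  · rw [norm_mul, Real.norm_of_nonneg (cutoff_nonneg n x)]
    by_cases hx : x ∈ tsupport (cutoff n)
    · gcongr
      · exact cutoff_nonneg n x
      · exact hC (_, x) ⟨hk k, hx⟩
    · simp [image_eq_zero_of_notMem_tsupport hx]
  · refine Tendsto.const_mul _ ?_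
    have h0 : ContinuousWithinAt (fun t => ‖φ t x‖ ^ 2) (Ici 0) 0 :=
      (hc.comp (by fun_prop : ContinuousOn (fun t : ℝ => (t, x)) (Ici 0))
        fun t ht => ⟨ht, mem_univ _⟩) 0 self_mem_Ici
    have h1 := h0.tendsto.comp (tendsto_nhdsWithin_iff.2
      ⟨tendsto_one_div_add_atTop_nhds_zero_nat (𝕜 := ℝ), Eventually.of_forall fun k => (hk k).1⟩)
    rw [hφ.initial] at h1
    exact h1

include hφ in
-- Let the starting time tend to zero for a fixed cut-off, then remove the cut-off with Fatou. The
-- inequality is all that the decay estimates use.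
lemma lintegral_norm_sq_le {t : ℝ} (ht : 0 < t) {m : ℝ} (hm0 : 0 ≤ m)
    (hm : ∫⁻ x, ‖φ₀ x‖ₑ ^ 2 ≤ ENNReal.ofReal m) : ∫⁻ x, ‖φ t x‖ₑ ^ 2 ≤ ENNReal.ofReal m := by
  obtain ⟨L, hL0, hL⟩ := exists_norm_fderiv_cutoff_le
  obtain ⟨B, hB⟩ := hφ.exists_sobolevBound t
  have hc : Continuous (φ t) := (hφ.contDiff_slice ht).continuous
  have h0 : ∀ n, ∫ x, cutoff n x * ‖φ₀ x‖ ^ 2 ≤ m := fun n => by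
    -- If the integrand were not integrable, the integral would be zero by convention and the bound
    -- would still hold.
    by_cases hi : Integrable fun x => cutoff n x * ‖φ₀ x‖ ^ 2
    · rw [integral_eq_lintegral_of_nonneg_ae (ae_of_all _ fun x =>
        mul_nonneg (cutoff_nonneg n x) (sq_nonneg _)) hi.aestronglyMeasurable]
      refine ENNReal.toReal_le_of_le_ofReal hm0 (le_trans (lintegral_mono fun x => ?_) hm)
      rw [← ofReal_norm, ← ENNReal.ofReal_pow (norm_nonneg _)]
      exact ENNReal.ofReal_le_ofReal (mul_le_of_le_one_left (sq_nonneg _) (cutoff_le_one n x))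
    · rw [integral_undef hi]
      exact hm0
  have h1 : ∀ n : ℕ, ∫ x, cutoff n x * ‖φ t x‖ ^ 2 ≤ m + L / (n + 1) * (12 * B * t) := fun n => by
    have hlim := (tendsto_cutoff_mass hφ n).add_const (L / (n + 1) * (12 * B * t))
    refine (ge_of_tendsto hlim ?_).trans (add_le_add_left (h0 n) _)
    have hev : ∀ᶠ k : ℕ in atTop, 1 / ((k : ℝ) + 1) ≤ t :=
      (tendsto_one_div_add_atTop_nhds_zero_nat (𝕜 := ℝ)).eventually_le_const ht
    filter_upwards [hev] with k hk
    exact cutoff_mass_le hφ hB hL0 (fun n x => (hL n x).1) n (by positivity) hk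
  have h2 : ∀ n : ℕ, ∫⁻ x, ENNReal.ofReal (cutoff n x * ‖φ t x‖ ^ 2) ≤
      ENNReal.ofReal (m + L / (n + 1) * (12 * B * t)) := fun n => by
    have hi : Integrable fun x => cutoff n x * ‖φ t x‖ ^ 2 :=
      ((contDiff_cutoff n).continuous.mul (hc.norm.pow 2)).integrable_of_hasCompactSupport
        (hasCompactSupport_cutoff n).mul_right
    rw [← ofReal_integral_eq_lintegral_ofReal hi
      (ae_of_all _ fun x => mul_nonneg (cutoff_nonneg n x) (sq_nonneg _))]
    exact ENNReal.ofReal_le_ofReal (h1 n)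
  have hlim : Tendsto (fun n : ℕ => ENNReal.ofReal (m + L / (n + 1) * (12 * B * t))) atTop
      (𝓝 (ENNReal.ofReal m)) := by
    refine ENNReal.tendsto_ofReal ?_
    have := ((tendsto_one_div_add_atTop_nhds_zero_nat (𝕜 := ℝ)).const_mul
      (L * (12 * B * t))).const_add m
    simp only [mul_zero, add_zero] at this
    refine this.congr fun n => ?_
    ring
  calc ∫⁻ x, ‖φ t x‖ₑ ^ 2
      = ∫⁻ x, liminf (fun n => ENNReal.ofReal (cutoff n x * ‖φ t x‖ ^ 2)) atTop := by
        refine lintegral_congr fun x => ?_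
        have := ENNReal.tendsto_ofReal ((tendsto_cutoff x).mul_const (‖φ t x‖ ^ 2))
        rw [this.liminf_eq, one_mul, ENNReal.ofReal_pow (norm_nonneg _), ofReal_norm]
    _ ≤ liminf (fun n => ∫⁻ x, ENNReal.ofReal (cutoff n x * ‖φ t x‖ ^ 2)) atTop :=
        lintegral_liminf_le fun n => (((contDiff_cutoff n).continuous.mul
          (hc.norm.pow 2)).measurable.ennreal_ofReal)
    _ ≤ liminf (fun n : ℕ => ENNReal.ofReal (m + L / (n + 1) * (12 * B * t))) atTop :=
        liminf_le_liminf (Eventually.of_forall h2)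
    _ = _ := hlim.liminf_eq

end mass

/-! ### Propagation of the second moment -/

/-- The truncated weight `|x|² η(x / (n + 1))²`. -/
def momentWeight (n : ℕ) (x : E3) : ℝ := ∑ j, (x j * cutoff n x) ^ 2

lemma momentWeight_eq (n : ℕ) (x : E3) : momentWeight n x = ‖x‖ ^ 2 * cutoff n x ^ 2 := by
  rw [EuclideanSpace.real_norm_sq_eq, Finset.sum_mul]
  exact Finset.sum_congr rfl fun j _ => mul_pow _ _ _

lemma momentWeight_nonneg (n : ℕ) (x : E3) : 0 ≤ momentWeight n x :=
  Finset.sum_nonneg fun _ _ => sq_nonneg _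

lemma momentWeight_le (n : ℕ) (x : E3) : momentWeight n x ≤ ‖x‖ ^ 2 := by
  rw [momentWeight_eq]
  exact mul_le_of_le_one_right (sq_nonneg _) (pow_le_one₀ (cutoff_nonneg n x) (cutoff_le_one n x))

lemma contDiff_coord_mul_cutoff (n : ℕ) (j : Fin 3) :
    ContDiff ℝ 1 fun x : E3 => x j * cutoff n x := by
  have h1 : ContDiff ℝ 1 fun x : E3 => x j := by fun_prop
  exact h1.mul ((contDiff_cutoff n).of_le (by exact_mod_cast le_top))

lemma contDiff_momentWeight (n : ℕ) : ContDiff ℝ 1 (momentWeight n) :=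
  ContDiff.sum fun j _ => (contDiff_coord_mul_cutoff n j).pow 2

lemma hasCompactSupport_momentWeight (n : ℕ) : HasCompactSupport (momentWeight n) := by
  refine (hasCompactSupport_cutoff n).mono fun x hx hx0 => hx ?_
  simp [momentWeight, hx0]

lemma tendsto_momentWeight (x : E3) :
    Tendsto (fun n => momentWeight n x) atTop (𝓝 (‖x‖ ^ 2)) := by
  simp only [momentWeight_eq]
  simpa using ((tendsto_cutoff x).pow 2).const_mul (‖x‖ ^ 2)

/-- The weight is a sum of squares of the functions `xⱼ η`, whose gradients are bounded uniformly in
`n` because `‖x‖ ‖∇η‖ ≤ L`. Squaring the cut-off is what allows the gradient to be estimated by the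
root of the weight itself. -/
lemma exists_sq_fderiv_momentWeight_le : ∃ C : ℝ, 0 ≤ C ∧ ∀ (n : ℕ) (x : E3) (i : Fin 3),
    fderiv ℝ (momentWeight n) x (EuclideanSpace.single i 1) ^ 2 ≤ C * momentWeight n x := by
  obtain ⟨L, hL0, hL⟩ := exists_norm_fderiv_cutoff_le
  refine ⟨12 * (1 + L) ^ 2, by positivity, fun n x i => ?_⟩
  set e : E3 := EuclideanSpace.single i 1 with he
  have he1 : ‖e‖ = 1 := by simp [he]
  have hd : ∀ j : Fin 3, DifferentiableAt ℝ (fun x : E3 => x j * cutoff n x) x := fun j =>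
    (contDiff_coord_mul_cutoff n j).differentiable one_ne_zero x
  have hj : ∀ j : Fin 3, |fderiv ℝ (fun x : E3 => x j * cutoff n x) x e| ≤ 1 + L := fun j => by
    have h1 : HasFDerivAt (fun x : E3 => x j) (EuclideanSpace.proj j : E3 →L[ℝ] ℝ) x :=
      (EuclideanSpace.proj j : E3 →L[ℝ] ℝ).hasFDerivAt
    have h2 := ((contDiff_cutoff n).differentiable (by simp) x).hasFDerivAt
    have h3 : HasFDerivAt (fun x : E3 => x j * cutoff n x) _ x := h1.mul h2
    rw [h3.fderiv]
    change |x j * fderiv ℝ (cutoff n) x e + cutoff n x * e j| ≤ 1 + L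
    have hxj : |x j| ≤ ‖x‖ := PiLp.norm_apply_le x j
    have hej : |e j| ≤ 1 := he1 ▸ PiLp.norm_apply_le e j
    have hf : |fderiv ℝ (cutoff n) x e| ≤ L / (1 + ‖x‖) :=
      ((fderiv ℝ (cutoff n) x).le_opNorm e).trans (by rw [he1, mul_one]; exact (hL n x).2)
    have hA : |x j * fderiv ℝ (cutoff n) x e| ≤ L := by
      rw [abs_mul]
      calc |x j| * |fderiv ℝ (cutoff n) x e| ≤ ‖x‖ * (L / (1 + ‖x‖)) := by gcongr
        _ ≤ L := by
          rw [mul_div_assoc', div_le_iff₀ (by positivity)]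
          nlinarith [norm_nonneg x]
    have hB : |cutoff n x * e j| ≤ 1 := by
      rw [abs_mul, abs_of_nonneg (cutoff_nonneg n x)]
      exact mul_le_one₀ (cutoff_le_one n x) (abs_nonneg _) hej
    calc _ ≤ |x j * fderiv ℝ (cutoff n) x e| + |cutoff n x * e j| := abs_add_le _ _
      _ ≤ _ := by linarith
  have hf : fderiv ℝ (momentWeight n) x e =
      ∑ j, 2 * (x j * cutoff n x) * fderiv ℝ (fun x : E3 => x j * cutoff n x) x e := by
    have hp : ∀ j : Fin 3, HasFDerivAt (fun x : E3 => (x j * cutoff n x) ^ 2) _ x := fun j =>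
      (hd j).hasFDerivAt.pow 2
    have : HasFDerivAt (momentWeight n) _ x :=
      HasFDerivAt.fun_sum (u := Finset.univ) fun j _ => hp j
    rw [this.fderiv]
    simp
  calc fderiv ℝ (momentWeight n) x e ^ 2
      ≤ 3 * ∑ j, (2 * (x j * cutoff n x) * fderiv ℝ (fun x : E3 => x j * cutoff n x) x e) ^ 2 := by
        rw [hf]
        simpa using sq_sum_le_card_mul_sum_sq (s := Finset.univ)
          (f := fun j => 2 * (x j * cutoff n x) * fderiv ℝ (fun x : E3 => x j * cutoff n x) x e)
    _ ≤ 3 * ∑ j, 4 * (1 + L) ^ 2 * (x j * cutoff n x) ^ 2 := by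
        gcongr with j
        rw [mul_pow, mul_pow]
        have := sq_le_sq' (abs_le.1 (hj j)).1 (abs_le.1 (hj j)).2
        nlinarith [sq_nonneg (x j * cutoff n x)]
    _ = 12 * (1 + L) ^ 2 * momentWeight n x := by
        rw [momentWeight, ← Finset.mul_sum]
        ring

section moment

variable {v : E3 → ℝ} {φ₀ : E3 → ℂ} {φ : ℝ → E3 → ℂ} (hφ : IsGlobalSmoothSolution v φ₀ φ)
  {T : ℝ} {B : ℝ≥0} (hB : SobolevBound φ T B)

include hφ hB in
lemma integral_slab_grad_le (hT : 1 ≤ T) :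
    Integrable (fun z => ∑ j, ‖dx j (spacetime φ) z‖ ^ 2) (slab 1 T) ∧
    ∫ z, ∑ j, ‖dx j (spacetime φ) z‖ ^ 2 ∂(slab 1 T) ≤ 3 * B * T := by
  have hs := hφ.contDiffOn_spacetime
  have hc : ContinuousOn (fun z => ∑ j, ‖dx j (spacetime φ) z‖ ^ 2) posTime :=
    continuousOn_finsetSum _ fun j _ => (contDiffOn_dx hs j).continuousOn.norm.pow 2
  have hm := aestronglyMeasurable_prod_of_continuousOn (μ := (volume : Measure E3)) (b := T)
    one_pos hc
  have hle : ∀ t ∈ Ioc 1 T, ∫⁻ x, ‖∑ j, ‖dx j (spacetime φ) (t, x)‖ ^ 2‖ₑ ≤ 3 * B := fun t ht => by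
    have ht' : t ∈ Ioc 0 T := ⟨one_pos.trans ht.1, ht.2⟩
    calc _ ≤ ∫⁻ x, ∑ j, ‖dx j (spacetime φ) (t, x)‖ₑ ^ 2 := by
          refine lintegral_mono fun x => (enorm_sum_le _ _).trans (le_of_eq ?_)
          simp only [enorm_norm_sq]
      _ ≤ ∑ j : Fin 3, (B : ℝ≥0∞) := by
          rw [lintegral_finsetSum _ fun j _ => (continuous_slice
            (contDiffOn_dx hs j).continuousOn ht'.1).enorm.measurable.pow_const 2]
          exact Finset.sum_le_sum fun j _ => hB.one t ht' j
      _ = 3 * B := by simp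
  refine ⟨integrable_prod_of_lintegral_le hm (C := 3 * B) (by finiteness) hle, ?_⟩
  rw [slab, integral_eq_lintegral_of_nonneg_ae (ae_of_all _ fun z => by positivity) hm]
  refine ENNReal.toReal_le_of_le_ofReal (by positivity) ?_
  refine (lintegral_prod_le _).trans ?_
  calc _ ≤ ∫⁻ t in Ioc 1 T, (3 * B : ℝ≥0∞) := by
        refine setLIntegral_mono measurable_const fun t ht => le_trans (le_of_eq ?_) (hle t ht)
        refine lintegral_congr fun x => ?_
        rw [Real.enorm_of_nonneg (by positivity)]
    _ ≤ _ := by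
        rw [setLIntegral_const, Real.volume_Ioc]
        have : (3 * B : ℝ≥0∞) = ENNReal.ofReal (3 * B) := by
          rw [ENNReal.ofReal_mul (by norm_num)]
          simp
        rw [this, ← ENNReal.ofReal_mul (by positivity)]
        refine ENNReal.ofReal_le_ofReal ?_
        gcongr
        linarith

include hφ hB in
-- Gronwall's argument, with the integrating factor placed as time weight in the mass balance. The
-- flux is split by `2ab ≤ a² + b²` into a multiple of the truncated moment and the bounded kinetic
-- energy.
lemma truncated_moment_le {C : ℝ} (hC0 : 0 ≤ C) {n : ℕ} (hC : ∀ (x : E3) (i : Fin 3),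
    fderiv ℝ (momentWeight n) x (EuclideanSpace.single i 1) ^ 2 ≤ C * momentWeight n x)
    (hT : 1 ≤ T) : ∫ x, momentWeight n x * ‖φ T x‖ ^ 2 ≤
      Real.exp (3 * C * T) * ((∫ x, momentWeight n x * ‖φ 1 x‖ ^ 2) + 3 * B * T) := by
  -- Each of the three directions contributes `C` times the truncated moment, so the rate `3C`
  -- cancels them exactly.
  set w : ℝ → ℝ := fun t => Real.exp (-(3 * C * t)) with hw
  have hwd : ∀ t, HasDerivAt w (-(3 * C) * w t) t := fun t => by
    have := ((hasDerivAt_id t).const_mul (3 * C)).neg.exp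
    refine this.congr_deriv ?_
    simp [hw]
    ring
  have hwc : ContDiffOn ℝ 1 w (Ioi 0) := by
    refine ContDiff.contDiffOn ?_
    exact Real.contDiff_exp.comp (contDiff_const.mul contDiff_id).neg
  obtain ⟨hint, key⟩ := mass_weighted_balance hφ hwc one_pos hT (contDiff_momentWeight n)
    (hasCompactSupport_momentWeight n)
  obtain ⟨hgi, hgle⟩ := integral_slab_grad_le hφ hB hT
  have hae : ∀ᵐ z ∂(slab 1 T), 0 < z.1 := by
    have h1 : ∀ᵐ t ∂(volume.restrict (Ioc 1 T)), 0 < t :=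
      (ae_restrict_mem measurableSet_Ioc).mono fun t ht => one_pos.trans ht.1
    exact (Measure.quasiMeasurePreserving_fst (μ := volume.restrict (Ioc 1 T))
      (ν := (volume : Measure E3))).ae h1
  have hmono := integral_mono_ae hint hgi (hae.mono fun z hz => by
    have hw0 : 0 ≤ w z.1 := (Real.exp_pos _).le
    have hw1 : w z.1 ≤ 1 := Real.exp_le_one_iff.2 (by
      have : 0 ≤ 3 * C * z.1 := by positivity
      linarith)
    simp only
    rw [(hwd z.1).deriv, sub_eq_add_neg, ← Finset.sum_neg_distrib]
    have hj : ∀ j, -(fderiv ℝ (momentWeight n) z.2 (EuclideanSpace.single j 1)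
        * massFlux w φ j z) ≤ w z.1 * (C * momentWeight n z.2 * ‖spacetime φ z‖ ^ 2
          + ‖dx j (spacetime φ) z‖ ^ 2) := fun j => by
      set d := fderiv ℝ (momentWeight n) z.2 (EuclideanSpace.single j 1)
      have h1 := abs_massFlux_le w φ j z
      rw [abs_of_nonneg hw0] at h1
      calc -(d * massFlux w φ j z) ≤ |d * massFlux w φ j z| := neg_le_abs _
        _ ≤ |d| * (w z.1 * (2 * (‖spacetime φ z‖ * ‖dx j (spacetime φ) z‖))) := by
            rw [abs_mul]
            gcongr
        _ = w z.1 * (2 * (|d| * ‖spacetime φ z‖) * ‖dx j (spacetime φ) z‖) := by ring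
        _ ≤ w z.1 * ((|d| * ‖spacetime φ z‖) ^ 2 + ‖dx j (spacetime φ) z‖ ^ 2) := by
            gcongr
            exact two_mul_le_add_sq _ _
        _ ≤ _ := by
            rw [mul_pow, sq_abs]
            gcongr
            exact hC z.2 j
    calc _ ≤ momentWeight n z.2 * (-(3 * C) * w z.1 * ‖spacetime φ z‖ ^ 2)
          + ∑ j : Fin 3, w z.1 * (C * momentWeight n z.2 * ‖spacetime φ z‖ ^ 2
          + ‖dx j (spacetime φ) z‖ ^ 2) := by
            gcongr with j
            exact hj j
      _ = w z.1 * ∑ j, ‖dx j (spacetime φ) z‖ ^ 2 := by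
            rw [← Finset.mul_sum, Finset.sum_add_distrib]
            simp
            ring
      _ ≤ _ := mul_le_of_le_one_left (by positivity) hw1)
  rw [← key] at hmono
  have hw1 : w 1 ≤ 1 := Real.exp_le_one_iff.2 (by
      have : 0 ≤ 3 * C * 1 := by positivity
      linarith)
  have hI : 0 ≤ ∫ x, momentWeight n x * ‖φ 1 x‖ ^ 2 :=
    integral_nonneg fun x => mul_nonneg (momentWeight_nonneg n x) (sq_nonneg _)
  have h1 : w T * (∫ x, momentWeight n x * ‖φ T x‖ ^ 2) ≤
      (∫ x, momentWeight n x * ‖φ 1 x‖ ^ 2) + 3 * B * T := by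
    nlinarith
  have h2 : Real.exp (3 * C * T) * w T = 1 := by
    rw [hw, ← Real.exp_add]
    simp
  calc ∫ x, momentWeight n x * ‖φ T x‖ ^ 2
      = Real.exp (3 * C * T) * (w T * ∫ x, momentWeight n x * ‖φ T x‖ ^ 2) := by
        rw [← mul_assoc, h2, one_mul]
    _ ≤ _ := by gcongr

include hφ in
-- The Gronwall bound is independent of the truncation, so Fatou passes to the full moment.
lemma exists_moment_le (h1 : Integrable fun x => ‖x‖ ^ 2 * ‖φ 1 x‖ ^ 2) (T : ℝ) :
    ∃ Q : ℝ≥0, ∀ t ∈ Icc 1 T, ∫⁻ x, ‖x‖ₑ ^ 2 * ‖φ t x‖ₑ ^ 2 ≤ Q := by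
  obtain ⟨C, hC0, hC⟩ := exists_sq_fderiv_momentWeight_le
  obtain ⟨B, hB⟩ := hφ.exists_sobolevBound T
  set q := ∫ x, ‖x‖ ^ 2 * ‖φ 1 x‖ ^ 2 with hq
  have hq0 : 0 ≤ q := integral_nonneg fun x => by positivity
  refine ⟨(Real.exp (3 * C * T) * (q + 3 * B * T)).toNNReal, fun t ht => ?_⟩
  have ht0 : 0 < t := one_pos.trans_le ht.1
  have hB' : SobolevBound φ t B := ⟨fun s hs => hB.zero s ⟨hs.1, hs.2.trans ht.2⟩,
    fun s hs => hB.one s ⟨hs.1, hs.2.trans ht.2⟩, fun s hs => hB.two s ⟨hs.1, hs.2.trans ht.2⟩⟩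
  have hc : Continuous (φ t) := (hφ.contDiff_slice ht0).continuous
  have hc1 : Continuous (φ 1) := (hφ.contDiff_slice one_pos).continuous
  have hle : ∀ n, ∫⁻ x, ENNReal.ofReal (momentWeight n x * ‖φ t x‖ ^ 2) ≤
      ENNReal.ofReal (Real.exp (3 * C * T) * (q + 3 * B * T)) := fun n => by
    have hi : ∀ {u : E3 → ℂ}, Continuous u → Integrable fun x => momentWeight n x * ‖u x‖ ^ 2 :=
      fun hu => ((contDiff_momentWeight n).continuous.mul
        (hu.norm.pow 2)).integrable_of_hasCompactSupport
          (hasCompactSupport_momentWeight n).mul_right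
    rw [← ofReal_integral_eq_lintegral_ofReal (hi hc)
      (ae_of_all _ fun x => mul_nonneg (momentWeight_nonneg n x) (sq_nonneg _))]
    refine ENNReal.ofReal_le_ofReal ((truncated_moment_le hφ hB' hC0 (hC n) ht.1).trans ?_)
    have h2 : ∫ x, momentWeight n x * ‖φ 1 x‖ ^ 2 ≤ q :=
      integral_mono (hi hc1) h1 fun x => by
        simp only
        gcongr
        exact momentWeight_le n x
    have h3 := ht.2
    have h4 : 0 ≤ ∫ x, momentWeight n x * ‖φ 1 x‖ ^ 2 :=
      integral_nonneg fun x => mul_nonneg (momentWeight_nonneg n x) (sq_nonneg _)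
    gcongr
  calc ∫⁻ x, ‖x‖ₑ ^ 2 * ‖φ t x‖ₑ ^ 2
      = ∫⁻ x, liminf (fun n => ENNReal.ofReal (momentWeight n x * ‖φ t x‖ ^ 2)) atTop := by
        refine lintegral_congr fun x => ?_
        have := ENNReal.tendsto_ofReal ((tendsto_momentWeight x).mul_const (‖φ t x‖ ^ 2))
        rw [this.liminf_eq, ENNReal.ofReal_mul (sq_nonneg _), ENNReal.ofReal_pow (norm_nonneg _),
          ENNReal.ofReal_pow (norm_nonneg _), ofReal_norm, ofReal_norm]
    _ ≤ liminf (fun n => ∫⁻ x, ENNReal.ofReal (momentWeight n x * ‖φ t x‖ ^ 2)) atTop :=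
        lintegral_liminf_le fun n => (((contDiff_momentWeight n).continuous.mul
          (hc.norm.pow 2)).measurable.ennreal_ofReal)
    _ ≤ liminf (fun _ : ℕ => ENNReal.ofReal (Real.exp (3 * C * T) * (q + 3 * B * T))) atTop :=
        liminf_le_liminf (Eventually.of_forall hle)
    _ = _ := by rw [liminf_const]; rfl

end moment

/-! ### The transform of a solution -/

lemma lintegral_scale {t : ℝ} (ht : 0 < t) (g : E3 → ℝ≥0∞) :
    ∫⁻ y, ENNReal.ofReal (t ^ 3) * g (t • y) = ∫⁻ x, g x := by
  have hme : MeasurableEmbedding (fun y : E3 => t • y) :=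
    (Homeomorph.smulOfNeZero t ht.ne').measurableEmbedding
  rw [lintegral_const_mul' _ _ ENNReal.ofReal_ne_top, ← hme.lintegral_map,
    Measure.map_addHaar_smul volume ht.ne', lintegral_smul_measure, finrank_euclideanSpace,
    Fintype.card_fin, abs_of_nonneg (by positivity), smul_eq_mul, ← mul_assoc,
    ← ENNReal.ofReal_mul (by positivity), mul_inv_cancel₀ (by positivity), ENNReal.ofReal_one,
    one_mul]

lemma norm_sq_pseudoconformal (f : ℝ × E3 → ℂ) {t : ℝ} (ht : 0 < t) (y : E3) :
    ‖pseudoconformal f (t, y)‖ ^ 2 = t ^ 3 * ‖f (t, t • y)‖ ^ 2 := by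
  rw [pseudoconformal, norm_mul, mul_pow, norm_sq_modulation (mem_posTime ht y)]
  rfl

lemma enorm_sq_pseudoconformal (f : ℝ × E3 → ℂ) {t : ℝ} (ht : 0 < t) (y : E3) :
    ‖pseudoconformal f (t, y)‖ₑ ^ 2 = ENNReal.ofReal (t ^ 3) * ‖f (t, t • y)‖ₑ ^ 2 := by
  rw [← ofReal_norm, ← ENNReal.ofReal_pow (norm_nonneg _), norm_sq_pseudoconformal f ht,
    ENNReal.ofReal_mul (by positivity), ENNReal.ofReal_pow (norm_nonneg _), ofReal_norm]

/-- The squared modulus `t³` of the modulation is the Jacobian of `y ↦ t y`. -/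
lemma lintegral_sq_pseudoconformal (f : ℝ × E3 → ℂ) {t : ℝ} (ht : 0 < t) :
    ∫⁻ y, ‖pseudoconformal f (t, y)‖ₑ ^ 2 = ∫⁻ x, ‖f (t, x)‖ₑ ^ 2 := by
  simp only [enorm_sq_pseudoconformal f ht]
  exact lintegral_scale ht fun x => ‖f (t, x)‖ₑ ^ 2

lemma lintegral_four_pseudoconformal (f : ℝ × E3 → ℂ) {t : ℝ} (ht : 0 < t) :
    ∫⁻ y, ‖pseudoconformal f (t, y)‖ₑ ^ 4 =
      ENNReal.ofReal (t ^ 3) * ∫⁻ x, ‖f (t, x)‖ₑ ^ 4 := by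
  rw [← lintegral_const_mul' _ _ ENNReal.ofReal_ne_top,
    ← lintegral_scale ht fun x => ENNReal.ofReal (t ^ 3) * ‖f (t, x)‖ₑ ^ 4]
  refine lintegral_congr fun y => ?_
  calc ‖pseudoconformal f (t, y)‖ₑ ^ 4 = (‖pseudoconformal f (t, y)‖ₑ ^ 2) ^ 2 := by rw [← pow_mul]
    _ = _ := by
      rw [enorm_sq_pseudoconformal f ht]
      ring

lemma lintegral_six_pseudoconformal (f : ℝ × E3 → ℂ) {t : ℝ} (ht : 0 < t) :
    ∫⁻ y, ‖pseudoconformal f (t, y)‖ₑ ^ 6 =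
      ENNReal.ofReal (t ^ 3) ^ 2 * ∫⁻ x, ‖f (t, x)‖ₑ ^ 6 := by
  rw [← lintegral_const_mul' _ _ (by finiteness),
    ← lintegral_scale ht fun x => ENNReal.ofReal (t ^ 3) ^ 2 * ‖f (t, x)‖ₑ ^ 6]
  refine lintegral_congr fun y => ?_
  calc ‖pseudoconformal f (t, y)‖ₑ ^ 6 = (‖pseudoconformal f (t, y)‖ₑ ^ 2) ^ 3 := by rw [← pow_mul]
    _ = _ := by
      rw [enorm_sq_pseudoconformal f ht]
      ring

lemma scaledField_pseudoconformal (χ : ℝ → ℝ) (φ : ℝ → E3 → ℂ) {t : ℝ} (ht : 0 < t) (y : E3) :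
    scaledField χ (pseudoconformal (spacetime φ)) (t, y) =
      meanField (potential χ) (φ t) (t • y) := by
  have h := Measure.integral_comp_smul (volume : Measure E3)
    (fun x => potential χ (t • y - x) * ‖φ t x‖ ^ 2) t
  rw [finrank_euclideanSpace, Fintype.card_fin, abs_of_nonneg (by positivity), smul_eq_mul] at h
  rw [scaledField, meanField]
  simp only [norm_sq_pseudoconformal _ ht, smul_sub]
  have e : ∀ x, potential χ (t • y - t • x) * (t ^ 3 * ‖spacetime φ (t, t • x)‖ ^ 2) =
      t ^ 3 * (potential χ (t • y - t • x) * ‖φ t (t • x)‖ ^ 2) := fun x => by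
    simp only [spacetime]
    ring
  simp only [e]
  rw [integral_const_mul, h, ← mul_assoc, mul_inv_cancel₀ (by positivity), one_mul]

/-! ### Uniform bounds for the transformed solution. -/

section

variable {χ : ℝ → ℝ} (hχ : IsDecreasingCutoff χ) {φ₀ : E3 → ℂ} {φ : ℝ → E3 → ℂ}
  (hφ : IsGlobalSmoothSolution (potential χ) φ₀ φ)

include hφ in
lemma equation_pseudoconformal {z : ℝ × E3} (hz : z ∈ posTime) :
    Complex.I * dt (pseudoconformal (spacetime φ)) z
      + ((z.1 ^ 2 : ℝ) : ℂ)⁻¹ * lap (pseudoconformal (spacetime φ)) z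
      - (scaledField χ (pseudoconformal (spacetime φ)) z : ℂ)
        * pseudoconformal (spacetime φ) z = 0 := by
  have h1 := hφ.equation_spacetime (dilation_mem hz)
  have h2 : scaledField χ (pseudoconformal (spacetime φ)) z =
      meanField (potential χ) (φ (dilation z).1) (dilation z).2 :=
    scaledField_pseudoconformal χ φ hz.1 z.2
  rw [schrodinger_pseudoconformal hφ.contDiffOn_spacetime hz, h2, pseudoconformal]
  linear_combination modulation z * h1

include hφ in
lemma exists_four_le (T : ℝ) : ∃ X : ℝ≥0, ∀ t ∈ Ioc 0 T, ∫⁻ x, ‖φ t x‖ₑ ^ 4 ≤ X := by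
  obtain ⟨B, hB⟩ := hφ.exists_sobolevBound T
  obtain ⟨S, hS⟩ := exists_lintegral_pow_six_le
  refine ⟨(√((B : ℝ) * (S * (3 * B) ^ 3))).toNNReal, fun t ht => ?_⟩
  have hs := hφ.contDiff_slice ht.1
  refine lintegral_four_le hs.continuous ?_
  rw [ENNReal.ofReal_mul (by positivity), ENNReal.ofReal_mul (by positivity),
    ENNReal.ofReal_pow (by positivity), ENNReal.ofReal_mul (by norm_num)]
  simp only [ENNReal.ofReal_coe_nnreal]
  have h0 := hB.zero t ht
  gcongr
  refine (hS (φ t) (hs.of_le (by exact_mod_cast le_top))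
    (h0.trans_lt ENNReal.coe_lt_top).ne).trans ?_
  gcongr
  calc ∫⁻ x, ENNReal.ofReal (∑ j, ‖partialDeriv j (φ t) x‖ ^ 2)
      = ∫⁻ x, ∑ j, ‖dx j (spacetime φ) (t, x)‖ₑ ^ 2 := by
        refine lintegral_congr fun x => ?_
        rw [ENNReal.ofReal_sum_of_nonneg fun j _ => sq_nonneg _]
        refine Finset.sum_congr rfl fun j _ => ?_
        rw [hφ.partialDeriv_eq ht.1, ENNReal.ofReal_pow (norm_nonneg _), ofReal_norm]
    _ ≤ ∑ j : Fin 3, (B : ℝ≥0∞) := by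
        rw [lintegral_finsetSum _ fun j _ => (continuous_slice (contDiffOn_dx
          hφ.contDiffOn_spacetime j).continuousOn ht.1).enorm.measurable.pow_const 2]
        exact Finset.sum_le_sum fun j _ => hB.one t ht j
    _ = _ := by simp

include hχ in
lemma enorm_meanField_le {u : E3 → ℂ} {X : ℝ≥0} (hX : ∫⁻ x, ‖u x‖ₑ ^ 4 ≤ X) (x : E3) :
    ‖meanField (potential χ) u x‖ₑ ≤ (∫⁻ x : E3, ‖potential χ x‖ₑ ^ 2) + X := by
  have hv := hχ.measurable_potential
  refine (enorm_integral_le_lintegral_enorm _).trans ?_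
  simp only [enorm_mul]
  refine (lintegral_mul_le_sq_add_sq (by fun_prop)).trans ?_
  rw [lintegral_sub_left_eq_self (fun y => ‖potential χ y‖ₑ ^ 2)]
  gcongr
  refine le_trans (le_of_eq (lintegral_congr fun y => ?_)) hX
  rw [enorm_norm_sq, ← pow_mul]

include hχ hφ in
-- The Sobolev hypothesis says nothing about `∂ₜφ`; the equation supplies it, with a bounded mean
-- field.
lemma exists_norm_dt_le (T : ℝ) : ∃ c : ℝ, 0 ≤ c ∧ ∀ t ∈ Ioc 0 T, ∀ x,
    ‖dt (spacetime φ) (t, x)‖ ≤ ‖lap (spacetime φ) (t, x)‖ + c * ‖φ t x‖ := by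
  obtain ⟨X, hX⟩ := exists_four_le hφ T
  have hfin : (∫⁻ x : E3, ‖potential χ x‖ₑ ^ 2) + X ≠ ⊤ := by
    have := hχ.lintegral_potential_sq_lt_top.ne
    finiteness
  refine ⟨((∫⁻ x : E3, ‖potential χ x‖ₑ ^ 2) + X).toReal, ENNReal.toReal_nonneg,
    fun t ht x => ?_⟩
  have h1 := hφ.equation_spacetime (mem_posTime ht.1 x)
  have h2 : dt (spacetime φ) (t, x) = Complex.I * (lap (spacetime φ) (t, x)
      - (meanField (potential χ) (φ t) x : ℂ) * φ t x) := by
    simp only [spacetime] at h1 ⊢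
    linear_combination (-Complex.I) * h1 + (dt (spacetime φ) (t, x)) * Complex.I_mul_I
  have h3 : ‖meanField (potential χ) (φ t) x‖ ≤
      ((∫⁻ x : E3, ‖potential χ x‖ₑ ^ 2) + X).toReal := by
    have := ENNReal.toReal_mono hfin (enorm_meanField_le hχ (hX t ht) x)
    rwa [toReal_enorm] at this
  rw [h2, norm_mul, Complex.norm_I, one_mul]
  refine (norm_sub_le _ _).trans ?_
  rw [norm_mul, Complex.norm_real]
  gcongr

lemma norm_conjDx_sq_le (f : ℝ × E3 → ℂ) (j : Fin 3) (z : ℝ × E3) :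
    ‖conjDx j f z‖ ^ 2 ≤ 2 * (‖z.2‖ ^ 2 * ‖f z‖ ^ 2 + z.1 ^ 2 * ‖dx j f z‖ ^ 2) := by
  have h1 : ‖conjDx j f z‖ ≤ ‖z.2‖ * ‖f z‖ + |z.1| * ‖dx j f z‖ := by
    refine (norm_add_le _ _).trans (add_le_add ?_ ?_)
    · rw [norm_mul, norm_neg, norm_mul, Complex.norm_I, one_mul, Complex.norm_real]
      gcongr
      have : ‖z.2 j‖ ≤ ‖z.2‖ := PiLp.norm_apply_le z.2 j
      rw [norm_div]
      norm_num at this ⊢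
      linarith [abs_nonneg (z.2 j)]
    · rw [norm_mul, Complex.norm_real, Real.norm_eq_abs]
  calc ‖conjDx j f z‖ ^ 2 ≤ (‖z.2‖ * ‖f z‖ + |z.1| * ‖dx j f z‖) ^ 2 := by gcongr
    _ ≤ 2 * ((‖z.2‖ * ‖f z‖) ^ 2 + (|z.1| * ‖dx j f z‖) ^ 2) := add_sq_le
    _ = _ := by rw [mul_pow, mul_pow, sq_abs]

/-- At `x = t y` the coefficients of `conjDt` grow like `‖y‖²` on `f` and like `‖y‖` on its
gradient. Dividing by `1 + ‖y‖` leaves one factor `‖x‖` on `f`, matched to the second moment, and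
none on the gradient. -/
lemma norm_conjDt_le (f : ℝ × E3 → ℂ) {t : ℝ} (ht : 1 ≤ t) (y : E3) :
    (1 + ‖y‖)⁻¹ * ‖conjDt f (t, t • y)‖ ≤ 2 * ‖f (t, t • y)‖ + ‖t • y‖ * ‖f (t, t • y)‖
      + ‖dt f (t, t • y)‖ + ∑ j, ‖dx j f (t, t • y)‖ := by
  have ht0 : 0 < t := by linarith
  have hy0 := norm_nonneg y
  have hty : ‖t • y‖ = t * ‖y‖ := by rw [norm_smul, Real.norm_of_nonneg ht0.le]
  have h1 : ‖conjDt f (t, t • y)‖ ≤ (2 + ‖y‖ ^ 2) * ‖f (t, t • y)‖ + ‖dt f (t, t • y)‖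
      + ∑ j, ‖y‖ * ‖dx j f (t, t • y)‖ := by
    refine (norm_add_le _ _).trans (add_le_add ((norm_add_le _ _).trans
      (add_le_add ?_ le_rfl)) ((norm_sum_le _ _).trans (Finset.sum_le_sum fun j _ => ?_)))
    · rw [norm_mul]
      gcongr
      refine (norm_sub_le _ _).trans (add_le_add ?_ ?_)
      · rw [Complex.norm_real, Real.norm_of_nonneg (by positivity), div_le_iff₀ (by positivity)]
        linarith
      · rw [norm_mul, Complex.norm_I, one_mul, Complex.norm_real,
          Real.norm_of_nonneg (by positivity), hty, div_le_iff₀ (by positivity)]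
        nlinarith [sq_nonneg (t * ‖y‖)]
    · rw [norm_mul, Complex.norm_real]
      gcongr
      have e : (t • y) j / t = y j := by
        simp only [PiLp.smul_apply, smul_eq_mul]
        field_simp
      simp only [e]
      exact PiLp.norm_apply_le y j
  have hf := norm_nonneg (f (t, t • y))
  have hd := norm_nonneg (dt f (t, t • y))
  have hS : 0 ≤ ∑ j, ‖dx j f (t, t • y)‖ := by positivity
  rw [← Finset.mul_sum] at h1
  rw [inv_mul_le_iff₀ (by positivity), hty]
  refine h1.trans ?_
  have h2 : ‖y‖ ^ 2 ≤ (1 + ‖y‖) * (t * ‖y‖) := by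
    nlinarith [mul_nonneg hy0 hy0, mul_nonneg (mul_nonneg hy0 hy0) (by linarith : 0 ≤ t - 1),
      mul_nonneg ht0.le hy0]
  nlinarith [mul_le_mul_of_nonneg_right h2 hf, mul_nonneg hy0 hf, mul_nonneg hy0 hd,
    mul_nonneg hy0 hS]

include hχ hφ in
lemma exists_controlled (h1 : Integrable fun x => ‖x‖ ^ 2 * ‖φ 1 x‖ ^ 2) (T : ℝ) :
    ∃ B, Controlled (pseudoconformal (spacetime φ)) 1 T B := by
  obtain ⟨B, hB⟩ := hφ.exists_sobolevBound T
  obtain ⟨Q, hQ⟩ := exists_moment_le hφ h1 T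
  obtain ⟨X, hX⟩ := exists_four_le hφ T
  obtain ⟨c, hc0, hc⟩ := exists_norm_dt_le hχ hφ T
  have hs := hφ.contDiffOn_spacetime
  set B₁ : ℝ≥0∞ := 2 * (B + Q)
  set B₂ : ℝ≥0∞ := 2 * (Q + ENNReal.ofReal (T ^ 2) * B)
  -- Six is the number of summands squared below: two involving `φ`, the Laplacian, and three first
  -- derivatives.
  set B₃ : ℝ≥0∞ := 6 * (ENNReal.ofReal ((2 + c) ^ 2) * B + Q + B + 3 * B)
  set B₄ : ℝ≥0∞ := ENNReal.ofReal (T ^ 3) * X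
  have hfin : B₁ + B₂ + B₃ + B₄ ≠ ⊤ := by
    simp only [B₁, B₂, B₃, B₄]
    finiteness
  refine ⟨(B₁ + B₂ + B₃ + B₄).toNNReal, ?_⟩
  have hmem : ∀ {t : ℝ}, t ∈ Icc 1 T → 0 < t ∧ t ∈ Ioc 0 T := fun ht =>
    ⟨one_pos.trans_le ht.1, one_pos.trans_le ht.1, ht.2⟩
  have hm0 : ∀ {t : ℝ}, 0 < t → Measurable fun x => ‖φ t x‖ₑ ^ 2 := fun ht =>
    (hφ.contDiff_slice ht).continuous.enorm.measurable.pow_const 2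
  have hmx : ∀ {t : ℝ}, 0 < t → Measurable fun x => ‖x‖ₑ ^ 2 * ‖φ t x‖ₑ ^ 2 := fun ht =>
    (continuous_enorm.measurable.pow_const 2).mul (hm0 ht)
  have hmj : ∀ {t : ℝ}, 0 < t → ∀ j, Measurable fun x => ‖dx j (spacetime φ) (t, x)‖ₑ ^ 2 :=
    fun ht j => (continuous_slice (contDiffOn_dx hs j).continuousOn ht).enorm.measurable.pow_const 2
  have hml : ∀ {t : ℝ}, 0 < t → Measurable fun x => ‖lap (spacetime φ) (t, x)‖ₑ ^ 2 := fun ht =>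
    (continuous_slice (continuousOn_finsetSum _ fun j _ =>
      (contDiffOn_dx (contDiffOn_dx hs j) j).continuousOn) ht).enorm.measurable.pow_const 2
  constructor <;> intro t ht <;> rw [ENNReal.coe_toNNReal hfin] <;>
    obtain ⟨ht0, ht'⟩ := hmem ht
  · calc ∫⁻ y, ‖(1 + ‖y‖) • pseudoconformal (spacetime φ) (t, y)‖ₑ ^ 2
        ≤ ∫⁻ y, ENNReal.ofReal (t ^ 3) * (2 * (‖φ t (t • y)‖ₑ ^ 2
          + ‖t • y‖ₑ ^ 2 * ‖φ t (t • y)‖ₑ ^ 2)) := by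
          refine lintegral_mono fun y => ?_
          rw [enorm_smul, mul_pow, enorm_sq_pseudoconformal _ ht0, mul_left_comm]
          refine mul_le_mul_right ?_ _
          have : ‖1 + ‖y‖‖ₑ ^ 2 ≤ 2 * (1 + ‖t • y‖ₑ ^ 2) := by
            have hr : (1 + ‖y‖) ^ 2 ≤ 2 * (1 + ‖t • y‖ ^ 2) := by
              have hle : ‖y‖ ≤ ‖t • y‖ := by
                rw [norm_smul, Real.norm_of_nonneg ht0.le]
                exact le_mul_of_one_le_left (norm_nonneg _) ht.1
              nlinarith [sq_nonneg (1 - ‖y‖), norm_nonneg y]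
            have := ENNReal.ofReal_le_ofReal hr
            rw [ENNReal.ofReal_mul (by norm_num), ENNReal.ofReal_add (by norm_num) (by positivity),
              ENNReal.ofReal_pow (by positivity), ENNReal.ofReal_pow (norm_nonneg _),
              ofReal_norm] at this
            rw [Real.enorm_of_nonneg (by positivity)]
            simpa using this
          calc _ ≤ 2 * (1 + ‖t • y‖ₑ ^ 2) * ‖spacetime φ (t, t • y)‖ₑ ^ 2 := by gcongr
            _ = _ := by
              simp only [spacetime]
              ring
      _ = ∫⁻ x, 2 * (‖φ t x‖ₑ ^ 2 + ‖x‖ₑ ^ 2 * ‖φ t x‖ₑ ^ 2) :=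
          lintegral_scale ht0 fun x => 2 * (‖φ t x‖ₑ ^ 2 + ‖x‖ₑ ^ 2 * ‖φ t x‖ₑ ^ 2)
      _ ≤ B₁ := by
          rw [lintegral_const_mul' _ _ (by finiteness), lintegral_add_left (hm0 ht0)]
          simp only [B₁]
          gcongr
          · exact hB.zero t ht'
          · exact hQ t ht
      _ ≤ _ := by
          rw [add_assoc, add_assoc]
          exact le_self_add
  · intro j
    have e : ∀ y, dx j (pseudoconformal (spacetime φ)) (t, y) =
        pseudoconformal (conjDx j (spacetime φ)) (t, y) := fun y =>
      dx_pseudoconformal hs (mem_posTime ht0 y) j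
    simp only [e]
    rw [lintegral_sq_pseudoconformal _ ht0]
    calc ∫⁻ x, ‖conjDx j (spacetime φ) (t, x)‖ₑ ^ 2
        ≤ ∫⁻ x, 2 * (‖x‖ₑ ^ 2 * ‖φ t x‖ₑ ^ 2
          + ENNReal.ofReal (T ^ 2) * ‖dx j (spacetime φ) (t, x)‖ₑ ^ 2) := by
          refine lintegral_mono fun x => ?_
          have h := ENNReal.ofReal_le_ofReal (norm_conjDx_sq_le (spacetime φ) j (t, x))
          rw [ENNReal.ofReal_mul (by norm_num), ENNReal.ofReal_add (by positivity) (by positivity),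
            ENNReal.ofReal_mul (by positivity), ENNReal.ofReal_mul (by positivity)] at h
          simp only [ENNReal.ofReal_pow (norm_nonneg _), ofReal_norm] at h
          refine h.trans ?_
          have h2 := ht.2
          have h3 := ht0.le
          rw [ENNReal.ofReal_ofNat]
          gcongr
          rfl
      _ ≤ B₂ := by
          rw [lintegral_const_mul' _ _ (by finiteness), lintegral_add_left (hmx ht0),
            lintegral_const_mul' _ _ (by finiteness)]
          simp only [B₂]
          gcongr
          · exact hQ t ht
          · exact hB.one t ht' j
      _ ≤ _ := by
          rw [add_assoc, add_assoc]
          exact le_add_left le_self_add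
  · have e : ∀ y, dt (pseudoconformal (spacetime φ)) (t, y) =
        pseudoconformal (conjDt (spacetime φ)) (t, y) := fun y =>
      dt_pseudoconformal hs (mem_posTime ht0 y)
    set g : E3 → ℝ≥0∞ := fun x => 6 * (ENNReal.ofReal ((2 + c) ^ 2) * ‖φ t x‖ₑ ^ 2
      + ‖x‖ₑ ^ 2 * ‖φ t x‖ₑ ^ 2 + ‖lap (spacetime φ) (t, x)‖ₑ ^ 2
      + ∑ j, ‖dx j (spacetime φ) (t, x)‖ₑ ^ 2) with hg
    calc ∫⁻ y, ‖(1 + ‖y‖)⁻¹ • dt (pseudoconformal (spacetime φ)) (t, y)‖ₑ ^ 2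
        ≤ ∫⁻ y, ENNReal.ofReal (t ^ 3) * g (t • y) := by
          refine lintegral_mono fun y => ?_
          rw [e, enorm_smul, mul_pow, enorm_sq_pseudoconformal _ ht0, mul_left_comm]
          refine mul_le_mul_right ?_ _
          set x := t • y with hx
          have hr : ((1 + ‖y‖)⁻¹ * ‖conjDt (spacetime φ) (t, x)‖) ^ 2 ≤
              6 * ((2 + c) ^ 2 * ‖φ t x‖ ^ 2 + ‖x‖ ^ 2 * ‖φ t x‖ ^ 2
                + ‖lap (spacetime φ) (t, x)‖ ^ 2 + ∑ j, ‖dx j (spacetime φ) (t, x)‖ ^ 2) := by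
            have h2 := norm_conjDt_le (spacetime φ) ht.1 y
            have h3 := hc t ht' x
            have h4 : (1 + ‖y‖)⁻¹ * ‖conjDt (spacetime φ) (t, x)‖ ≤ (2 + c) * ‖φ t x‖
                + ‖x‖ * ‖φ t x‖ + ‖lap (spacetime φ) (t, x)‖
                + ∑ j, ‖dx j (spacetime φ) (t, x)‖ := by
              simp only [← hx, spacetime] at h2 h3 ⊢
              linarith
            refine (pow_le_pow_left₀ (by positivity) h4 2).trans ?_
            simp only [Fin.sum_univ_three]
            set a₁ := (2 + c) * ‖φ t x‖ with ha₁
            set a₂ := ‖x‖ * ‖φ t x‖ with ha₂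
            have e1 : (2 + c) ^ 2 * ‖φ t x‖ ^ 2 = a₁ ^ 2 := by rw [ha₁, mul_pow]
            have e2 : ‖x‖ ^ 2 * ‖φ t x‖ ^ 2 = a₂ ^ 2 := by rw [ha₂, mul_pow]
            rw [e1, e2]
            set a₃ := ‖lap (spacetime φ) (t, x)‖
            set d := fun j => ‖dx j (spacetime φ) (t, x)‖
            have := sq_sum_le_card_mul_sum_sq (s := (Finset.univ : Finset (Fin 6)))
              (f := ![a₁, a₂, a₃, d 0, d 1, d 2])
            simp [Fin.sum_univ_succ] at this
            simp only [d] at this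
            nlinarith
          have h5 := ENNReal.ofReal_le_ofReal hr
          rw [ENNReal.ofReal_mul (by norm_num), ENNReal.ofReal_add (by positivity) (by positivity),
            ENNReal.ofReal_add (by positivity) (by positivity),
            ENNReal.ofReal_add (by positivity) (by positivity),
            ENNReal.ofReal_mul (by positivity), ENNReal.ofReal_mul (by positivity),
            ENNReal.ofReal_sum_of_nonneg fun j _ => sq_nonneg _,
            ENNReal.ofReal_pow (by positivity), ENNReal.ofReal_mul (by positivity)] at h5
          simp only [ENNReal.ofReal_pow (norm_nonneg _), ofReal_norm] at h5
          rw [mul_pow] at h5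
          rw [Real.enorm_of_nonneg (by positivity)]
          simpa [hg] using h5
      _ = ∫⁻ x, g x := lintegral_scale ht0 g
      _ ≤ B₃ := by
          have hmS : Measurable fun x => ∑ j, ‖dx j (spacetime φ) (t, x)‖ₑ ^ 2 :=
            Finset.measurable_fun_sum _ fun j _ => hmj ht0 j
          simp only [hg]
          rw [lintegral_const_mul' _ _ (by finiteness), lintegral_add_right _ hmS,
            lintegral_add_right _ (hml ht0), lintegral_add_right _ (hmx ht0),
            lintegral_const_mul' _ _ (by finiteness), lintegral_finsetSum _ fun j _ => hmj ht0 j]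
          simp only [B₃]
          gcongr
          · exact hB.zero t ht'
          · exact hQ t ht
          · exact hB.two t ht'
          · exact (Finset.sum_le_sum fun j _ => hB.one t ht' j).trans (le_of_eq (by simp))
      _ ≤ _ := by
          rw [add_assoc]
          exact le_add_left le_self_add
  · rw [lintegral_four_pseudoconformal _ ht0]
    calc _ ≤ B₄ := by
          have h2 := ht.2
          simp only [B₄]
          gcongr
          exact hX t ht'
      _ ≤ _ := le_add_self

end

/-! ### The pseudoconformal energy at time one -/

/-- Completing the square. With `a = φ` and `d = ∂ⱼφ` it recognises mass, momentum and kinetic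
densities as the square of the conjugated derivative. -/
lemma norm_sq_galilean (a d : ℂ) (r : ℝ) :
    ‖-(Complex.I * ((r / 2 : ℝ) : ℂ)) * a + d‖ ^ 2 = r ^ 2 / 4 * ‖a‖ ^ 2
      + r * (1 / (2 * Complex.I) * (a * conj d - conj a * d)).re + ‖d‖ ^ 2 := by
  have e : 1 / (2 * Complex.I) = ((-(1 / 2) : ℝ) : ℂ) * Complex.I := by
    rw [one_div, mul_inv, Complex.inv_I]
    push_cast
    ring
  rw [e]
  simp only [Complex.sq_norm, Complex.normSq_apply, Complex.add_re, Complex.add_im,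
    Complex.sub_re, Complex.sub_im, Complex.mul_re, Complex.mul_im, Complex.neg_re,
    Complex.neg_im, Complex.I_re, Complex.I_im, Complex.ofReal_re, Complex.ofReal_im,
    Complex.conj_re, Complex.conj_im]
  ring

section

variable {χ : ℝ → ℝ} (hχ : IsDecreasingCutoff χ) {φ₀ : E3 → ℂ} {φ : ℝ → E3 → ℂ}
  (hφ : IsGlobalSmoothSolution (potential χ) φ₀ φ)

include hφ

lemma pseudoconformalDensity_one (x : E3) :
    pseudoconformalDensity (potential χ) φ 1 x = ∑ j, ‖conjDx j (spacetime φ) (1, x)‖ ^ 2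
      + meanField (potential χ) (φ 1) x * (1 / 2 * ‖φ 1 x‖ ^ 2) := by
  have h : ∀ j, ‖conjDx j (spacetime φ) (1, x)‖ ^ 2 = x j ^ 2 / 4 * ‖φ 1 x‖ ^ 2
      + x j * momentumDensity j (φ 1) x + ‖partialDeriv j (φ 1) x‖ ^ 2 := fun j => by
    rw [momentumDensity, hφ.partialDeriv_eq one_pos, ← norm_sq_galilean, conjDx,
      Complex.ofReal_one, one_mul]
    rfl
  simp only [h, pseudoconformalDensity, energyDensity, stressTrace, massDensity,
    EuclideanSpace.real_norm_sq_eq, Fin.sum_univ_three]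
  ring

lemma continuous_conjDx_one (j : Fin 3) : Continuous fun x => conjDx j (spacetime φ) (1, x) := by
  have h1 := (hφ.contDiff_slice one_pos).continuous
  have h2 := continuous_slice (contDiffOn_dx hφ.contDiffOn_spacetime j).continuousOn one_pos
  simp only [conjDx, spacetime] at h2 ⊢
  fun_prop

lemma norm_dx_pseudoconformal_one (j : Fin 3) (y : E3) :
    ‖dx j (pseudoconformal (spacetime φ)) (1, y)‖ ^ 2 = ‖conjDx j (spacetime φ) (1, y)‖ ^ 2 := by
  rw [dx_pseudoconformal hφ.contDiffOn_spacetime (mem_posTime one_pos y),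
    norm_sq_pseudoconformal _ one_pos, one_smul, one_pow, one_mul]

include hχ in
-- The energy density is the sum of the squares `|∂ⱼφ - i xⱼ φ/2|²` and a non-negative interaction,
-- so finite energy puts each `∂ⱼφ - i xⱼ φ/2` in L². Subtracting `∂ⱼφ`, which is in L² by the
-- Sobolev bound, leaves `xⱼ φ`.
lemma integrable_moment
    (hi : Integrable (pseudoconformalDensity (potential χ) φ 1)) :
    Integrable fun x => ‖x‖ ^ 2 * ‖φ 1 x‖ ^ 2 := by
  have hc := (hφ.contDiff_slice one_pos).continuous
  obtain ⟨B, hB⟩ := hφ.exists_sobolevBound 1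
  have hd : ∀ j, Integrable fun x => ‖dx j (spacetime φ) (1, x)‖ ^ 2 := fun j => by
    refine ⟨((continuous_slice (contDiffOn_dx hφ.contDiffOn_spacetime j).continuousOn
      one_pos).norm.pow 2).aestronglyMeasurable, ?_⟩
    simp only [HasFiniteIntegral, enorm_norm_sq]
    exact (hB.one 1 ⟨one_pos, le_rfl⟩ j).trans_lt ENNReal.coe_lt_top
  have hg : Integrable fun x => ∑ j, ‖conjDx j (spacetime φ) (1, x)‖ ^ 2 := by
    refine hi.mono' (continuous_finsetSum _ fun j _ =>
      (continuous_conjDx_one hφ j).norm.pow 2).aestronglyMeasurable (ae_of_all _ fun x => ?_)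
    rw [Real.norm_of_nonneg (by positivity), pseudoconformalDensity_one hφ]
    have hW : 0 ≤ meanField (potential χ) (φ 1) x :=
      integral_nonneg fun y => mul_nonneg (hχ.potential_nonneg _) (sq_nonneg _)
    exact le_add_of_nonneg_right (by positivity)
  -- Eight is the four from `|xⱼ φ/2|²` times the two from `(a + b)² ≤ 2a² + 2b²`.
  refine ((hg.add (integrable_finsetSum Finset.univ fun j _ => hd j)).const_mul 8).mono'
    ((continuous_norm.pow 2).mul (hc.norm.pow 2)).aestronglyMeasurable (ae_of_all _ fun x => ?_)
  rw [Real.norm_of_nonneg (by positivity), Pi.add_apply, ← Finset.sum_add_distrib,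
    EuclideanSpace.real_norm_sq_eq, Finset.sum_mul, Finset.mul_sum]
  refine Finset.sum_le_sum fun j _ => ?_
  have e : -(Complex.I * ((x j / 2 : ℝ) : ℂ)) * φ 1 x =
      conjDx j (spacetime φ) (1, x) - dx j (spacetime φ) (1, x) := by
    simp [conjDx, spacetime]
  have h1 : ‖-(Complex.I * ((x j / 2 : ℝ) : ℂ)) * φ 1 x‖ ^ 2 = x j ^ 2 * ‖φ 1 x‖ ^ 2 / 4 := by
    rw [norm_mul, norm_neg, norm_mul, Complex.norm_I, one_mul, Complex.norm_real, mul_pow,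
      Real.norm_eq_abs, sq_abs]
    ring
  have h2 := norm_sub_le (conjDx j (spacetime φ) (1, x)) (dx j (spacetime φ) (1, x))
  rw [← e] at h2
  have h3 := pow_le_pow_left₀ (norm_nonneg _) h2 2
  rw [h1] at h3
  nlinarith [add_sq_le (a := ‖conjDx j (spacetime φ) (1, x)‖)
    (b := ‖dx j (spacetime φ) (1, x)‖)]

include hχ in
-- At time one the transform is only a phase, and Fubini identifies half the double integral with
-- that of the mean field against the mass density.
lemma energy_eq (hi : Integrable (pseudoconformalDensity (potential χ) φ 1)) :
    kinetic (pseudoconformal (spacetime φ)) 1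
      + interaction (potential χ) (pseudoconformal (spacetime φ)) 1 =
        pseudoconformalEnergy (potential χ) φ 1 := by
  obtain ⟨B, hB⟩ := exists_controlled hχ hφ (integrable_moment hχ hφ hi) 1
  have hs := contDiffOn_pseudoconformal hφ.contDiffOn_spacetime
  have hd := integrable_density_density (k := potential χ) (C := 1) hχ hs le_rfl hB
    ⟨le_rfl, le_rfl⟩ (fun x => by
      rw [abs_of_nonneg (hχ.potential_nonneg x)]
      linarith) hχ.measurable_potential
  have hk := hB.integrable_grad hs le_rfl ⟨le_rfl, le_rfl⟩
  simp only [norm_sq_pseudoconformal _ one_pos, one_smul, one_pow, one_mul, spacetime] at hd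
  simp only [norm_dx_pseudoconformal_one hφ] at hk
  have hd' := hd.const_mul (1 / 2)
  have e : ∀ x, ∫ y, 1 / 2 * (potential χ (x - y) * (‖φ 1 x‖ ^ 2 * ‖φ 1 y‖ ^ 2)) =
      meanField (potential χ) (φ 1) x * (1 / 2 * ‖φ 1 x‖ ^ 2) := fun x => by
    rw [meanField, ← integral_mul_const]
    refine integral_congr_ae (ae_of_all _ fun y => ?_)
    ring
  have hp := hd'.integral_prod_left
  simp only [e] at hp
  rw [pseudoconformalEnergy, kinetic, interaction]
  simp only [pseudoconformalDensity_one hφ, norm_dx_pseudoconformal_one hφ,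
    norm_sq_pseudoconformal _ one_pos, one_smul, one_pow, one_mul, spacetime]
  rw [integral_add hk hp]
  congr 1
  refine (integral_prod _ hd').trans ?_
  simp only [e]

include hχ in
lemma isTransformed_pseudoconformal {M E : ℝ} (hM : eLpNorm φ₀ 2 volume ≤ ENNReal.ofReal M)
    (hi : Integrable (pseudoconformalDensity (potential χ) φ 1))
    (hE : pseudoconformalEnergy (potential χ) φ 1 ≤ E) :
    IsTransformed χ (max M 0 ^ 2) E (pseudoconformal (spacetime φ)) where
  smooth := contDiffOn_pseudoconformal hφ.contDiffOn_spacetime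
  equation _ hz := equation_pseudoconformal hφ hz
  controlled T := exists_controlled hχ hφ (integrable_moment hχ hφ hi) T
  mass t ht := by
    have ht0 : 0 < t := by linarith
    rw [lintegral_sq_pseudoconformal _ ht0]
    refine lintegral_norm_sq_le hφ ht0 (sq_nonneg _) ?_
    rw [lintegral_enorm_pow _ two_ne_zero, ENNReal.ofReal_pow (le_max_right _ _)]
    gcongr
    exact hM.trans (ENNReal.ofReal_le_ofReal (le_max_left _ _))
  energy := (energy_eq hχ hφ hi).trans_le hE

end

/-! ### Decay of the solution -/

/-- The constant in the bound for `∫ |φ|⁶`. -/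
def sixthPowerConst (χ : ℝ → ℝ) (S : ℝ≥0) (M E : ℝ) : ℝ :=
  S * (max E 0 + 2 * ((∫ x, potential χ x) * √(max M 0 ^ 2 * (S * max E 0 ^ 3)))) ^ 3

section

variable {χ : ℝ → ℝ} (hχ : IsDecreasingCutoff χ) {S : ℝ≥0} {M E : ℝ}

include hχ in
lemma sixthPowerConst_nonneg : 0 ≤ sixthPowerConst χ S M E := by
  have h1 : 0 ≤ ∫ x, potential χ x := integral_nonneg hχ.potential_nonneg
  have h2 : 0 ≤ max E 0 := le_max_right _ _
  rw [sixthPowerConst]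
  positivity

variable {φ₀ : E3 → ℂ} {φ : ℝ → E3 → ℂ}
  (hφ : IsGlobalSmoothSolution (potential χ) φ₀ φ)
  (hS : ∀ u : E3 → ℂ, ContDiff ℝ 1 u → ∫⁻ x, ‖u x‖ₑ ^ 2 ≠ ⊤ → ∫⁻ x, ‖u x‖ₑ ^ 6 ≤
      S * (∫⁻ x, ENNReal.ofReal (∑ j, ‖partialDeriv j u x‖ ^ 2)) ^ 3)
  (hM : eLpNorm φ₀ 2 volume ≤ ENNReal.ofReal M)
  (hi : Integrable (pseudoconformalDensity (potential χ) φ 1))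
  (hE : pseudoconformalEnergy (potential χ) φ 1 ≤ E) {t : ℝ} (ht : 1 ≤ t)

include hχ hφ hS hM hi hE ht

/-- Sobolev and the bound on `K` give growth `t^{3/2}` for the transform; the scaling factor `t⁶`
turns this into `t^{-9/2}`. -/
lemma lintegral_six_le : ∫⁻ x, ‖φ t x‖ₑ ^ 6 ≤
    ENNReal.ofReal (sixthPowerConst χ S M E * t ^ (-(9 / 2) : ℝ)) := by
  have h := isTransformed_pseudoconformal hχ hφ hM hi hE
  have ht0 : 0 < t := by linarith
  have h6 := h.lintegral_six_le hS ht
  have hk := h.kinetic_le_sqrt hχ hS ht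
  rw [lintegral_six_pseudoconformal _ ht0] at h6
  -- The energy of a solution is non-negative, so the truncation in the constant changes nothing
  -- here.
  have hE0 : max E 0 = E := max_eq_left (h.energy_nonneg hχ)
  have hexp : (t ^ (1 / 2 : ℝ)) ^ 3 = (t ^ 3) ^ 2 * t ^ (-(9 / 2) : ℝ) := by
    rw [← Real.rpow_natCast, ← Real.rpow_natCast, ← Real.rpow_natCast, ← Real.rpow_mul ht0.le,
      ← Real.rpow_mul ht0.le, ← Real.rpow_add ht0]
    norm_num
  have h0 : ENNReal.ofReal (t ^ 3) ^ 2 ≠ 0 := by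
    simp only [ne_eq, OfNat.ofNat_ne_zero, not_false_eq_true, pow_eq_zero_iff,
      ENNReal.ofReal_eq_zero, not_le]
    positivity
  refine (ENNReal.mul_le_mul_iff_right h0 (by finiteness)).1 (h6.trans ?_)
  rw [← ENNReal.ofReal_pow (kinetic_nonneg _ _), ← ENNReal.ofReal_pow (by positivity),
    ← ENNReal.ofReal_coe_nnreal, ← ENNReal.ofReal_mul (by positivity),
    ← ENNReal.ofReal_mul (by positivity)]
  refine ENNReal.ofReal_le_ofReal ?_
  calc _ ≤ S * ((E + 2 * ((∫ x, potential χ x) * √(max M 0 ^ 2 * (S * E ^ 3))))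
        * t ^ (1 / 2 : ℝ)) ^ 3 := by
        have := kinetic_nonneg (pseudoconformal (spacetime φ)) t
        gcongr
    _ = _ := by
        rw [mul_pow, hexp, sixthPowerConst, hE0]
        ring

lemma eLpNorm_six_le : eLpNorm (φ t) 6 volume ≤
    ENNReal.ofReal (sixthPowerConst χ S M E ^ (1 / 6 : ℝ) * t ^ (-(3 / 4) : ℝ)) := by
  have ht0 : 0 < t := by linarith
  have hD := sixthPowerConst_nonneg hχ (S := S) (M := M) (E := E)
  have h := lintegral_six_le hχ hφ hS hM hi hE ht
  rw [lintegral_enorm_pow _ (by norm_num)] at h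
  refine (ENNReal.pow_le_pow_left_iff (n := 6) (by norm_num)).1 (h.trans_eq ?_)
  rw [← ENNReal.ofReal_pow (by positivity), mul_pow, ← Real.rpow_natCast, ← Real.rpow_natCast,
    ← Real.rpow_mul hD, ← Real.rpow_mul ht0.le]
  norm_num

/-- Interpolation bounds the eighth power of the L⁴ norm by the mass times the integral of `|φ|⁶`;
an eighth of the exponent `9/2` is `9/16`. -/
lemma eLpNorm_four_le : eLpNorm (φ t) 4 volume ≤
    ENNReal.ofReal ((max M 0 ^ 2 * sixthPowerConst χ S M E) ^ (1 / 8 : ℝ)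
      * t ^ (-(9 / 16) : ℝ)) := by
  have ht0 : 0 < t := by linarith
  have hD := sixthPowerConst_nonneg hχ (S := S) (M := M) (E := E)
  have h6 := lintegral_six_le hχ hφ hS hM hi hE ht
  have h2 := (isTransformed_pseudoconformal hχ hφ hM hi hE).mass t ht
  rw [lintegral_sq_pseudoconformal _ ht0] at h2
  have h := (lintegral_pow_four_le (hφ.contDiff_slice ht0).continuous).trans (mul_le_mul' h2 h6)
  rw [lintegral_enorm_pow _ (by norm_num), ← pow_mul, ← ENNReal.ofReal_mul (by positivity)] at h
  refine (ENNReal.pow_le_pow_left_iff (n := 4 * 2) (by norm_num)).1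
    (h.trans_eq ?_)
  rw [← ENNReal.ofReal_pow (by positivity), mul_pow, ← Real.rpow_mul_natCast (by positivity),
    ← Real.rpow_mul_natCast ht0.le]
  norm_num [mul_assoc]

end

lemma lintegral_Ioi_sq_le {f : ℝ → ℝ≥0∞} {A a : ℝ} (ha : 1 < 2 * a)
    (hf : ∀ t, 1 ≤ t → f t ≤ ENNReal.ofReal (A * t ^ (-a))) :
    ∫⁻ t in Ioi (1 : ℝ), f t ^ 2 ≤ ENNReal.ofReal (A ^ 2 * (2 * a - 1)⁻¹) := by
  have ha' : -(2 * a) < -1 := by linarith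
  calc ∫⁻ t in Ioi (1 : ℝ), f t ^ 2
      ≤ ∫⁻ t in Ioi (1 : ℝ), ENNReal.ofReal (A ^ 2 * t ^ (-(2 * a))) := by
        refine setLIntegral_mono' measurableSet_Ioi fun t ht => ?_
        have ht1 : (1 : ℝ) ≤ t := le_of_lt ht
        have ht0 : 0 < t := by linarith
        refine (pow_le_pow_left' (hf t ht1) 2).trans ?_
        -- No sign is assumed on `A`; if it is negative, the hypothesis forces `f t = 0`.
        rcases le_total 0 (A * t ^ (-a)) with h | h
        · rw [← ENNReal.ofReal_pow h, mul_pow, ← Real.rpow_natCast (t ^ (-a)),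
            ← Real.rpow_mul ht0.le]
          refine ENNReal.ofReal_le_ofReal (le_of_eq ?_)
          congr 2
          push_cast
          ring
        · rw [ENNReal.ofReal_of_nonpos h]
          simp
    _ = ENNReal.ofReal (∫ t in Ioi (1 : ℝ), A ^ 2 * t ^ (-(2 * a))) := by
        refine (ofReal_integral_eq_lintegral_ofReal
          ((integrableOn_Ioi_rpow_of_lt ha' one_pos).const_mul _) ?_).symm
        filter_upwards [ae_restrict_mem measurableSet_Ioi] with t ht
        have : (0 : ℝ) < t := one_pos.trans ht
        simp only [Pi.zero_apply]
        positivity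
    _ = _ := by
        rw [integral_const_mul, integral_Ioi_rpow_of_lt ha' one_pos, Real.one_rpow]
        congr 2
        rw [neg_div, ← div_neg, inv_eq_one_div]
        congr 1
        ring

end Hartree

end

theorem theorem4 (χ : ℝ → ℝ) (hχ : Hartree.IsDecreasingCutoff χ) (M E : ℝ) :
    ∃ C : ℝ, ∀ (φ₀ : Hartree.E3 → ℂ) (φ : ℝ → Hartree.E3 → ℂ),
      Hartree.IsGlobalSmoothSolution (Hartree.potential χ) φ₀ φ →
      eLpNorm φ₀ 2 volume ≤ ENNReal.ofReal M →
      Integrable (Hartree.pseudoconformalDensity (Hartree.potential χ) φ 1) volume →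
      Hartree.pseudoconformalEnergy (Hartree.potential χ) φ 1 ≤ E →
        (∀ t : ℝ, 1 ≤ t →
          eLpNorm (φ t) 6 volume ≤ ENNReal.ofReal (C * t ^ (-(3 / 4) : ℝ))) ∧
        (∀ t : ℝ, 1 ≤ t →
          eLpNorm (φ t) 4 volume ≤ ENNReal.ofReal (C * t ^ (-(9 / 16) : ℝ))) ∧
        (∫⁻ t in Ioi (1 : ℝ), eLpNorm (φ t) 6 volume ^ 2) ≤ ENNReal.ofReal C ∧
        (∫⁻ t in Ioi (1 : ℝ), eLpNorm (φ t) 4 volume ^ 2) ≤ ENNReal.ofReal C := by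
  obtain ⟨S, hS⟩ := Hartree.exists_lintegral_pow_six_le
  set A := Hartree.sixthPowerConst χ S M E ^ (1 / 6 : ℝ)
  set B := (max M 0 ^ 2 * Hartree.sixthPowerConst χ S M E) ^ (1 / 8 : ℝ)
  -- One constant serves all four bounds. The last two entries are the integrals of `t^{-2a}` over
  -- `(1, ∞)` with `2a = 3/2` and `2a = 9/8`, both above one.
  set C := max (max A B) (max (A ^ 2 * (2 * (3 / 4) - 1)⁻¹) (B ^ 2 * (2 * (9 / 16) - 1)⁻¹))
  refine ⟨C, fun φ₀ φ hφ hM hi hE => ?_⟩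
  have h6 := fun (t : ℝ) (ht : 1 ≤ t) => Hartree.eLpNorm_six_le hχ hφ hS hM hi hE ht
  have h4 := fun (t : ℝ) (ht : 1 ≤ t) => Hartree.eLpNorm_four_le hχ hφ hS hM hi hE ht
  have hA : A ≤ C := (le_max_left _ _).trans (le_max_left _ _)
  have hB : B ≤ C := (le_max_right _ _).trans (le_max_left _ _)
  refine ⟨fun t ht => (h6 t ht).trans (ENNReal.ofReal_le_ofReal ?_),
    fun t ht => (h4 t ht).trans (ENNReal.ofReal_le_ofReal ?_),
    (Hartree.lintegral_Ioi_sq_le (by norm_num) h6).trans (ENNReal.ofReal_le_ofReal ?_),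
    (Hartree.lintegral_Ioi_sq_le (by norm_num) h4).trans (ENNReal.ofReal_le_ofReal ?_)⟩
  · exact mul_le_mul_of_nonneg_right hA (Real.rpow_nonneg (by linarith) _)
  · exact mul_le_mul_of_nonneg_right hB (Real.rpow_nonneg (by linarith) _)
  · exact (le_max_left _ _).trans (le_max_right _ _)
  · exact (le_max_right _ _).trans (le_max_right _ _)
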